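/- For a positive integer $m$ and a real $\alpha\ge 0$, let the Hilbert--Schmidt ensemble be the probability measure with density proportional to $\delta\big(1-\sum_{i=1}^m\lambda_i\big)\prod_{i<j}(\lambda_i-\lambda_j)^2\prod_i\lambda_i^{\alpha}$ on $(0,\infty)^m$, and the Wishart--Laguerre ensemble the one with density proportional to $\prod_{i<j}(x_i-x_j)^2\prod_i x_i^{\alpha}e^{-x_i}$ on $(0,\infty)^m$. Let $S=-\sum_i\lambda_i\ln\lambda_i$ be the von Neumann entropy over the former, with cumulants $\kappa_l(S)=\frac{d^l}{dt^l}\ln\mathbb E[e^{tS}]\big|_{t=0}$. Over the latter let $R_k=\sum_i x_i^k$ and $T_k=\sum_i x_i^k\ln x_i$, with means $\kappa(R_k)$, $\kappa(T_k)$. Let $\psi_k(z)=\frac{d^{k+1}}{dz^{k+1}}\ln\Gamma(z)$ be the polygamma functions and $(z)_l=z(z+1)\cdots(z+l-1)$. (i) Let $l\ge1$. With $\alpha=n-m$, the terms of $\kappa_l(S)$ involving the polygamma function $\psi_{l-1}$ of highest order are $$(-1)^{l-1}\left(\psi_{l-1}(mn)-\frac{\kappa(R_l)}{(mn)_l}\,\psi_{l-1}(n)\right),$$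 in the following sense: there are a polynomial $P$ in $m$, $n$ and the quantities $\psi_j(mn)$, $\psi_j(n)$, $0\le j\le l-2$, and a polynomial $D$ in $m$, $n$, both with rational coefficients and depending only on $l$, such that for every integer $m\ge1$ and every real $n\ge m$ one has $D(m,n)\ne0$ and $$\kappa_l(S)=(-1)^{l-1}\left(\psi_{l-1}(mn)-\frac{\kappa(R_l)}{(mn)_l}\,\psi_{l-1}(n)\right)+\frac{P\big(m,n,(\psi_j(mn))_{j\le l-2},(\psi_j(n))_{j\le l-2}\big)}{D(m,n)}.$$ (ii) For every integer $k\ge1$ there are polynomials $A_k,\Lambda_k$ in two variables with rational coefficients such that, for all integers $m\ge1$ and reals $\alpha\ge0$, $R_k$ and $T_k$ are integrable and $$\kappa(R_k)=A_k(m,\alpha),\qquad \kappa(T_k)=\kappa(R_k)\,\psi_0(m+\alpha)+\Lambda_k(m,\alpha).$$ -/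

import Mathlib

open MeasureTheory ProbabilityTheory

noncomputable section

namespace EntanglementEntropy

/-- The `k`-th polygamma function `ψ_k(z) = d^{k+1}/dz^{k+1} ln Γ(z)` (used for `z > 0`). -/
def polygamma (k : ℕ) (z : ℝ) : ℝ :=
  iteratedDeriv (k + 1) (fun y : ℝ => Real.log (Real.Gamma y)) z

/-- The squared Vandermonde product `∏_{i<j} (x_i - x_j)^2`. -/
def vandermondeSq {m : ℕ} (x : Fin m → ℝ) : ℝ :=
  ∏ i : Fin m, ∏ j ∈ Finset.Ioi i, (x i - x j) ^ 2

/-- Rescaling of a measure to total mass one. -/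
def normalize {Ω : Type*} [MeasurableSpace Ω] (μ : Measure Ω) : Measure Ω :=
  (μ Set.univ)⁻¹ • μ

open Classical in
/-- The unnormalized Wishart-Laguerre density
`∏_{i<j} (x_i - x_j)^2 ∏_i x_i^α e^{-x_i}` on the positive orthant. -/
def wishartWeight (m : ℕ) (α : ℝ) (x : Fin m → ℝ) : ℝ :=
  if ∀ i, 0 < x i then vandermondeSq x * ∏ i, (x i ^ α * Real.exp (-x i)) else 0

/-- The Wishart-Laguerre ensemble of `m` eigenvalues with parameter `α`. -/
def wishartLaguerre (m : ℕ) (α : ℝ) : Measure (Fin m → ℝ) :=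
  normalize (volume.withDensity fun x => ENNReal.ofReal (wishartWeight m α x))

/-- The point of the hyperplane `∑ λ_i = 1` with first `m - 1` coordinates `y` (for `m ≥ 1`). -/
def hyperplanePoint (m : ℕ) (y : Fin (m - 1) → ℝ) : Fin m → ℝ :=
  fun i => if h : (i : ℕ) < m - 1 then y ⟨i, h⟩ else 1 - ∑ j, y j

/-- The measure `δ(1 - ∑ λ_i) dλ_1 ⋯ dλ_m`: the last variable is integrated out against the
delta function, the other `m - 1` carry Lebesgue measure. -/
def deltaHyperplane (m : ℕ) : Measure (Fin m → ℝ) :=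
  (volume : Measure (Fin (m - 1) → ℝ)).map (hyperplanePoint m)

open Classical in
/-- The factor `∏_{i<j} (λ_i - λ_j)^2 ∏_i λ_i^α` on the positive orthant. -/
def hilbertSchmidtWeight (m : ℕ) (α : ℝ) (x : Fin m → ℝ) : ℝ :=
  if ∀ i, 0 < x i then vandermondeSq x * ∏ i, x i ^ α else 0

/-- The Hilbert-Schmidt ensemble: the probability measure proportional to
`δ(1 - ∑ λ_i) ∏_{i<j} (λ_i - λ_j)^2 ∏_i λ_i^α`. -/
def hilbertSchmidt (m : ℕ) (α : ℝ) : Measure (Fin m → ℝ) :=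
  normalize ((deltaHyperplane m).withDensity
    fun x => ENNReal.ofReal (hilbertSchmidtWeight m α x))

/-- The von Neumann entropy `S = -∑ λ_i ln λ_i`. -/
def vonNeumannEntropy {m : ℕ} (x : Fin m → ℝ) : ℝ :=
  -∑ i, x i * Real.log (x i)

/-- The linear statistic `R_k = ∑ x_i^k`. -/
def statR (k : ℕ) {m : ℕ} (x : Fin m → ℝ) : ℝ := ∑ i, x i ^ k

/-- The linear statistic `T_k = ∑ x_i^k ln x_i`. -/
def statT (k : ℕ) {m : ℕ} (x : Fin m → ℝ) : ℝ := ∑ i, x i ^ k * Real.log (x i)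

/-- The `l`-th cumulant of `X`: the `l`-th derivative at `0` of `t ↦ ln E[e^{tX}]`. -/
def cumulant {Ω : Type*} [MeasurableSpace Ω] (X : Ω → ℝ) (μ : Measure Ω) (l : ℕ) : ℝ :=
  iteratedDeriv l (cgf X μ) 0

/-- The mean `κ(R_k)` over the Wishart-Laguerre ensemble. -/
def meanR (k m : ℕ) (α : ℝ) : ℝ := ∫ x, statR k x ∂(wishartLaguerre m α)

/-- The mean `κ(T_k)` over the Wishart-Laguerre ensemble. -/
def meanT (k m : ℕ) (α : ℝ) : ℝ := ∫ x, statT k x ∂(wishartLaguerre m α)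

/-- A rational expression in `m`, `n` and the polygamma values `ψ_j(mn)`, `ψ_j(n)`, `j < r`:
the quotient `P / D`, where `P` is a polynomial in all of these quantities and `D` is a polynomial
in `m`, `n` only. -/
def polygammaExpr (r : ℕ) (P : MvPolynomial (Fin 2 ⊕ (Fin r ⊕ Fin r)) ℚ)
    (D : MvPolynomial (Fin 2) ℚ) (m n : ℝ) : ℝ :=
  MvPolynomial.aeval (Sum.elim ![m, n]
      (Sum.elim (fun j : Fin r => polygamma j (m * n)) (fun j : Fin r => polygamma j n))) P
    / MvPolynomial.aeval ![m, n] D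

end EntanglementEntropy

end

/-! The Laguerre weight is deformed to `x ^ α * exp (-x + t x ln x)`. Its moments are treated
formally, as power series in `t` and in an increment of `α`, so convergence in `t` plays no role.
Write `D = ∂_t` and `E = ∂_α`. The moments satisfy `D c_k = E c_{k+1}` together with an
integration-by-parts identity (`isDeformed_wishartMoment`), and all later relations are algebra over
orthogonal polynomials with coefficients in this ring. By Andréief's identity the moment series of
`T_1` is a normalized Hankel determinant. Its logarithmic derivative is therefore the deformed mean
of `T_1` (`derivative_momentSeries_statT`), whose `t ^ p` coefficient times `p!` is the cumulant of
`T_1` of order `p + 1`.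

The central point is a decoupling of covariances. `D` of the mean of `T_a` and `E` of the mean of
`T_{a+1}` differ only by double sums of matrix elements. Two uses of Christoffel-Darboux collapse
these to finitely many products of diagonal and off-diagonal elements (`decouple_log`,
`decouple_pow`). Scaling relations express those elements through the means themselves, which closes
the system (`isCumulantSystem_wishart`). Filter by `𝓕 r`, the rational algebra generated by `m`,
`n`, `1/n` and `ψ_j(n)` with `j < r`; `E` raises the step by one. The `t ^ p` coefficients lie in `𝓕
(p + 1)`, and modulo lower steps one more order in `t` amounts to one more derivative in `α`. Hence
the cumulant of `T_1` of order `p + 1` is `κ(R_{p+1}) ψ_p(n)` modulo `𝓕 p` (`leading_coeff`). The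
induction starts at `t = 0`, where linear recurrences show that each logarithmic mean is `ψ_0(n)`
times its power counterpart up to a polynomial (`IsMeanSystem.mem`); this is also part (ii).

The passage to the entropy uses that a Wishart vector is `r λ`, with `λ` Hilbert-Schmidt distributed
and `r` an independent gamma variable of parameter `mn` (`wishartUnnormalized_eq_map`), and that
`T_1 = r ln r - r S`. The moments of `T_1` are triangular in those of `S`, with diagonal entries
`(-1) ^ l (mn)_l`, while the logarithmic moments of `r` contribute `(mn)_l ψ_{l-1}(mn)`
(`entropyMoment_mem`). Moments and cumulants differ by products of lower order, so they share the
leading term (`entropyCumulant_mem`).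

Uniformity in `m` and `n` comes from working in a ring of functions on the set of all admissible
pairs: membership in a rational subalgebra yields one expression valid for every pair. -/

namespace EntanglementEntropy

open Polynomial Finset

/-! ### Moment functionals, derivations on coefficients, and formal integration by parts. -/

section MomentFunctional

variable {R : Type*} [CommRing R]

/-- The linear functional on polynomials with moments `c k` on `X ^ k`. -/
noncomputable def momentFunctional (c : ℕ → R) : R[X] →ₗ[R] R :=
  Polynomial.lsum fun k => LinearMap.toSpanSingleton R R (c k)

@[simp]
lemma momentFunctional_monomial (c : ℕ → R) (k : ℕ) (a : R) :
    momentFunctional c (monomial k a) = a * c k := by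
  simp [momentFunctional, Polynomial.lsum, Polynomial.sum_monomial_index]

lemma momentFunctional_C_mul (c : ℕ → R) (a : R) (g : R[X]) :
    momentFunctional c (C a * g) = a * momentFunctional c g := by
  rw [← smul_eq_C_mul, map_smul, smul_eq_mul]

/-- The derivation of `R[X]` which applies a derivation of `R` to the coefficients. -/
noncomputable def coeffDerivation (δ : Derivation ℤ R R) : Derivation ℤ R[X] R[X] :=
  Derivation.mk'
    (Polynomial.lsum fun k => ((monomial k : R →ₗ[R] R[X]).restrictScalars ℤ) ∘ₗ δ.toLinearMap)
    (by
      intro p q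
      induction p using Polynomial.induction_on' with
      | add p₁ p₂ h₁ h₂ => simp only [add_mul, map_add, h₁, h₂, add_smul, smul_add]; ring
      | monomial i a =>
        induction q using Polynomial.induction_on' with
        | add q₁ q₂ h₁ h₂ => simp only [mul_add, map_add, h₁, h₂, add_smul, smul_add]; ring
        | monomial j b =>
          simp [Polynomial.lsum, Polynomial.sum_monomial_index, monomial_mul_monomial, add_comm])

@[simp]
lemma coeffDerivation_monomial (δ : Derivation ℤ R R) (k : ℕ) (a : R) :
    coeffDerivation δ (monomial k a) = monomial k (δ a) := by
  simp [coeffDerivation, Polynomial.lsum, Polynomial.sum_monomial_index]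

@[simp]
lemma coeff_coeffDerivation (δ : Derivation ℤ R R) (g : R[X]) (i : ℕ) :
    (coeffDerivation δ g).coeff i = δ (g.coeff i) := by
  induction g using Polynomial.induction_on' with
  | add p q hp hq => simp [hp, hq]
  | monomial k a => simp only [coeffDerivation_monomial, coeff_monomial]; split_ifs <;> simp

lemma derivation_momentFunctional (δ : Derivation ℤ R R) (c : ℕ → R) (g : R[X]) :
    δ (momentFunctional c g)
      = momentFunctional (fun k => δ (c k)) g + momentFunctional c (coeffDerivation δ g) := by
  induction g using Polynomial.induction_on' with
  | add p q hp hq => simp only [map_add, hp, hq]; ring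
  | monomial k a => simp; ring

lemma momentFunctional_shift (c : ℕ → R) (a : ℕ) (g : R[X]) :
    momentFunctional (fun k => c (k + a)) g = momentFunctional c (X ^ a * g) := by
  induction g using Polynomial.induction_on' with
  | add p q hp hq => simp only [map_add, hp, hq, mul_add]
  | monomial k b => simp [X_pow_mul_monomial]

/-- The derivation `x ∂_x - t D` of `R[X]`. -/
noncomputable def scalingDerivation (D : Derivation ℤ R R) (t : R) : Derivation ℤ R[X] R[X] :=
  (X : R[X]) • (Polynomial.derivative' (R := R)).restrictScalars ℤ
    - (C t : R[X]) • coeffDerivation D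

lemma coeff_scalingDerivation (D : Derivation ℤ R R) (t : R) (g : R[X]) (i : ℕ) :
    (scalingDerivation D t g).coeff i = i * g.coeff i - t * D (g.coeff i) := by
  have h1 : scalingDerivation D t g = X * derivative g - C t * coeffDerivation D g := rfl
  rw [h1, coeff_sub, coeff_C_mul, coeff_coeffDerivation]
  cases i with
  | zero => simp
  | succ i => simp [coeff_X_mul, coeff_derivative]; ring

lemma scalingDerivation_monomial (D : Derivation ℤ R R) (t : R) (k : ℕ) (a : R) :
    scalingDerivation D t (monomial k a) = monomial k (k * a - t * D a) := by
  ext i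
  rw [coeff_scalingDerivation]
  simp only [coeff_monomial]
  split_ifs with h
  · subst h; rfl
  · simp

lemma scalingDerivation_X_pow_mul (D : Derivation ℤ R R) (t : R) (a : ℕ) (g : R[X]) :
    scalingDerivation D t (X ^ a * g)
      = C (a : R) * (X ^ a * g) + X ^ a * scalingDerivation D t g := by
  have : scalingDerivation D t (X ^ a) = C (a : R) * X ^ a := by
    rw [X_pow_eq_monomial, scalingDerivation_monomial, C_mul_monomial]; simp
  simp [this]; ring

/-- Integration by parts: the moment sequence `φ` scales under `(t, x)` with source `σ`. -/
def ScalesWith (D : Derivation ℤ R R) (t α : R) (φ σ : ℕ → R) : Prop :=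
  ∀ k : ℕ, (1 - t) * φ (k + 1) = (k + 1 + α) * φ k + σ k + t * D (φ k)

lemma ScalesWith.momentFunctional {D : Derivation ℤ R R} {t α : R} {φ σ : ℕ → R}
    (h : ScalesWith D t α φ σ) (g : R[X]) :
    (1 - t) * momentFunctional φ (X * g)
      = momentFunctional φ (scalingDerivation D t g) + (1 + α) * momentFunctional φ g
        + momentFunctional σ g + t * D (momentFunctional φ g) := by
  induction g using Polynomial.induction_on' with
  | add p q hp hq =>
    simp only [map_add, mul_add] at *
    linear_combination hp + hq
  | monomial k a =>
    have := h k
    simp only [X_mul_monomial, momentFunctional_monomial, scalingDerivation_monomial,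
      Derivation.leibniz, smul_eq_mul]
    linear_combination a * this

end MomentFunctional

/-! ### Orthogonal polynomials over a commutative ring. -/

section OrthogonalPolynomials

variable {R : Type*} [CommRing R]

/-- Monic orthogonal polynomials `π k` of the functional with moments `c`, with invertible square
norms `h k`. -/
structure IsOPS (c : ℕ → R) (π : ℕ → R[X]) (h hi : ℕ → R) : Prop where
  coeff_self : ∀ k, (π k).coeff k = 1
  coeff_gt : ∀ k i, k < i → (π k).coeff i = 0
  orth : ∀ j k, j ≠ k → momentFunctional c (π j * π k) = 0
  norm : ∀ k, momentFunctional c (π k * π k) = h k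
  inv : ∀ k, h k * hi k = 1

/-- The matrix elements of `x ^ a` for the functional with moments `φ`. -/
noncomputable def matElt (φ : ℕ → R) (π : ℕ → R[X]) (a j k : ℕ) : R :=
  momentFunctional φ (X ^ a * (π j * π k))

/-- The first recurrence coefficient. -/
noncomputable def recDiag (c : ℕ → R) (π : ℕ → R[X]) (hi : ℕ → R) (k : ℕ) : R :=
  hi k * matElt c π 1 k k

/-- The second recurrence coefficient. -/
def recOff (h hi : ℕ → R) : ℕ → R
  | 0 => 0
  | k + 1 => h (k + 1) * hi k

lemma matElt_comm (φ : ℕ → R) (π : ℕ → R[X]) (a j k : ℕ) :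
    matElt φ π a j k = matElt φ π a k j := by
  rw [matElt, matElt, mul_comm (π j)]

namespace IsOPS

variable {c : ℕ → R} {π : ℕ → R[X]} {h hi : ℕ → R} (H : IsOPS c π h hi)
include H

lemma expand (m : ℕ) : ∀ g : R[X], (∀ i, m ≤ i → g.coeff i = 0) →
    ∃ b : ℕ → R, g = ∑ k ∈ range m, C (b k) * π k := by
  induction m with
  | zero =>
    intro g hg
    exact ⟨0, by ext i; simpa using hg i (Nat.zero_le i)⟩
  | succ m ih =>
    intro g hg
    obtain ⟨b, hb⟩ := ih (g - C (g.coeff m) * π m) (by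
      intro i hi'
      rw [coeff_sub, coeff_C_mul]
      rcases hi'.eq_or_lt with rfl | hlt
      · simp [H.coeff_self]
      · simp [H.coeff_gt m i hlt, hg i hlt])
    refine ⟨Function.update b m (g.coeff m), ?_⟩
    rw [sum_range_succ, Function.update_self]
    have : ∑ k ∈ range m, C (Function.update b m (g.coeff m) k) * π k
        = ∑ k ∈ range m, C (b k) * π k := by
      refine sum_congr rfl fun k hk => ?_
      rw [Function.update_of_ne (mem_range.mp hk).ne]
    rw [this, ← hb]; ring

lemma functional_eq_zero {m : ℕ} {g : R[X]} (hg : ∀ i, m ≤ i → g.coeff i = 0) :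
    momentFunctional c (g * π m) = 0 := by
  obtain ⟨b, rfl⟩ := H.expand m g hg
  rw [sum_mul, map_sum]
  refine sum_eq_zero fun k hk => ?_
  rw [mul_assoc, momentFunctional_C_mul, H.orth k m (mem_range.mp hk).ne, mul_zero]

lemma eq_sum {m : ℕ} {g : R[X]} (hg : ∀ i, m ≤ i → g.coeff i = 0) :
    g = ∑ k ∈ range m, C (hi k * momentFunctional c (g * π k)) * π k := by
  obtain ⟨b, hb⟩ := H.expand m g hg
  have key : ∀ k ∈ range m, hi k * momentFunctional c (g * π k) = b k := by
    intro k hk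
    have : momentFunctional c (g * π k) = b k * h k := by
      conv_lhs => rw [hb]
      rw [sum_mul, map_sum, sum_eq_single k]
      · rw [mul_assoc, momentFunctional_C_mul, H.norm]
      · intro j _ hj
        rw [mul_assoc, momentFunctional_C_mul, H.orth j k hj, mul_zero]
      · intro hk'; exact absurd hk hk'
    rw [this]; linear_combination b k * H.inv k
  conv_lhs => rw [hb]
  exact sum_congr rfl fun k hk => by rw [key k hk]

lemma eq_zero {m : ℕ} {g : R[X]} (hg : ∀ i, m ≤ i → g.coeff i = 0)
    (h0 : ∀ k, k < m → momentFunctional c (g * π k) = 0) : g = 0 := by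
  rw [H.eq_sum hg]
  exact sum_eq_zero fun k hk => by rw [h0 k (mem_range.mp hk)]; simp

lemma pi_zero : π 0 = 1 := by
  ext i
  rcases Nat.eq_zero_or_pos i with rfl | hi'
  · simp [H.coeff_self]
  · rw [H.coeff_gt 0 i hi', coeff_one, if_neg hi'.ne']

lemma matElt_one_eq_zero {j k : ℕ} (hjk : j + 1 < k) : matElt c π 1 j k = 0 := by
  rw [matElt, pow_one, ← mul_assoc]
  refine H.functional_eq_zero fun i hi' => ?_
  obtain ⟨i, rfl⟩ : ∃ i', i = i' + 1 := ⟨i - 1, by omega⟩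
  rw [coeff_X_mul, H.coeff_gt j i (by omega)]

lemma matElt_one_succ (k : ℕ) : matElt c π 1 k (k + 1) = h (k + 1) := by
  have : momentFunctional c ((X * π k - π (k + 1)) * π (k + 1)) = 0 := by
    refine H.functional_eq_zero fun i hi' => ?_
    obtain ⟨i, rfl⟩ : ∃ i', i = i' + 1 := ⟨i - 1, by omega⟩
    rw [coeff_sub, coeff_X_mul]
    rcases (Nat.succ_le_succ_iff.mp hi').eq_or_lt with rfl | hlt
    · simp [H.coeff_self]
    · rw [H.coeff_gt _ _ hlt, H.coeff_gt _ _ (by omega), sub_zero]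
  rw [sub_mul, map_sub, H.norm, mul_assoc, sub_eq_zero] at this
  rw [matElt, pow_one, this]

lemma matElt_zero_of_ne {j k : ℕ} (hjk : j ≠ k) : matElt c π 0 j k = 0 := by
  rw [matElt, pow_zero, one_mul, H.orth j k hjk]

lemma matElt_zero_self (k : ℕ) : matElt c π 0 k k = h k := by
  rw [matElt, pow_zero, one_mul, H.norm]

/-- The defect has degree at most `k` and is orthogonal to `π 0, ..., π k`, hence vanishes. At `k =
0` the truncated index `k - 1` is harmless because `recOff` is zero there. -/
lemma three_term (k : ℕ) :
    X * π k = π (k + 1) + C (recDiag c π hi k) * π k + C (recOff h hi k) * π (k - 1) := by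
  rw [← sub_eq_zero]
  refine H.eq_zero (m := k + 1) (fun i hi' => ?_) (fun j hj => ?_)
  · obtain ⟨i, rfl⟩ : ∃ i', i = i' + 1 := ⟨i - 1, by omega⟩
    have h1 : (C (recDiag c π hi k) * π k).coeff (i + 1) = 0 := by
      rw [coeff_C_mul, H.coeff_gt _ _ (by omega), mul_zero]
    have h2 : (C (recOff h hi k) * π (k - 1)).coeff (i + 1) = 0 := by
      rw [coeff_C_mul, H.coeff_gt _ _ (by omega), mul_zero]
    rw [coeff_sub, coeff_add, coeff_add, h1, h2, coeff_X_mul]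
    rcases (Nat.succ_le_succ_iff.mp hi').eq_or_lt with rfl | hlt
    · simp [H.coeff_self]
    · rw [H.coeff_gt _ _ hlt, H.coeff_gt _ _ (by omega)]; simp
  · rw [sub_mul, add_mul, add_mul, map_sub, map_add, map_add, mul_assoc, mul_assoc, mul_assoc,
      momentFunctional_C_mul, momentFunctional_C_mul, H.orth (k + 1) j (by omega)]
    have e : momentFunctional c (X * (π k * π j)) = matElt c π 1 j k := by
      rw [matElt, pow_one, mul_comm (π k)]
    rw [e]
    rcases (Nat.lt_succ_iff.mp hj).eq_or_lt with rfl | hlt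
    · rw [H.norm, recDiag]
      rcases Nat.eq_zero_or_pos j with rfl | hpos
      · simp only [recOff]; linear_combination -(matElt c π 1 0 0) * H.inv 0
      · rw [H.orth (j - 1) j (by omega)]; linear_combination -(matElt c π 1 j j) * H.inv j
    · obtain ⟨k, rfl⟩ : ∃ k', k = k' + 1 := ⟨k - 1, by omega⟩
      rw [H.orth (k + 1) j (by omega), Nat.add_sub_cancel]
      rcases (Nat.lt_succ_iff.mp hlt).eq_or_lt with rfl | hlt'
      · rw [H.matElt_one_succ, H.norm, recOff]; linear_combination -h (j + 1) * H.inv j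
      · rw [H.matElt_one_eq_zero (by omega), H.orth k j (by omega)]; ring

/-- The Christoffel-Darboux formula for a pair of functionals. -/
lemma christoffel_darboux (f g : R[X] →ₗ[R] R) (k : ℕ) :
    ∑ j ∈ range (k + 1), hi j * (f (X * π j) * g (π j) - f (π j) * g (X * π j))
      = hi k * (f (π (k + 1)) * g (π k) - f (π k) * g (π (k + 1))) := by
  have ht : ∀ (f : R[X] →ₗ[R] R) (k : ℕ), f (X * π k)
      = f (π (k + 1)) + recDiag c π hi k * f (π k) + recOff h hi k * f (π (k - 1)) := by
    intro f k
    rw [H.three_term k, map_add, map_add, ← smul_eq_C_mul, ← smul_eq_C_mul, map_smul, map_smul,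
      smul_eq_mul, smul_eq_mul]
  induction k with
  | zero => rw [sum_range_one, ht, ht]; simp only [recOff]; ring
  | succ k ih =>
    rw [sum_range_succ, ih, ht, ht, Nat.add_sub_cancel, recOff]
    linear_combination (hi k * (f (π k) * g (π (k + 1)) - f (π (k + 1)) * g (π k)))
      * H.inv (k + 1)

end IsOPS

end OrthogonalPolynomials

end EntanglementEntropy

namespace EntanglementEntropy

open Polynomial Finset

/-! ### Means of linear statistics as sums of matrix elements. -/

section Statistics

variable {R : Type*} [CommRing R]

/-- The increment in the number of eigenvalues of the mean of a linear statistic. -/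
noncomputable def diagElt (φ : ℕ → R) (π : ℕ → R[X]) (hi : ℕ → R) (a k : ℕ) : R :=
  hi k * matElt φ π a k k

/-- The covariance of a linear statistic with the trace. -/
noncomputable def offElt (φ : ℕ → R) (π : ℕ → R[X]) (hi : ℕ → R) (a : ℕ) : ℕ → R
  | 0 => 0
  | k + 1 => hi k * matElt φ π a k (k + 1)

/-- The mean of a linear statistic. -/
noncomputable def linStat (φ : ℕ → R) (π : ℕ → R[X]) (hi : ℕ → R) (a m : ℕ) : R :=
  ∑ k ∈ range m, diagElt φ π hi a k

lemma matElt_zero_seq (π : ℕ → R[X]) (a j k : ℕ) : matElt (0 : ℕ → R) π a j k = 0 := by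
  have : momentFunctional (0 : ℕ → R) = 0 := by
    ext k; simp
  rw [matElt, this]; rfl

@[simp]
lemma diagElt_zero_seq (π : ℕ → R[X]) (hi : ℕ → R) (a k : ℕ) :
    diagElt (0 : ℕ → R) π hi a k = 0 := by
  rw [diagElt, matElt_zero_seq, mul_zero]

@[simp]
lemma offElt_zero_seq (π : ℕ → R[X]) (hi : ℕ → R) (a k : ℕ) :
    offElt (0 : ℕ → R) π hi a k = 0 := by
  cases k with
  | zero => rfl
  | succ k => rw [offElt, matElt_zero_seq, mul_zero]

lemma matElt_def (φ : ℕ → R) (π : ℕ → R[X]) (a j k : ℕ) :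
    matElt φ π a j k = momentFunctional φ (X ^ a * (π j * π k)) := rfl

namespace IsOPS

variable {c : ℕ → R} {π : ℕ → R[X]} {h hi : ℕ → R} (H : IsOPS c π h hi)
include H

lemma coeffDerivation_coeff (δ : Derivation ℤ R R) (k i : ℕ) (hik : k ≤ i) :
    (coeffDerivation δ (π k)).coeff i = 0 := by
  rw [coeff_coeffDerivation]
  rcases hik.eq_or_lt with rfl | hlt
  · rw [H.coeff_self, Derivation.map_one_eq_zero]
  · rw [H.coeff_gt _ _ hlt, map_zero]

/-- Differentiate the orthogonality relation of `π k` and `π j`; the term containing the derivative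
of `π j` drops out by degree. -/
lemma functional_coeffDerivation (δ : Derivation ℤ R R) {j k : ℕ} (hjk : j < k) :
    momentFunctional c (coeffDerivation δ (π k) * π j)
      = - momentFunctional (fun i => δ (c i)) (π k * π j) := by
  have h1 := derivation_momentFunctional δ c (π k * π j)
  have h2 : momentFunctional c (coeffDerivation δ (π j) * π k) = 0 :=
    H.functional_eq_zero fun i hi' => H.coeffDerivation_coeff δ j i (by omega)
  rw [H.orth k j hjk.ne', map_zero, Derivation.leibniz, map_add, smul_eq_mul, smul_eq_mul,
    mul_comm (π k) (coeffDerivation δ (π j)), h2, mul_comm (π j)] at h1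
  linear_combination -h1

lemma coeffDerivation_pi (δ : Derivation ℤ R R) (k : ℕ) :
    coeffDerivation δ (π k)
      = - ∑ j ∈ range k, C (hi j * momentFunctional (fun i => δ (c i)) (π k * π j)) * π j := by
  conv_lhs => rw [H.eq_sum (H.coeffDerivation_coeff δ k)]
  rw [← sum_neg_distrib]
  refine sum_congr rfl fun j hj => ?_
  rw [H.functional_coeffDerivation δ (mem_range.mp hj)]
  simp

lemma derivation_norm (δ : Derivation ℤ R R) (k : ℕ) :
    δ (h k) = momentFunctional (fun i => δ (c i)) (π k * π k) := by
  have h2 : momentFunctional c (coeffDerivation δ (π k) * π k) = 0 :=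
    H.functional_eq_zero fun i hi' => H.coeffDerivation_coeff δ k i hi'
  rw [← H.norm k, derivation_momentFunctional δ c (π k * π k), Derivation.leibniz, map_add,
    smul_eq_mul, mul_comm (π k) (coeffDerivation δ (π k)), h2, add_zero, add_zero]

lemma derivation_inv (δ : Derivation ℤ R R) (k : ℕ) :
    δ (hi k) = - (hi k) ^ 2 * δ (h k) := by
  have := Derivation.leibniz_of_mul_eq_one δ (a := hi k) (b := h k) (by rw [mul_comm, H.inv])
  rw [this, smul_eq_mul]

/-- The derivative of the mean of a linear statistic is a covariance. -/
lemma derivation_sum (δ : Derivation ℤ R R) (y : ℕ → R) (m : ℕ) :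
    δ (∑ k ∈ range m, hi k * momentFunctional y (π k * π k))
      = ∑ k ∈ range m, hi k * momentFunctional (fun i => δ (y i)) (π k * π k)
        - ∑ j ∈ range m, ∑ k ∈ range m, hi j * (hi k *
            (momentFunctional (fun i => δ (c i)) (π j * π k) * momentFunctional y (π j * π k))) := by
  induction m with
  | zero => simp
  | succ m ih =>
    have e1 : momentFunctional y (π m * coeffDerivation δ (π m))
        = - ∑ j ∈ range m, hi j * (momentFunctional (fun i => δ (c i)) (π j * π m)
            * momentFunctional y (π j * π m)) := by
      rw [H.coeffDerivation_pi δ m, mul_neg, map_neg, mul_sum, map_sum]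
      congr 1
      refine sum_congr rfl fun j _ => ?_
      rw [mul_left_comm, momentFunctional_C_mul, mul_comm (π m) (π j)]; ring
    -- The enlarged square gains a row and an equal column, which match the two factors of `π m`
    -- being differentiated, and a corner, which matches the derivative of `hi m`.
    have e2 : ∑ j ∈ range (m + 1), ∑ k ∈ range (m + 1), hi j * (hi k *
            (momentFunctional (fun i => δ (c i)) (π j * π k) * momentFunctional y (π j * π k)))
        = ∑ j ∈ range m, ∑ k ∈ range m, hi j * (hi k *
            (momentFunctional (fun i => δ (c i)) (π j * π k) * momentFunctional y (π j * π k)))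
          + 2 * (hi m * ∑ j ∈ range m, hi j * (momentFunctional (fun i => δ (c i)) (π j * π m)
            * momentFunctional y (π j * π m)))
          + hi m * (hi m * (momentFunctional (fun i => δ (c i)) (π m * π m)
            * momentFunctional y (π m * π m))) := by
      rw [sum_range_succ, sum_range_succ]
      simp_rw [sum_range_succ]
      rw [sum_add_distrib, two_mul, mul_sum]
      have : ∀ j ∈ range m, hi m * (hi j * (momentFunctional (fun i => δ (c i)) (π m * π j)
          * momentFunctional y (π m * π j))) = hi j * (hi m *
            (momentFunctional (fun i => δ (c i)) (π j * π m)
              * momentFunctional y (π j * π m))) := by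
        intro j _
        rw [mul_comm (π m) (π j)]; ring
      rw [sum_congr rfl this]
      have : ∀ j ∈ range m, hi m * (hi j * (momentFunctional (fun i => δ (c i)) (π j * π m)
          * momentFunctional y (π j * π m))) = hi j * (hi m *
            (momentFunctional (fun i => δ (c i)) (π j * π m)
              * momentFunctional y (π j * π m))) := by
        intro j _; ring
      rw [sum_congr rfl this]; ring
    rw [sum_range_succ, map_add, ih, e2, Derivation.leibniz, derivation_momentFunctional,
      Derivation.leibniz, map_add, smul_eq_mul, smul_eq_mul, smul_eq_mul, e1, H.derivation_inv,
      H.derivation_norm, sum_range_succ]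
    ring

/-- The partial sums left over by one application of the Christoffel-Darboux formula move a power
of the variable from one functional to the other. -/
lemma partial_sum_shift (φ χ : ℕ → R) (k a b : ℕ) :
    ∑ j ∈ range (k + 1), hi j * (matElt φ π a j (k + 1) * matElt χ π b j k)
      = ∑ j ∈ range (k + 1), hi j * (matElt φ π 0 j (k + 1) * matElt χ π (a + b) j k)
        + hi k * ∑ i ∈ range a,
          (matElt φ π (a - 1 - i) (k + 1) (k + 1) * matElt χ π (b + i) k k
            - matElt φ π (a - 1 - i) k (k + 1) * matElt χ π (b + i) k (k + 1)) := by
  induction a generalizing b with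
  | zero => simp
  | succ a ih =>
    -- Each application with these two functionals carries one factor of `x` from `φ` to `χ` and
    -- leaves one boundary product.
    have h1 := H.christoffel_darboux
      (momentFunctional φ ∘ₗ LinearMap.mulLeft R (X ^ a * π (k + 1)))
      (momentFunctional χ ∘ₗ LinearMap.mulLeft R (X ^ b * π k)) k
    simp only [LinearMap.comp_apply, LinearMap.mulLeft_apply] at h1
    have r1 : ∀ j, X ^ a * π (k + 1) * (X * π j) = X ^ (a + 1) * (π j * π (k + 1)) := fun j => by
      ring
    have r2 : ∀ j, X ^ b * π k * (X * π j) = X ^ (b + 1) * (π j * π k) := fun j => by ring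
    have r3 : ∀ j, X ^ a * π (k + 1) * π j = X ^ a * (π j * π (k + 1)) := fun j => by ring
    have r4 : ∀ j, X ^ b * π k * π j = X ^ b * (π j * π k) := fun j => by ring
    simp only [r1, r2, r3, r4] at h1
    simp only [← matElt_def] at h1
    simp only [mul_sub, sum_sub_distrib] at h1
    rw [sub_eq_iff_eq_add] at h1
    rw [h1, ih (b + 1), sum_range_succ' _ a, Nat.add_sub_cancel, matElt_comm χ π b (k + 1) k]
    have r5 : ∀ i ∈ range a, (matElt φ π (a - (i + 1)) (k + 1) (k + 1) *
        matElt χ π (b + (i + 1)) k k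
        - matElt φ π (a - (i + 1)) k (k + 1) * matElt χ π (b + (i + 1)) k (k + 1))
        = (matElt φ π (a - 1 - i) (k + 1) (k + 1) * matElt χ π (b + 1 + i) k k
            - matElt φ π (a - 1 - i) k (k + 1) * matElt χ π (b + 1 + i) k (k + 1)) := by
      intro i _
      rw [show a - (i + 1) = a - 1 - i by omega, show b + (i + 1) = b + 1 + i by omega]
    rw [sum_congr rfl r5, show a + (b + 1) = a + 1 + b by omega]
    simp only [Nat.sub_zero, Nat.add_zero]
    ring

/-- Christoffel-Darboux in the index `i`, for each fixed `j`, removes one of the two summations. -/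
lemma double_sum (φ χ : ℕ → R) (k a : ℕ) :
    ∑ j ∈ range (k + 1), ∑ i ∈ range (k + 1), hi j * (hi i *
        (matElt χ π 0 j i * matElt φ π (a + 1) j i - matElt χ π 1 j i * matElt φ π a j i))
      = hi k * (∑ j ∈ range (k + 1), hi j * (matElt φ π a j (k + 1) * matElt χ π 0 j k)
          - ∑ j ∈ range (k + 1), hi j * (matElt χ π 0 j (k + 1) * matElt φ π a j k)) := by
  rw [← sum_sub_distrib, mul_sum]
  refine sum_congr rfl fun j _ => ?_
  have h1 := H.christoffel_darboux
      (momentFunctional φ ∘ₗ LinearMap.mulLeft R (X ^ a * π j))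
      (momentFunctional χ ∘ₗ LinearMap.mulLeft R (π j)) k
  simp only [LinearMap.comp_apply, LinearMap.mulLeft_apply] at h1
  have r1 : ∀ i, X ^ a * π j * (X * π i) = X ^ (a + 1) * (π j * π i) := fun i => by ring
  have r2 : ∀ i, π j * (X * π i) = X ^ 1 * (π j * π i) := fun i => by ring
  have r3 : ∀ i, X ^ a * π j * π i = X ^ a * (π j * π i) := fun i => by ring
  have r4 : ∀ i, π j * π i = X ^ 0 * (π j * π i) := fun i => by ring
  simp only [r1, r2, r3] at h1
  have r5 : ∀ i, momentFunctional χ (π j * π i) = matElt χ π 0 j i := fun i => by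
    rw [matElt, pow_zero, one_mul]
  simp only [r5] at h1
  simp only [← matElt_def] at h1
  rw [← mul_sum]
  have : ∑ i ∈ range (k + 1), hi i *
        (matElt χ π 0 j i * matElt φ π (a + 1) j i - matElt χ π 1 j i * matElt φ π a j i)
      = hi k * (matElt φ π a j (k + 1) * matElt χ π 0 j k
        - matElt φ π a j k * matElt χ π 0 j (k + 1)) := by
    rw [← h1]; exact sum_congr rfl fun i _ => by ring
  rw [this]; ring

lemma hi_mul_diag (φ : ℕ → R) (a k : ℕ) :
    matElt φ π a k k = h k * diagElt φ π hi a k := by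
  rw [diagElt]; linear_combination -(matElt φ π a k k) * H.inv k

lemma matElt_succ_eq (φ : ℕ → R) (a k : ℕ) :
    matElt φ π a k (k + 1) = h k * offElt φ π hi a (k + 1) := by
  rw [offElt]; linear_combination -(matElt φ π a k (k + 1)) * H.inv k

end IsOPS

/-- The structure of a moment sequence deformed in two directions. -/
structure IsDeformed (D E : Derivation ℤ R R) (t α : R) (c : ℕ → R) : Prop where
  comm : ∀ x, D (E x) = E (D x)
  E_t : E t = 0
  E_α : E α = 1
  shift : ∀ k, D (c k) = E (c (k + 1))
  scale : ScalesWith D t α c 0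

/-! ### Two-directional deformations: decoupling of covariances, ladder relation and scaling
recurrences. -/

namespace IsDeformed

variable {D E : Derivation ℤ R R} {t α : R} {c : ℕ → R} (K : IsDeformed D E t α c)
include K

lemma shift_E (k : ℕ) : D (E (c k)) = E (E (c (k + 1))) := by
  rw [K.comm, K.shift]

lemma scale_E : ScalesWith D t α (fun k => E (c k)) c := by
  intro k
  have h := congrArg E (K.scale k)
  simp only [Derivation.leibniz, map_sub, map_add, smul_eq_mul, Derivation.map_one_eq_zero, K.E_t,
    K.E_α, Derivation.map_natCast, Pi.zero_apply, map_zero, ← K.comm] at h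
  linear_combination h

variable {π : ℕ → R[X]} {h hi : ℕ → R} (H : IsOPS c π h hi)
include H

/-- In `derivation_sum` the two derivatives have the same single-sum part, because `D` of a moment
is `E` of the next one. Only the covariance parts differ. -/
lemma D_linStat_sub (φ : ℕ → R) (hφ : ∀ k, D (φ k) = E (φ (k + 1))) (a m : ℕ) :
    D (linStat φ π hi a m) = E (linStat φ π hi (a + 1) m)
      + ∑ j ∈ range m, ∑ i ∈ range m, hi j * (hi i *
        (matElt (fun k => E (c k)) π 0 j i * matElt φ π (a + 1) j i
          - matElt (fun k => E (c k)) π 1 j i * matElt φ π a j i)) := by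
  have h1 := H.derivation_sum D (fun k => φ (k + a)) m
  have h2 := H.derivation_sum E (fun k => φ (k + (a + 1))) m
  have e1 : (fun i => D (c i)) = fun i => (fun k => E (c k)) (i + 1) := funext K.shift
  have e2 : (fun i => D (φ (i + a))) = fun i => E (φ (i + (a + 1))) := funext fun i => hφ _
  rw [e1, e2] at h1
  simp only [momentFunctional_shift φ, momentFunctional_shift (fun k => E (c k))] at h1 h2
  have e3 : ∀ j k, momentFunctional (fun k => E (c k)) (π j * π k)
      = matElt (fun k => E (c k)) π 0 j k := fun j k => by rw [matElt, pow_zero, one_mul]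
  simp only [e3] at h2
  simp only [← matElt_def] at h1 h2
  simp only [mul_sub, sum_sub_distrib]
  simp only [linStat, diagElt]
  rw [h1, h2]; ring

/-- The decoupling of the covariances of the logarithmic statistics. -/
lemma decouple_log (a k : ℕ) :
    D (linStat (fun k => E (c k)) π hi a (k + 1))
      = E (linStat (fun k => E (c k)) π hi (a + 1) (k + 1))
        + ∑ i ∈ range a, (recOff h hi (k + 1)
            * (diagElt (fun k => E (c k)) π hi (a - 1 - i) (k + 1)
              * diagElt (fun k => E (c k)) π hi i k)
          - offElt (fun k => E (c k)) π hi (a - 1 - i) (k + 1)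
            * offElt (fun k => E (c k)) π hi i (k + 1)) := by
  rw [K.D_linStat_sub H _ K.shift_E, H.double_sum]
  -- The two functionals coincide, so transporting all `a` powers turns the first partial sum into
  -- the second. They cancel and only boundary products survive.
  have h1 := H.partial_sum_shift (fun k => E (c k)) (fun k => E (c k)) k a 0
  rw [h1, add_zero, add_sub_cancel_left, ← mul_assoc, mul_sum]
  congr 1
  refine sum_congr rfl fun i _ => ?_
  rw [zero_add, H.hi_mul_diag _ _ (k + 1), H.hi_mul_diag _ _ k, H.matElt_succ_eq, H.matElt_succ_eq,
    recOff]
  linear_combination (hi k * h (k + 1) * diagElt (fun k => E (c k)) π hi (a - 1 - i) (k + 1)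
    * diagElt (fun k => E (c k)) π hi i k - (hi k * h k + 1)
      * offElt (fun k => E (c k)) π hi (a - 1 - i) (k + 1)
      * offElt (fun k => E (c k)) π hi i (k + 1)) * H.inv k

/-- The decoupling of the covariances of a power statistic and a logarithmic statistic. -/
lemma decouple_pow (a k : ℕ) :
    D (linStat c π hi a (k + 1)) + offElt (fun k => E (c k)) π hi a (k + 1)
      = E (linStat c π hi (a + 1) (k + 1))
        + ∑ i ∈ range a, (recOff h hi (k + 1)
            * (diagElt c π hi (a - 1 - i) (k + 1) * diagElt (fun k => E (c k)) π hi i k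
              + diagElt (fun k => E (c k)) π hi (a - 1 - i) (k + 1) * diagElt c π hi i k)
          - (offElt c π hi (a - 1 - i) (k + 1) * offElt (fun k => E (c k)) π hi i (k + 1)
            + offElt (fun k => E (c k)) π hi (a - 1 - i) (k + 1) * offElt c π hi i (k + 1))) := by
  rw [K.D_linStat_sub H c K.shift, H.double_sum]
  -- Here the functionals differ, but orthogonality for `c` evaluates the transported sums: one
  -- vanishes, the other keeps only `j = k`, which is the extra off-diagonal element on the left of
  -- the statement.
  have h1 := H.partial_sum_shift c (fun k => E (c k)) k a 0
  have h2 := H.partial_sum_shift (fun k => E (c k)) c k a 0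
  have e1 : ∑ j ∈ range (k + 1), hi j * (matElt c π 0 j (k + 1)
      * matElt (fun k => E (c k)) π (a + 0) j k) = 0 := by
    refine sum_eq_zero fun j hj => ?_
    rw [H.matElt_zero_of_ne (mem_range.mp hj).ne]; ring
  have e2 : ∑ j ∈ range (k + 1), hi j * (matElt (fun k => E (c k)) π a j (k + 1)
      * matElt c π 0 j k) = matElt (fun k => E (c k)) π a k (k + 1) := by
    rw [sum_eq_single k]
    · rw [H.matElt_zero_self]
      linear_combination matElt (fun k => E (c k)) π a k (k + 1) * H.inv k
    · intro j _ hj; rw [H.matElt_zero_of_ne hj]; ring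
    · intro hk; simp at hk
  rw [e1, zero_add] at h1
  rw [e2, add_zero] at h2
  have h3 := sub_eq_iff_eq_add.mpr h2
  rw [h1, ← h3, offElt, add_assoc]
  congr 1
  have : ∀ x y z w : R, hi k * (hi k * x - (y - hi k * z)) + hi k * y
    = hi k * hi k * (x + z) := fun x y z w => by ring
  rw [this _ _ _ 0, ← sum_add_distrib, mul_sum]
  refine sum_congr rfl fun i _ => ?_
  simp only [zero_add, H.hi_mul_diag _ _ (k + 1), H.hi_mul_diag _ _ k, H.matElt_succ_eq, recOff]
  set A1 := diagElt c π hi (a - 1 - i) (k + 1)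
  set A2 := diagElt (fun k => E (c k)) π hi i k
  set A3 := diagElt (fun k => E (c k)) π hi (a - 1 - i) (k + 1)
  set A4 := diagElt c π hi i k
  set B1 := offElt c π hi (a - 1 - i) (k + 1)
  set B2 := offElt (fun k => E (c k)) π hi i (k + 1)
  set B3 := offElt (fun k => E (c k)) π hi (a - 1 - i) (k + 1)
  set B4 := offElt c π hi i (k + 1)
  linear_combination (hi k * h (k + 1) * (A1 * A2 + A3 * A4)
    - (hi k * h k + 1) * (B1 * B2 + B3 * B4)) * H.inv k

omit K in
lemma diagElt_zero_derivation (k : ℕ) : E (h k) = h k * diagElt (fun k => E (c k)) π hi 0 k := by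
  rw [H.derivation_norm, ← H.hi_mul_diag, matElt, pow_zero, one_mul]

lemma diagElt_one_derivation (k : ℕ) : D (h k) = h k * diagElt (fun k => E (c k)) π hi 1 k := by
  rw [H.derivation_norm, ← H.hi_mul_diag, matElt, ← momentFunctional_shift]
  exact congrArg (fun s => momentFunctional s (π k * π k)) (funext K.shift)

/-- The two diagonal elements are the logarithmic derivatives of `h k` along `E` and along `D`, so
this is the commutation of `D` and `E`. -/
lemma D_diagElt_zero (k : ℕ) :
    D (diagElt (fun k => E (c k)) π hi 0 k) = E (diagElt (fun k => E (c k)) π hi 1 k) := by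
  have h0 := diagElt_zero_derivation (E := E) H k
  have h1 := K.diagElt_one_derivation H k
  have h2 := congrArg D h0
  have h3 := congrArg E h1
  rw [K.comm, h3, Derivation.leibniz, Derivation.leibniz, h0, h1] at h2
  simp only [smul_eq_mul] at h2
  linear_combination hi k * -h2 + (E (diagElt (fun k => E (c k)) π hi 1 k)
    - D (diagElt (fun k => E (c k)) π hi 0 k)) * H.inv k

omit K in
lemma recDiag_scale (hs : ScalesWith D t α c 0) (k : ℕ) (hk : momentFunctional c
    (scalingDerivation D t (π k) * π k) = k * h k) :
    (1 - t) * recDiag c π hi k = 2 * k + 1 + α + t * (hi k * D (h k)) := by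
  have h1 := hs.momentFunctional (π k * π k)
  have e0 : momentFunctional (0 : ℕ → R) (π k * π k) = 0 := by
    have := matElt_zero_seq π 0 k k
    rwa [matElt, pow_zero, one_mul] at this
  rw [Derivation.leibniz, map_add, smul_eq_mul, mul_comm (π k) (scalingDerivation D t (π k)),
    hk, H.norm, e0] at h1
  rw [recDiag, matElt, pow_one]
  linear_combination hi k * h1 + (2 * k + 1 + α) * H.inv k

/-- The top coefficients agree, so the difference has degree below `k`. Against `π j` with `j < k`,
integration by parts moves the derivation to `π j`, where degree kills it. What remains is a matrix
element of `x`, nonzero only for `j = k - 1`. -/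
lemma ladder (k : ℕ) :
    scalingDerivation D t (π k)
      = C (k : R) * π k + C ((1 - t) * recOff h hi k) * π (k - 1) := by
  rw [← sub_eq_zero]
  refine H.eq_zero (m := k) (fun i hi' => ?_) (fun j hj => ?_)
  · rw [coeff_sub, coeff_add, coeff_scalingDerivation, coeff_C_mul, coeff_C_mul]
    have e : (1 - t) * recOff h hi k * (π (k - 1)).coeff i = 0 := by
      cases k with
      | zero => simp [recOff]
      | succ k => rw [H.coeff_gt _ _ (by omega), mul_zero]
    rw [e]
    rcases hi'.eq_or_lt with rfl | hlt
    · rw [H.coeff_self, Derivation.map_one_eq_zero]; ring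
    · rw [H.coeff_gt _ _ hlt, map_zero]; ring
  · have h1 := K.scale.momentFunctional (π k * π j)
    have e0 : momentFunctional (0 : ℕ → R) (π k * π j) = 0 := by
      have := matElt_zero_seq π 0 k j
      rwa [matElt, pow_zero, one_mul] at this
    have e1 : momentFunctional c (scalingDerivation D t (π j) * π k) = 0 := by
      refine H.functional_eq_zero fun i hi' => ?_
      rw [coeff_scalingDerivation, H.coeff_gt _ _ (by omega)]; simp
    rw [Derivation.leibniz, map_add, smul_eq_mul, smul_eq_mul, e0, H.orth k j hj.ne', map_zero,
      mul_comm (π k) (scalingDerivation D t (π j)), e1, mul_comm (π j)] at h1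
    have e2 : momentFunctional c (X * (π k * π j)) = matElt c π 1 j k := by
      rw [matElt, pow_one, mul_comm (π k)]
    rw [e2] at h1
    rw [sub_mul, add_mul, map_sub, map_add, mul_assoc, mul_assoc, momentFunctional_C_mul,
      momentFunctional_C_mul, H.orth k j hj.ne']
    obtain ⟨k, rfl⟩ : ∃ k', k = k' + 1 := ⟨k - 1, by omega⟩
    rw [Nat.add_sub_cancel, recOff]
    rcases (Nat.lt_succ_iff.mp hj).eq_or_lt with rfl | hlt
    · rw [H.matElt_one_succ] at h1
      rw [H.norm]
      linear_combination -h1 - (1 - t) * h (j + 1) * H.inv j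
    · rw [H.matElt_one_eq_zero (by omega)] at h1
      rw [H.orth k j hlt.ne']
      linear_combination -h1

lemma recDiag_eq (k : ℕ) :
    (1 - t) * recDiag c π hi k
      = 2 * k + 1 + α + t * diagElt (fun k => E (c k)) π hi 1 k := by
  have hk : momentFunctional c (scalingDerivation D t (π k) * π k) = k * h k := by
    rw [K.ladder H, add_mul, map_add, mul_assoc, mul_assoc, momentFunctional_C_mul,
      momentFunctional_C_mul, H.norm]
    cases k with
    | zero => simp [recOff]
    | succ k => rw [Nat.add_sub_cancel, H.orth k (k + 1) (by omega)]; ring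
  rw [recDiag_scale H K.scale k hk, K.diagElt_one_derivation H]
  linear_combination (t * diagElt (fun k => E (c k)) π hi 1 k) * H.inv k

lemma hi_mul_D (k : ℕ) (x : R) :
    hi k * D x = D (hi k * x) + diagElt (fun k => E (c k)) π hi 1 k * (hi k * x) := by
  rw [Derivation.leibniz, H.derivation_inv, K.diagElt_one_derivation H]
  simp only [smul_eq_mul]
  linear_combination (hi k * x * diagElt (fun k => E (c k)) π hi 1 k) * H.inv k

variable {φ σ : ℕ → R} (hφ : ScalesWith D t α φ σ)
include hφ

/-- Multiplication by `x` on the diagonal elements. -/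
lemma diagElt_succ (b k : ℕ) :
    (1 - t) * diagElt φ π hi (b + 1) k
      = (b + 1 + α + 2 * k) * diagElt φ π hi b k + diagElt σ π hi b k
        + t * D (diagElt φ π hi b k)
        + t * diagElt (fun k => E (c k)) π hi 1 k * diagElt φ π hi b k
        + 2 * (1 - t) * offElt φ π hi b k := by
  have h1 := hφ.momentFunctional (X ^ b * (π k * π k))
  have e1 : scalingDerivation D t (X ^ b * (π k * π k))
      = C (b + 2 * k : R) * (X ^ b * (π k * π k))
        + C (2 * ((1 - t) * recOff h hi k)) * (X ^ b * (π (k - 1) * π k)) := by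
    rw [scalingDerivation_X_pow_mul, Derivation.leibniz, smul_eq_mul, K.ladder H]
    simp only [map_add, map_mul, map_ofNat]; ring
  have e2 : (X : R[X]) * (X ^ b * (π k * π k)) = X ^ (b + 1) * (π k * π k) := by ring
  rw [e1, e2, map_add, momentFunctional_C_mul, momentFunctional_C_mul] at h1
  simp only [← matElt_def] at h1
  have e3 : hi k * (recOff h hi k * matElt φ π b (k - 1) k) = offElt φ π hi b k := by
    cases k with
    | zero => simp [recOff, offElt]
    | succ k =>
      rw [recOff, offElt, Nat.add_sub_cancel]
      linear_combination hi k * matElt φ π b k (k + 1) * H.inv (k + 1)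
  have e4 := K.hi_mul_D H k (matElt φ π b k k)
  rw [← e3]
  simp only [diagElt] at e4 ⊢
  linear_combination hi k * h1 + t * e4

/-- Scaling, in difference form. -/
lemma offElt_sub (a k : ℕ) :
    (1 - t) * (offElt φ π hi a (k + 1) - offElt φ π hi a k)
      = a * diagElt φ π hi a k + diagElt σ π hi a k + t * D (diagElt φ π hi a k) := by
  have h1 := K.diagElt_succ H hφ a k
  -- The next diagonal element is computed a second time, from the three-term recurrence; comparison
  -- with `diagElt_succ` eliminates it.
  have h2 : diagElt φ π hi (a + 1) k
      = offElt φ π hi a (k + 1) + recDiag c π hi k * diagElt φ π hi a k + offElt φ π hi a k := by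
    have e : (X : R[X]) ^ (a + 1) * (π k * π k) = X ^ a * (π k * π (k + 1))
        + C (recDiag c π hi k) * (X ^ a * (π k * π k))
        + C (recOff h hi k) * (X ^ a * (π (k - 1) * π k)) := by
      linear_combination (X ^ a * π k) * H.three_term k
    rw [diagElt, matElt, e, map_add, map_add, momentFunctional_C_mul, momentFunctional_C_mul]
    simp only [← matElt_def]
    have e3 : hi k * (recOff h hi k * matElt φ π a (k - 1) k) = offElt φ π hi a k := by
      cases k with
      | zero => simp [recOff, offElt]
      | succ k =>
        rw [recOff, offElt, Nat.add_sub_cancel]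
        linear_combination hi k * matElt φ π a k (k + 1) * H.inv (k + 1)
    rw [← e3, offElt, diagElt]; ring
  linear_combination h1 - (1 - t) * h2 - diagElt φ π hi a k * K.recDiag_eq H k

/-- The difference relation telescopes, starting from the convention that `offElt` vanishes at index
zero. -/
lemma offElt_eq (a m : ℕ) :
    (1 - t) * offElt φ π hi a m
      = a * linStat φ π hi a m + linStat σ π hi a m + t * D (linStat φ π hi a m) := by
  induction m with
  | zero => simp [linStat, offElt]
  | succ m ih =>
    have h1 := K.offElt_sub H hφ a m
    simp only [linStat, sum_range_succ, map_add] at ih ⊢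
    linear_combination ih + h1

lemma diagElt_sub (b k : ℕ) :
    (1 - t) * (recOff h hi (k + 1) * (diagElt φ π hi b (k + 1) - diagElt φ π hi b k))
      = (b + 1) * offElt φ π hi b (k + 1) + offElt σ π hi b (k + 1)
        + t * D (offElt φ π hi b (k + 1)) := by
  have h1 := hφ.momentFunctional (X ^ b * (π k * π (k + 1)))
  -- The lowered polynomial `π (k - 1)` is traded, through the three-term recurrence, for `X * π k`
  -- and `π (k + 1)`, so that only the indices `k` and `k + 1` occur.
  have e0 : scalingDerivation D t (π k)
      = - C (k + 1 + α + t * diagElt (fun k => E (c k)) π hi 1 k) * π k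
        + C (1 - t) * (X * π k - π (k + 1)) := by
    rw [K.ladder H, H.three_term k]
    have := congrArg (C : R → R[X]) (K.recDiag_eq H k)
    simp only [map_mul, map_add, map_sub, map_one, map_ofNat] at this ⊢
    linear_combination -(π k) * this
  have e1 : scalingDerivation D t (X ^ b * (π k * π (k + 1)))
      = C (b - α - t * diagElt (fun k => E (c k)) π hi 1 k) * (X ^ b * (π k * π (k + 1)))
        + C ((1 - t) * recOff h hi (k + 1)) * (X ^ b * (π k * π k))
        + C (1 - t) * (X * (X ^ b * (π k * π (k + 1))))
        - C (1 - t) * (X ^ b * (π (k + 1) * π (k + 1))) := by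
    rw [scalingDerivation_X_pow_mul, Derivation.leibniz, smul_eq_mul, smul_eq_mul,
      K.ladder H (k + 1), e0, Nat.add_sub_cancel]
    simp only [map_add, map_sub, map_mul, map_one, Nat.cast_add, Nat.cast_one]; ring
  rw [e1, map_sub, map_add, map_add, momentFunctional_C_mul, momentFunctional_C_mul,
    momentFunctional_C_mul, momentFunctional_C_mul] at h1
  simp only [← matElt_def] at h1
  have e4 := K.hi_mul_D H k (matElt φ π b k (k + 1))
  have e5 : hi k * matElt φ π b (k + 1) (k + 1)
      = recOff h hi (k + 1) * diagElt φ π hi b (k + 1) := by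
    rw [H.hi_mul_diag, recOff]; ring
  simp only [diagElt, offElt] at h1 e4 e5 ⊢
  linear_combination hi k * h1 + t * e4 - (1 - t) * e5

end IsDeformed

end Statistics

end EntanglementEntropy

namespace EntanglementEntropy

open MeasureTheory ProbabilityTheory Set

/-! ### Logarithmic moments of the gamma density and the polygamma functions. -/

section GammaLog

/-- The measure `x⁻¹ e^{-x} dx` on the positive half line. -/
noncomputable def gammaBase : Measure ℝ :=
  (volume.restrict (Ioi 0)).withDensity fun x => ENNReal.ofReal (x⁻¹ * Real.exp (-x))

/-- The integral `∫ x^{z-1} (ln x)^p e^{-x} dx` over the positive half line. -/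
noncomputable def gammaLog (p : ℕ) (z : ℝ) : ℝ :=
  ∫ x in Ioi (0 : ℝ), x ^ (z - 1) * Real.log x ^ p * Real.exp (-x)

lemma gammaBase_density_eq {x : ℝ} (hx : 0 < x) (z : ℝ) (p : ℕ) :
    (ENNReal.ofReal (x⁻¹ * Real.exp (-x))).toReal • (Real.log x ^ p * Real.exp (z * Real.log x))
      = x ^ (z - 1) * Real.log x ^ p * Real.exp (-x) := by
  rw [ENNReal.toReal_ofReal (by positivity), smul_eq_mul, Real.rpow_sub_one hx.ne',
    Real.rpow_def_of_pos hx, mul_comm (Real.log x) z]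
  field_simp

lemma measurable_gammaBase_density :
    Measurable fun x : ℝ => ENNReal.ofReal (x⁻¹ * Real.exp (-x)) := by fun_prop

lemma integral_gammaBase (z : ℝ) (p : ℕ) :
    ∫ x, Real.log x ^ p * Real.exp (z * Real.log x) ∂gammaBase = gammaLog p z := by
  rw [gammaBase, integral_withDensity_eq_integral_toReal_smul measurable_gammaBase_density
    (by simp)]
  exact setIntegral_congr_fun measurableSet_Ioi fun x hx => gammaBase_density_eq hx z p

lemma integrable_gammaBase_iff (z : ℝ) (p : ℕ) :
    Integrable (fun x => Real.log x ^ p * Real.exp (z * Real.log x)) gammaBase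
      ↔ IntegrableOn (fun x : ℝ => x ^ (z - 1) * Real.log x ^ p * Real.exp (-x)) (Ioi 0) := by
  rw [gammaBase, integrable_withDensity_iff_integrable_smul' measurable_gammaBase_density
    (by simp)]
  exact integrable_congr (ae_restrict_of_forall_mem measurableSet_Ioi
    fun x hx => gammaBase_density_eq hx z p)

/-- Under `gammaBase` the moment generating function of `Real.log` is the Gamma function.
Differentiation under the integral and analyticity of `ln Γ` thus follow from the general theory
inside the domain of convergence. -/
lemma mem_interior_integrableExpSet {z : ℝ} (hz : 0 < z) :
    z ∈ interior (integrableExpSet Real.log gammaBase) := by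
  refine mem_interior.mpr ⟨Ioi 0, fun s hs => ?_, isOpen_Ioi, hz⟩
  have h1 := (integrable_gammaBase_iff s 0).mpr (by
    refine (Real.GammaIntegral_convergent hs).congr_fun (fun x _ => ?_) measurableSet_Ioi
    simp [mul_comm])
  simpa [integrableExpSet] using h1

lemma integrableOn_gammaLog (p : ℕ) {z : ℝ} (hz : 0 < z) :
    IntegrableOn (fun x : ℝ => x ^ (z - 1) * Real.log x ^ p * Real.exp (-x)) (Ioi 0) :=
  (integrable_gammaBase_iff z p).mp
    (integrable_pow_mul_exp_of_mem_interior_integrableExpSet (mem_interior_integrableExpSet hz) p)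

lemma hasDerivAt_gammaLog (p : ℕ) {z : ℝ} (hz : 0 < z) :
    HasDerivAt (gammaLog p) (gammaLog (p + 1) z) z := by
  have h := hasDerivAt_integral_pow_mul_exp_real (mem_interior_integrableExpSet hz) p
  simp only [integral_gammaBase] at h
  exact h

lemma gammaLog_zero {z : ℝ} (hz : 0 < z) : gammaLog 0 z = Real.Gamma z := by
  rw [Real.Gamma_eq_integral hz, gammaLog]
  exact setIntegral_congr_fun measurableSet_Ioi fun x _ => by simp [mul_comm]

lemma analyticAt_log_Gamma {z : ℝ} (hz : 0 < z) :
    AnalyticAt ℝ (fun y : ℝ => Real.log (Real.Gamma y)) z := by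
  refine (analyticAt_cgf (mem_interior_integrableExpSet hz)).congr ?_
  filter_upwards [Ioi_mem_nhds hz] with y hy
  rw [cgf, mgf, ← gammaLog_zero hy, ← integral_gammaBase]
  simp

lemma hasDerivAt_polygamma (k : ℕ) {z : ℝ} (hz : 0 < z) :
    HasDerivAt (polygamma k) (polygamma (k + 1) z) z := by
  have h : AnalyticAt ℝ (polygamma k) z := by
    have := (analyticAt_log_Gamma hz).iterated_deriv (k + 1)
    rwa [← iteratedDeriv_eq_iterate] at this
  have e : polygamma (k + 1) z = deriv (polygamma k) z := by
    rw [polygamma, iteratedDeriv_succ]; rfl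
  rw [e]
  exact h.differentiableAt.hasDerivAt

lemma gammaLog_one {z : ℝ} (hz : 0 < z) :
    gammaLog 1 z = polygamma 0 z * gammaLog 0 z := by
  have hG : 0 < Real.Gamma z := Real.Gamma_pos_of_pos hz
  have h1 : HasDerivAt Real.Gamma (gammaLog 1 z) z :=
    (hasDerivAt_gammaLog 0 hz).congr_of_eventuallyEq (by
      filter_upwards [Ioi_mem_nhds hz] with y hy using (gammaLog_zero hy).symm)
  have h2 := h1.log hG.ne'
  have h3 : polygamma 0 z = gammaLog 1 z / Real.Gamma z := by
    rw [polygamma, zero_add, iteratedDeriv_one, h2.deriv]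
  rw [h3, gammaLog_zero hz, div_mul_cancel₀ _ hG.ne']

end GammaLog

/-! ### Taylor series of Gamma and polygamma functions as formal power series. -/

section Taylor

open PowerSeries

/-- A family of power series consisting of the Taylor expansions of a function on the positive
half line. -/
def IsTaylor (F : ℝ → ℝ⟦X⟧) : Prop :=
  ∀ z, 0 < z → ∀ q, HasDerivAt (fun y => coeff q (F y)) (coeff q (derivative ℝ (F z))) z

lemma IsTaylor.sub {F G : ℝ → ℝ⟦X⟧} (hF : IsTaylor F) (hG : IsTaylor G) :
    IsTaylor fun z => F z - G z := by
  intro z hz q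
  have := (hF z hz q).sub (hG z hz q)
  simp only [map_sub]
  exact this

lemma IsTaylor.mul {F G : ℝ → ℝ⟦X⟧} (hF : IsTaylor F) (hG : IsTaylor G) :
    IsTaylor fun z => F z * G z := by
  intro z hz q
  simp only [Derivation.leibniz, smul_eq_mul, map_add]
  simp only [coeff_mul]
  have h := HasDerivAt.fun_sum (u := Finset.HasAntidiagonal.antidiagonal q) fun ij _ =>
    (hF z hz ij.1).fun_mul (hG z hz ij.2)
  refine h.congr_deriv ?_
  rw [← Finset.Nat.sum_antidiagonal_swap
    (f := fun p => coeff p.1 (G z) * coeff p.2 (derivative ℝ (F z))),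
    ← Finset.sum_add_distrib]
  refine Finset.sum_congr rfl fun ij _ => ?_
  simp only [Prod.fst_swap, Prod.snd_swap]; ring

/-- Coefficient `q + 1` is, up to the factor `q + 1`, the derivative of coefficient `q`. Vanishing
of the values on the whole half line therefore propagates to all orders, so functional equations
need checking only on constant terms. -/
lemma IsTaylor.eq_zero {F : ℝ → ℝ⟦X⟧} (hF : IsTaylor F)
    (h0 : ∀ z, 0 < z → constantCoeff (F z) = 0) {z : ℝ} (hz : 0 < z) : F z = 0 := by
  have : ∀ q, ∀ z, 0 < z → coeff q (F z) = 0 := by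
    intro q
    induction q with
    | zero => intro z hz; simpa using h0 z hz
    | succ q ih =>
      intro z hz
      have h1 := hF z hz q
      have h2 : HasDerivAt (fun y => coeff q (F y)) 0 z :=
        (hasDerivAt_const z (0 : ℝ)).congr_of_eventuallyEq (by
          filter_upwards [Ioi_mem_nhds hz] with y hy using ih y hy)
      have h3 := h1.unique h2
      rw [coeff_derivative] at h3
      exact (mul_eq_zero.mp h3).resolve_right (by positivity)
  ext q
  simpa using this q z hz

/-- The series with coefficients `f q z / q!`. -/
noncomputable def taylorSeries (f : ℕ → ℝ → ℝ) (z : ℝ) : ℝ⟦X⟧ :=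
  PowerSeries.mk fun q => f q z / q.factorial

lemma derivative_taylorSeries (f : ℕ → ℝ → ℝ) (z : ℝ) :
    derivative ℝ (taylorSeries f z) = taylorSeries (fun q => f (q + 1)) z := by
  ext q
  rw [coeff_derivative, taylorSeries, taylorSeries, coeff_mk, coeff_mk, Nat.factorial_succ]
  push_cast
  field_simp

lemma isTaylor_taylorSeries {f : ℕ → ℝ → ℝ}
    (hf : ∀ q z, 0 < z → HasDerivAt (f q) (f (q + 1) z) z) : IsTaylor (taylorSeries f) := by
  intro z hz q
  rw [derivative_taylorSeries]
  simp only [taylorSeries, coeff_mk]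
  exact (hf q z hz).div_const _

@[simp]
lemma constantCoeff_taylorSeries (f : ℕ → ℝ → ℝ) (z : ℝ) :
    constantCoeff (taylorSeries f z) = f 0 z := by
  rw [← coeff_zero_eq_constantCoeff_apply, taylorSeries, coeff_mk]; simp

lemma isTaylor_const_add_X : IsTaylor fun z => C z + X := by
  intro z _ q
  have h : derivative ℝ (C z + X : ℝ⟦X⟧) = 1 := by simp
  rw [h]
  rcases Nat.eq_zero_or_pos q with rfl | hq
  · simpa using hasDerivAt_id' z
  · simp only [map_add, coeff_C, if_neg hq.ne', coeff_one]
    exact hasDerivAt_const _ _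

lemma taylorSeries_gammaLog_add_one {z : ℝ} (hz : 0 < z) :
    taylorSeries gammaLog (z + 1) = (C z + X) * taylorSeries gammaLog z := by
  have hG := isTaylor_taylorSeries (fun q z hz => hasDerivAt_gammaLog q hz)
  have h1 : IsTaylor fun z => taylorSeries gammaLog (z + 1) := by
    intro z hz q
    exact (hG (z + 1) (by linarith) q).comp_add_const z 1
  have h2 := h1.sub (isTaylor_const_add_X.mul hG)
  have h3 := h2.eq_zero (fun z hz => by
    simp [gammaLog_zero hz, gammaLog_zero (show 0 < z + 1 by linarith),
      Real.Gamma_add_one hz.ne']) hz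
  exact sub_eq_zero.mp h3

lemma gammaLog_add_one (p : ℕ) {z : ℝ} (hz : 0 < z) :
    gammaLog p (z + 1) = z * gammaLog p z + p * gammaLog (p - 1) z := by
  have h := congrArg (coeff p) (taylorSeries_gammaLog_add_one hz)
  rw [add_mul, map_add, coeff_C_mul] at h
  cases p with
  | zero => simpa [taylorSeries] using h
  | succ p =>
    rw [mul_comm X, coeff_succ_mul_X] at h
    simp only [taylorSeries, coeff_mk, Nat.factorial_succ] at h
    push_cast at h
    field_simp at h
    rw [Nat.add_sub_cancel]; push_cast
    linear_combination h

lemma derivative_taylorSeries_gammaLog {z : ℝ} (hz : 0 < z) :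
    derivative ℝ (taylorSeries gammaLog z)
      = taylorSeries polygamma z * taylorSeries gammaLog z := by
  have hG := isTaylor_taylorSeries (fun q z hz => hasDerivAt_gammaLog q hz)
  have hP := isTaylor_taylorSeries (fun q z hz => hasDerivAt_polygamma q hz)
  have h1 : IsTaylor fun z => derivative ℝ (taylorSeries gammaLog z) := by
    simp only [derivative_taylorSeries]
    exact isTaylor_taylorSeries (f := fun q => gammaLog (q + 1))
      fun q z hz => hasDerivAt_gammaLog (q + 1) hz
  have h3 := (h1.sub (hP.mul hG)).eq_zero (fun z hz => by
    simp [derivative_taylorSeries, gammaLog_one hz]) hz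
  exact sub_eq_zero.mp h3

end Taylor

end EntanglementEntropy

namespace EntanglementEntropy

open PowerSeries

/-! ### Derivations of power series rings. -/

section CoeffwiseDerivation

variable {S : Type*} [CommRing S]

/-- Derivations of a commutative ring. -/
abbrev RingDerivation (R : Type*) [CommRing R] := Derivation ℤ R R

/-- An additive map satisfying the Leibniz rule is a derivation. -/
def RingDerivation.ofLeibniz {R : Type*} [CommRing R] (f : R →+ R)
    (h : ∀ a b, f (a * b) = a * f b + b * f a) : RingDerivation R :=
  Derivation.mk' f.toIntLinearMap h

/-- The derivation of `S⟦X⟧` which applies a derivation of `S` to the coefficients. -/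
noncomputable def coeffwiseDerivation (δ : RingDerivation S) : RingDerivation S⟦X⟧ :=
  RingDerivation.ofLeibniz
    { toFun := fun f => PowerSeries.mk fun n => δ (coeff n f)
      map_zero' := by ext n; simp
      map_add' := fun f g => by ext n; simp }
    (by
      intro f g
      ext n
      simp only [AddMonoidHom.coe_mk, ZeroHom.coe_mk, coeff_mk, coeff_mul, map_sum,
        Derivation.leibniz, smul_eq_mul, map_add]
      rw [← Finset.Nat.sum_antidiagonal_swap (f := fun p => coeff p.1 g * δ (coeff p.2 f)),
        ← Finset.sum_add_distrib]
      rfl)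

@[simp]
lemma coeff_coeffwiseDerivation (δ : RingDerivation S) (f : S⟦X⟧) (n : ℕ) :
    coeff n (coeffwiseDerivation δ f) = δ (coeff n f) :=
  coeff_mk n fun n => δ (coeff n f)

variable (S) in
/-- The formal derivative as a derivation over the integers. -/
noncomputable def formalDerivative : RingDerivation S⟦X⟧ :=
  RingDerivation.ofLeibniz (PowerSeries.derivative S).toLinearMap.toAddMonoidHom
    fun a b => (PowerSeries.derivative S).leibniz a b

@[simp]
lemma coeff_formalDerivative (f : S⟦X⟧) (n : ℕ) :
    coeff n (formalDerivative S f) = coeff (n + 1) f * (n + 1) :=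
  coeff_derivative f n

lemma formalDerivative_apply (f : S⟦X⟧) : formalDerivative S f = PowerSeries.derivative S f := rfl

end CoeffwiseDerivation

/-! ### The formal moments of the deformed Laguerre weight. -/

section WishartMoments

/-- The moments of `x ^ α e^{-x + t x ln x}`, expanded in `t` (outer variable) and in `α` (inner
variable). -/
noncomputable def wishartMoment (α : ℝ) (k : ℕ) : ℝ⟦X⟧⟦X⟧ :=
  PowerSeries.mk fun p => PowerSeries.mk fun q =>
    gammaLog (p + q) (α + 1 + k + p) / (p.factorial * q.factorial)

lemma coeff_wishartMoment (α : ℝ) (k p q : ℕ) :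
    coeff q (coeff p (wishartMoment α k))
      = gammaLog (p + q) (α + 1 + k + p) / (p.factorial * q.factorial) := by
  rw [wishartMoment, coeff_mk, coeff_mk]

/-- Everything is checked on coefficients. Both `t` and the increment of `α` bring down a logarithm,
and `t` also a power of `x`, which gives the shift. The scaling identity reduces to
`gammaLog_add_one` at the argument `α + 1 + k + p`. -/
lemma isDeformed_wishartMoment {α : ℝ} (hα : -1 < α) :
    IsDeformed (formalDerivative ℝ⟦X⟧) (coeffwiseDerivation (formalDerivative ℝ)) (X : ℝ⟦X⟧⟦X⟧)
      (C (C α + X)) (wishartMoment α) where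
  comm x := by
    ext p q
    simp only [coeff_formalDerivative, coeff_coeffwiseDerivation]
    rw [show ((p : ℝ⟦X⟧) + 1) = C ((p : ℝ) + 1) by simp, mul_comm, coeff_C_mul,
      coeff_formalDerivative, mul_comm _ (C _), coeff_C_mul]
    ring
  E_t := by
    ext p q
    rw [coeff_coeffwiseDerivation, coeff_X]
    split_ifs <;> simp
  E_α := by
    ext p : 1
    rw [coeff_coeffwiseDerivation, coeff_C, coeff_one]
    split_ifs
    · simp [formalDerivative_apply]
    · simp
  shift k := by
    ext p q
    simp only [coeff_formalDerivative, coeff_coeffwiseDerivation]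
    rw [show ((p : ℝ⟦X⟧) + 1) = C ((p : ℝ) + 1) by simp, mul_comm, coeff_C_mul,
      coeff_wishartMoment, coeff_wishartMoment, Nat.factorial_succ, Nat.factorial_succ]
    rw [show p + 1 + q = p + (q + 1) by ring,
      show α + 1 + (k : ℝ) + ((p + 1 : ℕ) : ℝ) = α + 1 + ((k + 1 : ℕ) : ℝ) + p by push_cast; ring]
    push_cast
    field_simp
  scale k := by
    ext p q
    have hy : (0 : ℝ) < α + 1 + k + p := by
      have := (Nat.cast_nonneg k : (0 : ℝ) ≤ k)
      have := (Nat.cast_nonneg p : (0 : ℝ) ≤ p)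
      linarith
    have e1 : ((k : ℝ⟦X⟧⟦X⟧) + 1 + C (C α + X)) = C (C (k + 1 + α) + X) := by
      simp only [map_add, map_natCast, map_one]; ring
    have e2 : coeff p (X * formalDerivative ℝ⟦X⟧ (wishartMoment α k))
        = C (p : ℝ) * coeff p (wishartMoment α k) := by
      cases p with
      | zero => simp
      | succ p => rw [mul_comm X, coeff_succ_mul_X, coeff_formalDerivative, mul_comm]; simp
    have e3 : coeff q (X * coeff p (wishartMoment α k))
        = q * gammaLog (p + q - 1) (α + 1 + k + p) / (p.factorial * q.factorial) := by
      cases q with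
      | zero => simp
      | succ q =>
        rw [mul_comm X, coeff_succ_mul_X, coeff_wishartMoment, Nat.factorial_succ,
          show p + (q + 1) - 1 = p + q by omega]
        push_cast
        field_simp
    have e4 : coeff q (coeff p (X * wishartMoment α (k + 1)))
        = p * gammaLog (p + q - 1) (α + 1 + k + p) / (p.factorial * q.factorial) := by
      cases p with
      | zero => simp
      | succ p =>
        rw [mul_comm X, coeff_succ_mul_X, coeff_wishartMoment, Nat.factorial_succ,
          show p + 1 + q - 1 = p + q by omega]
        push_cast
        rw [show α + 1 + (k + 1) + (p : ℝ) = α + 1 + k + (p + 1) by ring]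
        field_simp
    rw [e1, Pi.zero_apply, add_zero, sub_mul, one_mul, map_sub, map_add, map_sub, map_add, e2, e4,
      coeff_C_mul, add_mul, map_add, coeff_C_mul, coeff_C_mul, e3, coeff_wishartMoment,
      coeff_wishartMoment, show α + 1 + ((k + 1 : ℕ) : ℝ) + p = α + 1 + k + p + 1 by
        push_cast; ring, gammaLog_add_one _ hy]
    push_cast
    field_simp
    ring

end WishartMoments

end EntanglementEntropy

namespace EntanglementEntropy

/-! ### Existence and uniqueness of orthogonal polynomials; Hankel determinants. -/

section Existence

open Polynomial Finset

variable {R S : Type*} [CommRing R] [CommRing S]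

/-- The Gram-Schmidt process for the monomials. -/
noncomputable def orthPoly (c : ℕ → R) (n : ℕ) : R[X] :=
  X ^ n - ∑ k : Fin n,
    C (Ring.inverse (momentFunctional c (orthPoly c k * orthPoly c k))
      * momentFunctional c (X ^ n * orthPoly c k)) * orthPoly c k
termination_by n
decreasing_by all_goals exact k.2

lemma coeff_orthPoly_of_le (c : ℕ → R) (n : ℕ) :
    ∀ i, n ≤ i → (orthPoly c n).coeff i = if i = n then 1 else 0 := by
  induction n using Nat.strong_induction_on with
  | _ n ih =>
    intro i hi
    rw [orthPoly, coeff_sub, coeff_X_pow, finsetSum_coeff, sum_eq_zero, sub_zero]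
    intro k _
    rw [coeff_C_mul, ih k k.2 i (k.2.le.trans hi), if_neg (by omega), mul_zero]

lemma momentFunctional_orthPoly_mul (c : ℕ → R)
    (hc : ∀ n, IsUnit (momentFunctional c (orthPoly c n * orthPoly c n))) (n : ℕ) :
    ∀ k, k < n → momentFunctional c (orthPoly c n * orthPoly c k) = 0 := by
  induction n using Nat.strong_induction_on with
  | _ n ih =>
    intro j hj
    conv_lhs => rw [orthPoly]
    rw [sub_mul, map_sub, sum_mul, map_sum, sum_eq_single (⟨j, hj⟩ : Fin n)]
    · rw [mul_assoc, momentFunctional_C_mul]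
      linear_combination -(momentFunctional c (X ^ n * orthPoly c j))
        * Ring.inverse_mul_cancel _ (hc j)
    · intro k _ hk
      have hk' : (k : ℕ) ≠ j := fun e => hk (Fin.ext e)
      rw [mul_assoc, momentFunctional_C_mul]
      rcases lt_or_gt_of_ne hk' with h | h
      · rw [mul_comm (orthPoly c k) (orthPoly c j), ih j hj k h, mul_zero]
      · rw [ih k k.2 j h, mul_zero]
    · simp

lemma isOPS_orthPoly (c : ℕ → R)
    (hc : ∀ n, IsUnit (momentFunctional c (orthPoly c n * orthPoly c n))) :
    IsOPS c (orthPoly c) (fun n => momentFunctional c (orthPoly c n * orthPoly c n))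
      (fun n => Ring.inverse (momentFunctional c (orthPoly c n * orthPoly c n))) where
  coeff_self k := by rw [coeff_orthPoly_of_le c k k le_rfl, if_pos rfl]
  coeff_gt k i hki := by rw [coeff_orthPoly_of_le c k i hki.le, if_neg hki.ne']
  orth j k hjk := by
    rcases lt_or_gt_of_ne hjk with h | h
    · rw [mul_comm, momentFunctional_orthPoly_mul c hc k j h]
    · exact momentFunctional_orthPoly_mul c hc j k h
  norm k := rfl
  inv k := Ring.mul_inverse_cancel _ (hc k)

lemma map_momentFunctional (f : R →+* S) (c : ℕ → R) (g : R[X]) :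
    f (momentFunctional c g) = momentFunctional (fun k => f (c k)) (g.map f) := by
  induction g using Polynomial.induction_on' with
  | add p q hp hq => simp [hp, hq]
  | monomial k a => simp

/-- Invertibility of the square norms can be tested after applying `f`. There they are values of a
positive functional on squares of polynomials kept nonzero by their leading coefficient one. -/
lemma exists_isOPS_of_pos (f : R →+* ℝ) (hf : ∀ a, f a ≠ 0 → IsUnit a) (c : ℕ → R)
    (hc : ∀ g : ℝ[X], g ≠ 0 → 0 < momentFunctional (fun k => f (c k)) (g * g)) :
    ∃ π h hi, IsOPS c π h hi := by
  refine ⟨_, _, _, isOPS_orthPoly c fun n => hf _ ?_⟩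
  rw [map_momentFunctional, Polynomial.map_mul]
  refine (hc _ fun h => ?_).ne'
  have := congrArg (fun p => p.coeff n) h
  simp [coeff_orthPoly_of_le] at this

lemma IsOPS.map (f : R →+* S) {c : ℕ → R} {π : ℕ → R[X]} {h hi : ℕ → R} (H : IsOPS c π h hi) :
    IsOPS (fun k => f (c k)) (fun k => (π k).map f) (fun k => f (h k)) (fun k => f (hi k)) where
  coeff_self k := by rw [coeff_map, H.coeff_self, map_one]
  coeff_gt k i hki := by rw [coeff_map, H.coeff_gt k i hki, map_zero]
  orth j k hjk := by
    rw [← Polynomial.map_mul, ← map_momentFunctional, H.orth j k hjk, map_zero]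
  norm k := by rw [← Polynomial.map_mul, ← map_momentFunctional, H.norm]
  inv k := by rw [← map_mul, H.inv, map_one]

lemma map_matElt (f : R →+* S) (φ : ℕ → R) (π : ℕ → R[X]) (a j k : ℕ) :
    f (matElt φ π a j k) = matElt (fun k => f (φ k)) (fun k => (π k).map f) a j k := by
  rw [matElt, map_momentFunctional]; simp [matElt]

lemma map_diagElt (f : R →+* S) (φ : ℕ → R) (π : ℕ → R[X]) (hi : ℕ → R) (a k : ℕ) :
    f (diagElt φ π hi a k)
      = diagElt (fun k => f (φ k)) (fun k => (π k).map f) (fun k => f (hi k)) a k := by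
  rw [diagElt, map_mul, map_matElt]; rfl

lemma map_linStat (f : R →+* S) (φ : ℕ → R) (π : ℕ → R[X]) (hi : ℕ → R) (a m : ℕ) :
    f (linStat φ π hi a m)
      = linStat (fun k => f (φ k)) (fun k => (π k).map f) (fun k => f (hi k)) a m := by
  simp only [linStat, map_sum, map_diagElt]

/-- This identifies the specialization of a deformed system with a system over the reals obtained
independently. -/
lemma IsOPS.unique {c : ℕ → R} {π π' : ℕ → R[X]} {h hi h' hi' : ℕ → R}
    (H : IsOPS c π h hi) (H' : IsOPS c π' h' hi') : π = π' ∧ h = h' ∧ hi = hi' := by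
  have e : π = π' := by
    funext k
    rw [← sub_eq_zero]
    refine H.eq_zero (m := k) (fun i hik => ?_) (fun j hj => ?_)
    · rw [coeff_sub]
      rcases hik.eq_or_lt with rfl | hlt
      · rw [H.coeff_self, H'.coeff_self, sub_self]
      · rw [H.coeff_gt _ _ hlt, H'.coeff_gt _ _ hlt, sub_self]
    · rw [sub_mul, map_sub, H.orth _ _ hj.ne', mul_comm, H'.functional_eq_zero, sub_zero]
      exact fun i hi'' => H.coeff_gt j i (by omega)
  have e2 : h = h' := by funext k; rw [← H.norm, ← H'.norm, e]
  refine ⟨e, e2, funext fun k => ?_⟩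
  have h1 := H.inv k
  have h2 := H'.inv k
  rw [e2] at h1
  linear_combination hi' k * h1 - hi k * h2

/-- The Hankel determinant is the product of the square norms. -/
lemma IsOPS.det_hankel {c : ℕ → R} {π : ℕ → R[X]} {h hi : ℕ → R} (H : IsOPS c π h hi) (m : ℕ) :
    (Matrix.of fun i j : Fin m => c (i + j)).det = ∏ k ∈ range m, h k := by
  have hsum : ∀ k : Fin m, π k = ∑ a : Fin m, monomial (a : ℕ) ((π k).coeff a) := by
    intro k
    ext i
    simp only [finsetSum_coeff, coeff_monomial]
    by_cases hi' : i < m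
    · rw [sum_eq_single (⟨i, hi'⟩ : Fin m)]
      · simp
      · intro b _ hb; rw [if_neg]; exact fun e => hb (Fin.ext e)
      · simp
    · rw [H.coeff_gt k i (by omega), sum_eq_zero]
      intro a _; rw [if_neg]; omega
  set P : Matrix (Fin m) (Fin m) R := Matrix.of fun k i => (π k).coeff i with hP
  -- The unitriangular change of basis from monomials to the `π k` diagonalizes the Hankel matrix.
  have h1 : P * (Matrix.of fun i j : Fin m => c (i + j)) * P.transpose
      = Matrix.diagonal fun k : Fin m => h k := by
    ext j k
    have h2 : momentFunctional c (π j * π k)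
        = (P * (Matrix.of fun i j : Fin m => c (i + j)) * P.transpose) j k := by
      rw [hsum j, hsum k, sum_mul_sum]
      simp only [Matrix.mul_apply, map_sum, monomial_mul_monomial,
        momentFunctional_monomial, hP, Matrix.of_apply, Matrix.transpose_apply, sum_mul]
      rw [sum_comm]
      refine sum_congr rfl fun a _ => sum_congr rfl fun b _ => by ring
    rw [← h2, Matrix.diagonal_apply]
    split_ifs with hjk
    · rw [hjk, H.norm]
    · exact H.orth _ _ fun e => hjk (Fin.ext e)
  have h3 : P.det = 1 := by
    rw [Matrix.det_of_isLowerTriangular]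
    · exact prod_eq_one fun k _ => H.coeff_self k
    · intro i j hij
      exact H.coeff_gt _ _ hij
  have h4 := congrArg Matrix.det h1
  rw [Matrix.det_mul, Matrix.det_mul, Matrix.det_transpose, h3, one_mul, mul_one,
    Matrix.det_diagonal, Fin.prod_univ_eq_prod_range (fun k => h k)] at h4
  exact h4

/-- The logarithmic derivative of the Hankel determinant. -/
lemma IsOPS.derivation_det_hankel {c : ℕ → R} {π : ℕ → R[X]} {h hi : ℕ → R} (H : IsOPS c π h hi)
    (δ : Derivation ℤ R R) (m : ℕ) :
    δ ((Matrix.of fun i j : Fin m => c (i + j)).det)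
      = linStat (fun k => δ (c k)) π hi 0 m * (Matrix.of fun i j : Fin m => c (i + j)).det := by
  rw [H.det_hankel]
  induction m with
  | zero => simp [linStat]
  | succ m ih =>
    rw [prod_range_succ, Derivation.leibniz, smul_eq_mul, smul_eq_mul, ih, H.derivation_norm,
      linStat, linStat, sum_range_succ]
    have : momentFunctional (fun i => δ (c i)) (π m * π m)
        = h m * diagElt (fun k => δ (c k)) π hi 0 m := by
      rw [← H.hi_mul_diag, matElt, pow_zero, one_mul]
    rw [this]
    ring

end Existence

end EntanglementEntropy

namespace EntanglementEntropy

open PowerSeries Finset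

/-! ### The filtration argument for the coefficients in `t`. -/

section Filtration

variable {𝔸 : Type*} [CommRing 𝔸] [Algebra ℚ 𝔸]

/-- The power series whose coefficients up to order `p` lie in the corresponding steps of a
filtration. -/
def filteredSeries (𝓕 : ℕ → Subalgebra ℚ 𝔸) (hmono : Monotone 𝓕) (p : ℕ) : Subring 𝔸⟦X⟧ where
  carrier := {f | ∀ i ≤ p, coeff i f ∈ 𝓕 (i + 1)}
  mul_mem' := by
    intro f g hf hg i hi
    rw [coeff_mul]
    refine sum_mem fun jk hjk => ?_
    have := mem_antidiagonal.mp hjk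
    exact mul_mem (hmono (by omega) (hf jk.1 (by omega))) (hmono (by omega) (hg jk.2 (by omega)))
  one_mem' := by
    intro i _
    rw [coeff_one]
    split_ifs
    · exact one_mem _
    · exact zero_mem _
  add_mem' := by
    intro f g hf hg i hi
    rw [map_add]
    exact add_mem (hf i hi) (hg i hi)
  zero_mem' := by
    intro i _
    rw [map_zero]
    exact zero_mem _
  neg_mem' := by
    intro f hf i hi
    rw [map_neg]
    exact neg_mem (hf i hi)

variable {𝓕 : ℕ → Subalgebra ℚ 𝔸} {hmono : Monotone 𝓕} {p : ℕ} {f : 𝔸⟦X⟧}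

lemma mem_filteredSeries :
    f ∈ filteredSeries 𝓕 hmono p ↔ ∀ i ≤ p, coeff i f ∈ 𝓕 (i + 1) := Iff.rfl

lemma filteredSeries_succ :
    f ∈ filteredSeries 𝓕 hmono (p + 1)
      ↔ f ∈ filteredSeries 𝓕 hmono p ∧ coeff (p + 1) f ∈ 𝓕 (p + 2) := by
  simp only [mem_filteredSeries]
  constructor
  · exact fun h => ⟨fun i hi => h i (by omega), h (p + 1) le_rfl⟩
  · rintro ⟨h1, h2⟩ i hi
    rcases hi.eq_or_lt with rfl | hlt
    · exact h2
    · exact h1 i (by omega)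

lemma C_mem_filteredSeries {a : 𝔸} (ha : a ∈ 𝓕 0) : C a ∈ filteredSeries 𝓕 hmono p := by
  intro i _
  rw [coeff_C]
  split_ifs
  · exact hmono (Nat.zero_le _) ha
  · exact zero_mem _

lemma X_mul_mem_filteredSeries (hf : f ∈ filteredSeries 𝓕 hmono p) :
    X * f ∈ filteredSeries 𝓕 hmono (p + 1) := by
  intro i hi
  cases i with
  | zero => simp
  | succ i =>
    rw [mul_comm, coeff_succ_mul_X]
    exact hmono (by omega) (hf i (by omega))

lemma X_mem_filteredSeries : X ∈ filteredSeries 𝓕 hmono p := by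
  intro i _
  rw [coeff_X]
  split_ifs
  · exact one_mem _
  · exact zero_mem _

/-- `t ∂_t` multiplies each coefficient by its index, so no order is lost. -/
lemma X_mul_formalDerivative_mem (hf : f ∈ filteredSeries 𝓕 hmono p) :
    X * formalDerivative 𝔸 f ∈ filteredSeries 𝓕 hmono p := by
  intro i hi
  cases i with
  | zero => simp
  | succ i =>
    rw [mul_comm, coeff_succ_mul_X, coeff_formalDerivative]
    refine mul_mem (hf _ hi) ?_
    exact add_mem (natCast_mem _ i) (one_mem _)

lemma X_mul_coeffwiseDerivation_mem {δ : RingDerivation 𝔸}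
    (hδ : ∀ r, ∀ a ∈ 𝓕 r, δ a ∈ 𝓕 (r + 1)) (hf : f ∈ filteredSeries 𝓕 hmono p) :
    X * coeffwiseDerivation δ f ∈ filteredSeries 𝓕 hmono (p + 1) := by
  intro i hi
  cases i with
  | zero => simp
  | succ i =>
    rw [mul_comm, coeff_succ_mul_X, coeff_coeffwiseDerivation]
    exact hδ _ _ (hf i (by omega))

/-- Dividing by `1 - X` forms partial sums of coefficients, which stay in the right step since the
filtration is increasing. -/
lemma mem_of_one_sub_X_mul_mem (hf : (1 - X) * f ∈ filteredSeries 𝓕 hmono p) :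
    f ∈ filteredSeries 𝓕 hmono p := by
  intro i hi
  induction i with
  | zero => simpa [sub_mul] using hf 0 hi
  | succ i ih =>
    have h1 := hf (i + 1) hi
    rw [sub_mul, one_mul, map_sub, mul_comm X, coeff_succ_mul_X] at h1
    have := add_mem h1 (hmono (by omega) (ih (by omega)) : coeff i f ∈ 𝓕 (i + 1 + 1))
    rwa [sub_add_cancel] at this

lemma mem_of_natCast_mul_mem {𝓑 : Subalgebra ℚ 𝔸} {a : 𝔸} (n : ℕ) (h : ((n : 𝔸) + 1) * a ∈ 𝓑) :
    a ∈ 𝓑 := by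
  have h1 := 𝓑.smul_mem h (((n : ℚ) + 1)⁻¹)
  have h2 : ((n : 𝔸) + 1) = algebraMap ℚ 𝔸 ((n : ℚ) + 1) := by simp
  rwa [h2, ← Algebra.smul_def, smul_smul, inv_mul_cancel₀ (by positivity), one_smul] at h1

/-- The system of equations satisfied by the deformed means of the linear statistics. -/
structure IsCumulantSystem (δ : RingDerivation 𝔸) (M N : 𝔸) (θ r A B w g : ℕ → 𝔸⟦X⟧) : Prop where
  off_log : ∀ a : ℕ, (1 - X : 𝔸⟦X⟧) * w a = (a : 𝔸⟦X⟧) * θ a + r a + X * formalDerivative 𝔸 (θ a)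
  off_pow : ∀ a : ℕ, (1 - X : 𝔸⟦X⟧) * g a = (a : 𝔸⟦X⟧) * r a + X * formalDerivative 𝔸 (r a)
  log_zero : formalDerivative 𝔸 (θ 0) = coeffwiseDerivation δ (θ 1)
  log : ∀ a : ℕ, (1 - X : 𝔸⟦X⟧) * (formalDerivative 𝔸 (θ a) - coeffwiseDerivation δ (θ (a + 1))
      + ∑ i ∈ range a, w (a - 1 - i) * w i)
    = ∑ i ∈ range a, A (a - 1 - i) *
        ((1 - X : 𝔸⟦X⟧) * (g 1 * A i) - (((i : 𝔸⟦X⟧) + 1) * w i + g i + X * formalDerivative 𝔸 (w i)))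
  pow : ∀ a : ℕ, (1 - X : 𝔸⟦X⟧) * (formalDerivative 𝔸 (r a) + w a - coeffwiseDerivation δ (r (a + 1))
      + ∑ i ∈ range a, (g (a - 1 - i) * w i + w (a - 1 - i) * g i))
    = ∑ i ∈ range a, (B (a - 1 - i) *
        ((1 - X : 𝔸⟦X⟧) * (g 1 * A i) - (((i : 𝔸⟦X⟧) + 1) * w i + g i + X * formalDerivative 𝔸 (w i)))
        + A (a - 1 - i) *
        ((1 - X : 𝔸⟦X⟧) * (g 1 * B i) - (((i : 𝔸⟦X⟧) + 1) * g i + X * formalDerivative 𝔸 (g i))))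
  diag_log : ∀ b : ℕ, (1 - X : 𝔸⟦X⟧) * A (b + 1) = ((b : 𝔸⟦X⟧) + 1 + C (M + N)) * A b + B b
      + X * formalDerivative 𝔸 (A b) + X * (A 1 * A b) + 2 * (1 - X : 𝔸⟦X⟧) * w b
  diag_pow : ∀ b : ℕ, (1 - X : 𝔸⟦X⟧) * B (b + 1) = ((b : 𝔸⟦X⟧) + 1 + C (M + N)) * B b
      + X * formalDerivative 𝔸 (B b) + X * (A 1 * B b) + 2 * (1 - X : 𝔸⟦X⟧) * g b
  diag_log_zero : formalDerivative 𝔸 (A 0) = coeffwiseDerivation δ (A 1)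
  diag_pow_zero : B 0 = 1
  pow_zero : r 0 = C M

namespace IsCumulantSystem

variable {δ : RingDerivation 𝔸} {M N : 𝔸} {θ r A B w g : ℕ → 𝔸⟦X⟧}
  (K : IsCumulantSystem δ M N θ r A B w g) (hmono : Monotone 𝓕)
  (hδ : ∀ r, ∀ a ∈ 𝓕 r, δ a ∈ 𝓕 (r + 1))

include K hδ in
lemma off_log_mem (hθ : ∀ a, θ (a + 1) ∈ filteredSeries 𝓕 hmono p)
    (hr : ∀ a, r a ∈ filteredSeries 𝓕 hmono p) (a : ℕ) : w a ∈ filteredSeries 𝓕 hmono p := by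
  refine mem_of_one_sub_X_mul_mem ?_
  rw [K.off_log]
  cases a with
  | zero =>
    -- `θ 0`, the deformed mean of the sum of logarithms, is not controlled by the hypotheses. It
    -- enters only through its `t`-derivative, which `log_zero` expresses by `θ 1`.
    rw [K.log_zero, Nat.cast_zero, zero_mul, zero_add]
    refine add_mem (hr 0) ?_
    exact (filteredSeries_succ.mp (X_mul_coeffwiseDerivation_mem hδ (hθ 0))).1
  | succ a =>
    exact add_mem (add_mem (mul_mem (natCast_mem _ _) (hθ a)) (hr _))
      (X_mul_formalDerivative_mem (hθ a))

include K in
lemma off_pow_mem (hr : ∀ a, r a ∈ filteredSeries 𝓕 hmono p) (a : ℕ) :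
    g a ∈ filteredSeries 𝓕 hmono p := by
  refine mem_of_one_sub_X_mul_mem ?_
  rw [K.off_pow]
  exact add_mem (mul_mem (natCast_mem _ _) (hr a)) (X_mul_formalDerivative_mem (hr a))

/-- All the deformed means have coefficients up to order `p` in the filtration. -/
structure CoeffsMem (θ r A B : ℕ → 𝔸⟦X⟧) (p : ℕ) : Prop where
  log : ∀ a, θ (a + 1) ∈ filteredSeries 𝓕 hmono p
  pow : ∀ a, r a ∈ filteredSeries 𝓕 hmono p
  diag_log : ∀ a, A a ∈ filteredSeries 𝓕 hmono p
  diag_pow : ∀ a, B a ∈ filteredSeries 𝓕 hmono p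

include K hδ in
-- All other terms of the decoupled equation are built from series already controlled to order `p`.
-- Differentiating in `t` thus agrees with applying `δ` at the next exponent, up to terms one step
-- below the new leading order.
lemma log_sub_mem (h : CoeffsMem hmono θ r A B p) (a : ℕ) :
    formalDerivative 𝔸 (θ a) - coeffwiseDerivation δ (θ (a + 1)) ∈ filteredSeries 𝓕 hmono p := by
  have hw := K.off_log_mem hmono hδ h.log h.pow
  have hg := K.off_pow_mem hmono h.pow
  have h1 : formalDerivative 𝔸 (θ a) - coeffwiseDerivation δ (θ (a + 1))
      + ∑ i ∈ range a, w (a - 1 - i) * w i ∈ filteredSeries 𝓕 hmono p := by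
    refine mem_of_one_sub_X_mul_mem ?_
    rw [K.log]
    refine sum_mem fun i _ => mul_mem (h.diag_log _) (sub_mem ?_ ?_)
    · exact mul_mem (sub_mem (one_mem _) X_mem_filteredSeries) (mul_mem (hg 1) (h.diag_log i))
    · exact add_mem (add_mem (mul_mem (add_mem (natCast_mem _ _) (one_mem _)) (hw i)) (hg i))
        (X_mul_formalDerivative_mem (hw i))
  have h2 : ∑ i ∈ range a, w (a - 1 - i) * w i ∈ filteredSeries 𝓕 hmono p :=
    sum_mem fun i _ => mul_mem (hw _) (hw i)
  simpa using sub_mem h1 h2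

include K hδ in
lemma pow_sub_mem (h : CoeffsMem hmono θ r A B p) (a : ℕ) :
    formalDerivative 𝔸 (r a) - coeffwiseDerivation δ (r (a + 1)) ∈ filteredSeries 𝓕 hmono p := by
  have hw := K.off_log_mem hmono hδ h.log h.pow
  have hg := K.off_pow_mem hmono h.pow
  have h1 : formalDerivative 𝔸 (r a) + w a - coeffwiseDerivation δ (r (a + 1))
      + ∑ i ∈ range a, (g (a - 1 - i) * w i + w (a - 1 - i) * g i)
      ∈ filteredSeries 𝓕 hmono p := by
    refine mem_of_one_sub_X_mul_mem ?_
    rw [K.pow]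
    refine sum_mem fun i _ => add_mem (mul_mem (h.diag_pow _) (sub_mem ?_ ?_))
      (mul_mem (h.diag_log _) (sub_mem ?_ ?_))
    · exact mul_mem (sub_mem (one_mem _) X_mem_filteredSeries) (mul_mem (hg 1) (h.diag_log i))
    · exact add_mem (add_mem (mul_mem (add_mem (natCast_mem _ _) (one_mem _)) (hw i)) (hg i))
        (X_mul_formalDerivative_mem (hw i))
    · exact mul_mem (sub_mem (one_mem _) X_mem_filteredSeries) (mul_mem (hg 1) (h.diag_pow i))
    · exact add_mem (mul_mem (add_mem (natCast_mem _ _) (one_mem _)) (hg i))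
        (X_mul_formalDerivative_mem (hg i))
  have h2 : w a + ∑ i ∈ range a, (g (a - 1 - i) * w i + w (a - 1 - i) * g i)
      ∈ filteredSeries 𝓕 hmono p :=
    add_mem (hw a) (sum_mem fun i _ => add_mem (mul_mem (hg _) (hw i)) (mul_mem (hw _) (hg i)))
  have h3 := sub_mem h1 h2
  have e : formalDerivative 𝔸 (r a) - coeffwiseDerivation δ (r (a + 1))
      = formalDerivative 𝔸 (r a) + w a - coeffwiseDerivation δ (r (a + 1))
      + ∑ i ∈ range a, (g (a - 1 - i) * w i + w (a - 1 - i) * g i)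
      - (w a + ∑ i ∈ range a, (g (a - 1 - i) * w i + w (a - 1 - i) * g i)) := by ring
  rw [e]; exact h3

include hδ in
lemma coeff_succ_mem {f f' : 𝔸⟦X⟧}
    (h : formalDerivative 𝔸 f - coeffwiseDerivation δ f' ∈ filteredSeries 𝓕 hmono p)
    (hf' : f' ∈ filteredSeries 𝓕 hmono p) : coeff (p + 1) f ∈ 𝓕 (p + 2) := by
  have h1 := h p le_rfl
  rw [map_sub, coeff_formalDerivative, coeff_coeffwiseDerivation] at h1
  have h2 := add_mem (hmono (Nat.le_succ _) h1) (hδ _ _ (hf' p le_rfl))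
  rw [sub_add_cancel, mul_comm] at h2
  exact mem_of_natCast_mul_mem p h2

include K hδ in
-- The dependencies are acyclic: decoupling gives the new coefficients of `θ` and `r`, these give
-- `w` and `g`, and then `B` and `A` follow by increasing exponent. The quadratic terms carry a
-- factor `X`, so for them order `p` suffices.
lemma coeffsMem_succ (hM : M ∈ 𝓕 0) (hN : N ∈ 𝓕 0) (h : CoeffsMem hmono θ r A B p) :
    CoeffsMem hmono θ r A B (p + 1) := by
  have hθ : ∀ a, θ (a + 1) ∈ filteredSeries 𝓕 hmono (p + 1) := fun a =>
    filteredSeries_succ.mpr ⟨h.log a,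
      coeff_succ_mem hmono hδ (K.log_sub_mem hmono hδ h (a + 1)) (h.log (a + 1))⟩
  have hr : ∀ a, r a ∈ filteredSeries 𝓕 hmono (p + 1) := fun a =>
    filteredSeries_succ.mpr ⟨h.pow a,
      coeff_succ_mem hmono hδ (K.pow_sub_mem hmono hδ h a) (h.pow (a + 1))⟩
  have hw := K.off_log_mem hmono hδ hθ hr
  have hg := K.off_pow_mem hmono hr
  have hs : ∀ b : ℕ, ((b : 𝔸⟦X⟧) + 1 + C (M + N)) ∈ filteredSeries 𝓕 hmono (p + 1) := fun b =>
    add_mem (add_mem (natCast_mem _ _) (one_mem _)) (C_mem_filteredSeries (add_mem hM hN))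
  have h2 : (2 : 𝔸⟦X⟧) * (1 - X) ∈ filteredSeries 𝓕 hmono (p + 1) :=
    mul_mem (ofNat_mem _ 2) (sub_mem (one_mem _) X_mem_filteredSeries)
  have hB : ∀ b, B b ∈ filteredSeries 𝓕 hmono (p + 1) := by
    intro b
    induction b with
    | zero => rw [K.diag_pow_zero]; exact one_mem _
    | succ b ih =>
      refine mem_of_one_sub_X_mul_mem ?_
      rw [K.diag_pow]
      exact add_mem (add_mem (add_mem (mul_mem (hs b) ih) (X_mul_formalDerivative_mem ih))
        (X_mul_mem_filteredSeries (mul_mem (h.diag_log 1) (h.diag_pow b)))) (mul_mem h2 (hg b))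
  have hA : ∀ b, A b ∈ filteredSeries 𝓕 hmono (p + 1) := by
    intro b
    induction b with
    | zero =>
      refine filteredSeries_succ.mpr ⟨h.diag_log 0, ?_⟩
      refine coeff_succ_mem hmono hδ (f' := A 1) ?_ (h.diag_log 1)
      rw [K.diag_log_zero, sub_self]
      exact zero_mem _
    | succ b ih =>
      refine mem_of_one_sub_X_mul_mem ?_
      rw [K.diag_log]
      exact add_mem (add_mem (add_mem (add_mem (mul_mem (hs b) ih) (hB b))
        (X_mul_formalDerivative_mem ih))
        (X_mul_mem_filteredSeries (mul_mem (h.diag_log 1) (h.diag_log b)))) (mul_mem h2 (hw b))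
  exact ⟨hθ, hr, hA, hB⟩

include K hδ in
lemma coeffsMem (hM : M ∈ 𝓕 0) (hN : N ∈ 𝓕 0) (h0 : CoeffsMem hmono θ r A B 0) :
    ∀ p, CoeffsMem hmono θ r A B p
  | 0 => h0
  | p + 1 => K.coeffsMem_succ hmono hδ hM hN (coeffsMem hM hN h0 p)

include K hδ in
/-- The leading term of the coefficients of the deformed logarithmic means. -/
lemma leading_coeff (hM : M ∈ 𝓕 0) (hN : N ∈ 𝓕 0) (h0 : CoeffsMem hmono θ r A B 0)
    {ρ Ψ : ℕ → 𝔸} (hρ : ∀ k, ρ k ∈ 𝓕 0) (hΨ : ∀ j, Ψ j ∈ 𝓕 (j + 1))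
    (hΨδ : ∀ j, δ (Ψ j) = Ψ (j + 1)) (hlead : ∀ a, coeff 0 (θ (a + 1)) - ρ (a + 1) * Ψ 0 ∈ 𝓕 0)
    (p a : ℕ) : (p.factorial : 𝔸) * coeff p (θ (a + 1)) - ρ (a + 1 + p) * Ψ p ∈ 𝓕 p := by
  induction p generalizing a with
  | zero => simpa using hlead a
  | succ p ih =>
    have h1 := K.log_sub_mem hmono hδ (K.coeffsMem hmono hδ hM hN h0 p) (a + 1) p le_rfl
    rw [map_sub, coeff_formalDerivative, coeff_coeffwiseDerivation] at h1
    -- One more order in `t` costs one `δ` at the next exponent. On the leading product, only the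
    -- term where `δ` hits `Ψ p` leaves step `p + 1`; the term with the derivative of `ρ` stays
    -- inside.
    have h2 := hδ _ _ (ih (a + 1))
    rw [map_sub, Derivation.leibniz, Derivation.leibniz, Derivation.map_natCast, hΨδ] at h2
    simp only [smul_eq_mul, mul_zero, add_zero] at h2
    have h3 : Ψ p * δ (ρ (a + 1 + 1 + p)) ∈ 𝓕 (p + 1) :=
      mul_mem (hΨ p) (hmono (by omega) (hδ _ _ (hρ _)))
    have h4 := add_mem (add_mem (mul_mem (natCast_mem _ p.factorial) h1) h2) h3
    have e : ((p + 1).factorial : 𝔸) * coeff (p + 1) (θ (a + 1))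
        - ρ (a + 1 + (p + 1)) * Ψ (p + 1)
        = (p.factorial : 𝔸) * (coeff (p + 1) (θ (a + 1)) * ((p : 𝔸) + 1)
            - δ (coeff p (θ (a + 1 + 1))))
          + ((p.factorial : 𝔸) * δ (coeff p (θ (a + 1 + 1)))
            - (ρ (a + 1 + 1 + p) * Ψ (p + 1) + Ψ p * δ (ρ (a + 1 + 1 + p))))
          + Ψ p * δ (ρ (a + 1 + 1 + p)) := by
      rw [Nat.factorial_succ, show a + 1 + 1 + p = a + 1 + (p + 1) by ring]
      push_cast; ring
    rw [e]; exact h4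

end IsCumulantSystem

end Filtration

/-! ### Recurrences for the means at `t = 0`. -/

section UndeformedMeans

variable {𝔸 : Type*} [CommRing 𝔸] [Algebra ℚ 𝔸]

/-- The system of recurrences satisfied by the undeformed means. -/
structure IsMeanSystem (M N Ψ : 𝔸) (A A' B B' w g : ℕ → 𝔸) : Prop where
  diag_log : ∀ b : ℕ, A (b + 1) = (b + 1 + (M + N)) * A b + B b + 2 * w b
  diag_log' : ∀ b : ℕ, A' (b + 1) = (M + N - 1 - b) * A' b - B' b + 2 * w b
  diag_pow : ∀ b : ℕ, B (b + 1) = (b + 1 + (M + N)) * B b + 2 * g b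
  diag_pow' : ∀ b : ℕ, B' (b + 1) = (M + N - 1 - b) * B' b + 2 * g b
  off_log : ∀ b : ℕ, (b + 1) * w b + g b = M * N * (A b - A' b)
  off_pow : ∀ b : ℕ, (b + 1) * g b = M * N * (B b - B' b)
  diag_log_zero : N * A 0 = N * Ψ + 1
  diag_log_zero' : A' 0 = Ψ
  diag_pow_zero : B 0 = 1
  diag_pow_zero' : B' 0 = 1
  off_log_zero : w 0 = M
  off_pow_zero : g 0 = 0

/-- Logarithmic and power quantities obey the same linear recurrences up to power terms, so the
former are `Ψ` times the latter modulo `𝓟`. The diagonal elements are scaled by `N` because `A 0` is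
formally `Ψ + 1/N`. In `off_log` this factor `N` is already present, so `w` needs no denominator. -/
lemma IsMeanSystem.mem {M N Ψ : 𝔸} {A A' B B' w g : ℕ → 𝔸}
    (K : IsMeanSystem M N Ψ A A' B B' w g) {𝓟 : Subalgebra ℚ 𝔸} (hM : M ∈ 𝓟) (hN : N ∈ 𝓟)
    (b : ℕ) :
    (B b ∈ 𝓟 ∧ B' b ∈ 𝓟 ∧ g b ∈ 𝓟) ∧ N * A b - Ψ * (N * B b) ∈ 𝓟 ∧
      N * A' b - Ψ * (N * B' b) ∈ 𝓟 ∧ w b - Ψ * g b ∈ 𝓟 := by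
  induction b with
  | zero =>
    rw [K.diag_log_zero, K.diag_log_zero', K.diag_pow_zero, K.diag_pow_zero', K.off_log_zero,
      K.off_pow_zero]
    refine ⟨⟨one_mem _, one_mem _, zero_mem _⟩, ?_, ?_, ?_⟩
    · rw [show N * Ψ + 1 - Ψ * (N * 1) = 1 by ring]; exact one_mem _
    · rw [show N * Ψ - Ψ * (N * 1) = 0 by ring]; exact zero_mem _
    · rw [mul_zero, sub_zero]; exact hM
  | succ b ih =>
    obtain ⟨⟨h1, h2, h3⟩, h4, h5, h6⟩ := ih
    have hs : (b + 1 + (M + N) : 𝔸) ∈ 𝓟 :=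
      add_mem (add_mem (natCast_mem _ _) (one_mem _)) (add_mem hM hN)
    have hs' : (M + N - 1 - b : 𝔸) ∈ 𝓟 :=
      sub_mem (sub_mem (add_mem hM hN) (one_mem _)) (natCast_mem _ _)
    have two : (2 : 𝔸) ∈ 𝓟 := ofNat_mem _ 2
    have g1 : B (b + 1) ∈ 𝓟 := by
      rw [K.diag_pow]; exact add_mem (mul_mem hs h1) (mul_mem two h3)
    have g2 : B' (b + 1) ∈ 𝓟 := by
      rw [K.diag_pow']; exact add_mem (mul_mem hs' h2) (mul_mem two h3)
    have g3 : g (b + 1) ∈ 𝓟 := by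
      refine mem_of_natCast_mul_mem (b + 1) ?_
      rw [K.off_pow]; exact mul_mem (mul_mem hM hN) (sub_mem g1 g2)
    have g4 : N * A (b + 1) - Ψ * (N * B (b + 1)) ∈ 𝓟 := by
      rw [K.diag_log, K.diag_pow]
      have := add_mem (add_mem (mul_mem hs h4) (mul_mem hN h1))
        (mul_mem (mul_mem two hN) h6)
      convert this using 1; ring
    have g5 : N * A' (b + 1) - Ψ * (N * B' (b + 1)) ∈ 𝓟 := by
      rw [K.diag_log', K.diag_pow']
      have := add_mem (sub_mem (mul_mem hs' h5) (mul_mem hN h2))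
        (mul_mem (mul_mem two hN) h6)
      convert this using 1; ring
    refine ⟨⟨g1, g2, g3⟩, g4, g5, mem_of_natCast_mul_mem (b + 1) ?_⟩
    have := sub_mem (mul_mem hM (sub_mem g4 g5)) g3
    convert this using 1
    linear_combination K.off_log (b + 1) - Ψ * K.off_pow (b + 1)

end UndeformedMeans

end EntanglementEntropy

namespace EntanglementEntropy

open MeasureTheory Finset

/-! ### Andréief's identity for powers of a linear statistic. -/

section Andreief

open PowerSeries

/-- The generating series of the moments of the powers of `F` for the weight `w`. -/
noncomputable def weightedMoment (w F : ℝ → ℝ) (k : ℕ) : ℝ⟦X⟧ :=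
  PowerSeries.mk fun p => (∫ x, x ^ k * F x ^ p * w x) / p.factorial

lemma vandermondeSq_eq {m : ℕ} (x : Fin m → ℝ) :
    vandermondeSq x = (Matrix.vandermonde x).transpose.det * (Matrix.vandermonde x).transpose.det := by
  rw [Matrix.det_transpose, Matrix.det_vandermonde, vandermondeSq, ← prod_mul_distrib]
  refine prod_congr rfl fun i _ => ?_
  rw [← prod_mul_distrib]
  exact prod_congr rfl fun j _ => by ring

lemma prod_rescale_exp {ι : Type*} (s : Finset ι) (a : ι → ℝ) :
    ∏ i ∈ s, rescale (a i) (exp ℝ) = rescale (∑ i ∈ s, a i) (exp ℝ) := by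
  classical
  induction s using Finset.induction_on with
  | empty => ext n; simp [coeff_one]
  | insert i s hi ih => rw [prod_insert hi, sum_insert hi, ih, exp_mul_exp_eq_exp_add]

lemma sum_pow_eq {m : ℕ} (a : Fin m → ℝ) (l : ℕ) :
    (∑ i, a i) ^ l = l.factorial * ∑ p ∈ finsuppAntidiag (univ : Finset (Fin m)) l,
      ∏ i, (a i ^ p i / (p i).factorial) := by
  have h := congrArg (coeff l) (prod_rescale_exp univ a)
  rw [coeff_prod, coeff_rescale, coeff_exp] at h
  simp only [coeff_rescale, coeff_exp] at h
  simp only [one_div, map_inv₀, map_natCast] at h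
  simp only [div_eq_mul_inv]
  rw [h]
  field_simp

/-- Reindexing `σ` by right multiplication with `τ` turns each inner sum into the Leibniz formula,
so `τ` contributes only a factor `m!`. -/
lemma sum_perm_mul_prod {R : Type*} [CommRing R] {m : ℕ} (M : Matrix (Fin m) (Fin m) R) :
    ∑ σ : Equiv.Perm (Fin m), ∑ τ : Equiv.Perm (Fin m),
      ((Equiv.Perm.sign σ : ℤ) : R) * ((Equiv.Perm.sign τ : ℤ) : R) * ∏ i, M (σ i) (τ i)
      = m.factorial * M.det := by
  have h : ∀ τ : Equiv.Perm (Fin m), ∑ σ : Equiv.Perm (Fin m),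
      ((Equiv.Perm.sign σ : ℤ) : R) * ((Equiv.Perm.sign τ : ℤ) : R) * ∏ i, M (σ i) (τ i)
      = M.det := by
    intro τ
    rw [Matrix.det_apply', ← Equiv.sum_comp (Equiv.mulRight τ)]
    refine sum_congr rfl fun σ _ => ?_
    rw [← Equiv.prod_comp τ fun i => M (σ i) i]
    simp only [Equiv.coe_mulRight, Equiv.Perm.mul_apply, Equiv.Perm.sign_mul]
    congr 1
    rw [Units.val_mul, Int.cast_mul, mul_assoc, ← Int.cast_mul, ← Units.val_mul,
      Int.units_mul_self]
    simp
  rw [sum_comm, sum_congr rfl fun τ _ => h τ, sum_const, card_univ, Fintype.card_perm,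
    Fintype.card_fin, nsmul_eq_mul]

/-- Two Leibniz expansions for the squared Vandermonde and a multinomial expansion of the power give
a finite sum of products of one-variable functions, which integrates factor by factor. -/
lemma andreief_integrand {m : ℕ} (w F : ℝ → ℝ) (l : ℕ) (x : Fin m → ℝ) :
    (∑ i, F (x i)) ^ l * (vandermondeSq x * ∏ i, w (x i))
      = l.factorial * ∑ σ : Equiv.Perm (Fin m), ∑ τ : Equiv.Perm (Fin m),
        ((Equiv.Perm.sign σ : ℤ) : ℝ) * ((Equiv.Perm.sign τ : ℤ) : ℝ) *
        ∑ p ∈ finsuppAntidiag (univ : Finset (Fin m)) l,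
          ∏ i, (x i ^ ((σ i : ℕ) + τ i) * F (x i) ^ p i * w (x i) / (p i).factorial) := by
  rw [sum_pow_eq, vandermondeSq_eq, Matrix.det_apply']
  simp only [Matrix.transpose_apply, Matrix.vandermonde_apply]
  rw [sum_mul_sum, mul_assoc]
  congr 1
  simp only [mul_sum, sum_mul]
  rw [sum_comm]
  refine sum_congr rfl fun σ _ => sum_congr rfl fun τ _ => sum_congr rfl fun p _ => ?_
  have : ∏ i, (x i ^ ((σ i : ℕ) + τ i) * F (x i) ^ p i * w (x i) / (p i).factorial)
      = (∏ i, (F (x i) ^ p i / (p i).factorial)) * ((∏ i, x i ^ (σ i : ℕ)) * ∏ i, x i ^ (τ i : ℕ))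
        * ∏ i, w (x i) := by
    simp only [← prod_mul_distrib]
    exact prod_congr rfl fun i _ => by rw [pow_add]; ring
  rw [this]; ring

variable {w F : ℝ → ℝ} (hF : ∀ k p : ℕ, Integrable fun x => x ^ k * F x ^ p * w x)
include hF

lemma integrable_andreief (m l : ℕ) :
    Integrable fun x : Fin m → ℝ => (∑ i, F (x i)) ^ l * (vandermondeSq x * ∏ i, w (x i)) := by
  simp only [andreief_integrand]
  refine Integrable.const_mul (integrable_finsetSum _ fun σ _ => integrable_finsetSum _
    fun τ _ => Integrable.const_mul (integrable_finsetSum _ fun p _ => ?_) _) _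
  exact Integrable.fintype_prod (f := fun i x =>
    x ^ ((σ i : ℕ) + τ i) * F x ^ p i * w x / (p i).factorial)
    fun i => (hF _ _).div_const _

/-- The Andréief identity for powers of linear statistics. -/
lemma integral_andreief (m l : ℕ) :
    ∫ x : Fin m → ℝ, (∑ i, F (x i)) ^ l * (vandermondeSq x * ∏ i, w (x i))
      = l.factorial * m.factorial *
        coeff l (Matrix.of fun i j : Fin m => weightedMoment w F (i + j)).det := by
  have hI : ∀ (σ τ : Equiv.Perm (Fin m)) (p : Fin m →₀ ℕ), Integrable fun x : Fin m → ℝ =>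
      ∏ i, (x i ^ ((σ i : ℕ) + τ i) * F (x i) ^ p i * w (x i) / (p i).factorial) :=
    fun σ τ p => Integrable.fintype_prod (f := fun i x =>
      x ^ ((σ i : ℕ) + τ i) * F x ^ p i * w x / (p i).factorial)
      fun i => (hF _ _).div_const _
  have hS : ∀ σ τ : Equiv.Perm (Fin m), Integrable fun x : Fin m → ℝ =>
      ∑ p ∈ finsuppAntidiag (univ : Finset (Fin m)) l,
        ∏ i, (x i ^ ((σ i : ℕ) + τ i) * F (x i) ^ p i * w (x i) / (p i).factorial) :=
    fun σ τ => integrable_finsetSum _ fun p _ => hI σ τ p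
  simp only [andreief_integrand]
  rw [integral_const_mul, integral_finsetSum _ fun σ _ => integrable_finsetSum _
    fun τ _ => (hS σ τ).const_mul _]
  have h1 : ∀ σ τ : Equiv.Perm (Fin m), ∫ x : Fin m → ℝ,
      ((Equiv.Perm.sign σ : ℤ) : ℝ) * ((Equiv.Perm.sign τ : ℤ) : ℝ) *
        ∑ p ∈ finsuppAntidiag (univ : Finset (Fin m)) l,
        ∏ i, (x i ^ ((σ i : ℕ) + τ i) * F (x i) ^ p i * w (x i) / (p i).factorial)
      = coeff l (((Equiv.Perm.sign σ : ℤ) : ℝ⟦X⟧) * ((Equiv.Perm.sign τ : ℤ) : ℝ⟦X⟧) *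
        ∏ i, (Matrix.of fun i j : Fin m => weightedMoment w F (i + j)) (σ i) (τ i)) := by
    intro σ τ
    rw [integral_const_mul, integral_finsetSum _ fun p _ => hI σ τ p, ← Int.cast_mul,
      ← Int.cast_mul, show (((Equiv.Perm.sign σ : ℤ) * (Equiv.Perm.sign τ : ℤ) : ℤ) : ℝ⟦X⟧)
        = C (((Equiv.Perm.sign σ : ℤ) * (Equiv.Perm.sign τ : ℤ) : ℤ) : ℝ) from (map_intCast (C (R := ℝ)) _).symm,
      coeff_C_mul, coeff_prod]
    congr 1
    refine sum_congr rfl fun p _ => ?_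
    rw [integral_fintype_prod_volume_eq_prod (fun i x =>
      x ^ ((σ i : ℕ) + τ i) * F x ^ p i * w x / (p i).factorial)]
    refine prod_congr rfl fun i _ => ?_
    rw [Matrix.of_apply, weightedMoment, coeff_mk, integral_div]
  rw [sum_congr rfl fun σ _ => (integral_finsetSum _ fun τ _ => (hS σ τ).const_mul _)]
  simp only [h1]
  simp only [← map_sum]
  rw [sum_perm_mul_prod, ← map_natCast (C (R := ℝ)), coeff_C_mul, mul_assoc]

end Andreief

/-! ### Positivity of the undeformed moment functional. -/

section Positivity

open Polynomial

lemma momentFunctional_integral {w : ℝ → ℝ} (hw : ∀ k : ℕ, Integrable fun x => x ^ k * w x)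
    (g : ℝ[X]) : (Integrable fun x => g.eval x * w x) ∧
      momentFunctional (fun k => ∫ x, x ^ k * w x) g = ∫ x, g.eval x * w x := by
  induction g using Polynomial.induction_on' with
  | add p q hp hq =>
    simp only [eval_add, add_mul, map_add]
    exact ⟨hp.1.add hq.1, by rw [integral_add hp.1 hq.1, hp.2, hq.2]⟩
  | monomial k a =>
    simp only [eval_monomial, mul_assoc, momentFunctional_monomial]
    exact ⟨(hw k).const_mul a, by rw [integral_const_mul]⟩

/-- On the half line the integrand vanishes only at the finitely many roots of `g`, so its support
has positive measure. -/
lemma momentFunctional_mul_self_pos {w : ℝ → ℝ}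
    (hw : ∀ k : ℕ, Integrable fun x => x ^ k * w x) (h0 : ∀ x, 0 ≤ w x)
    (hpos : ∀ x, 0 < x → 0 < w x) {g : ℝ[X]} (hg : g ≠ 0) :
    0 < momentFunctional (fun k => ∫ x, x ^ k * w x) (g * g) := by
  obtain ⟨hI, e⟩ := momentFunctional_integral hw (g * g)
  rw [e, integral_pos_iff_support_of_nonneg _ hI]
  · have hsub : Set.Ioi (0 : ℝ) \ (g.roots.toFinset : Set ℝ)
        ⊆ Function.support fun x => (g * g).eval x * w x := by
      rintro x ⟨hx, hr⟩
      have hx' : g.eval x ≠ 0 := fun h => hr (by simpa [hg] using h)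
      rw [Function.mem_support, eval_mul]
      exact mul_ne_zero (mul_ne_zero hx' hx') (hpos x hx).ne'
    refine lt_of_lt_of_le ?_ (measure_mono hsub)
    rw [measure_sdiff_null ((g.roots.toFinset).measure_zero volume)]
    simp
  · intro x
    simp only [eval_mul, Pi.zero_apply]
    exact mul_nonneg (mul_self_nonneg _) (h0 x)

end Positivity

end EntanglementEntropy

namespace EntanglementEntropy

open MeasureTheory Finset

/-! ### Integrals against normalized densities. -/

section Normalize

variable {Ω : Type*} [MeasurableSpace Ω] {ν : Measure Ω} {W : Ω → ℝ}

lemma integral_withDensity_ofReal (hW : Integrable W ν) (h0 : 0 ≤ W) (f : Ω → ℝ) :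
    ∫ x, f x ∂(ν.withDensity fun x => ENNReal.ofReal (W x)) = ∫ x, f x * W x ∂ν := by
  rw [integral_withDensity_eq_integral_toReal_smul₀ hW.aemeasurable.ennreal_ofReal
    (Filter.Eventually.of_forall fun _ => ENNReal.ofReal_lt_top)]
  refine integral_congr_ae (Filter.Eventually.of_forall fun x => ?_)
  simp only [ENNReal.toReal_ofReal (h0 x), smul_eq_mul, mul_comm]

lemma integrable_withDensity_ofReal_iff (hW : Integrable W ν) (h0 : 0 ≤ W) (f : Ω → ℝ) :
    Integrable f (ν.withDensity fun x => ENNReal.ofReal (W x))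
      ↔ Integrable (fun x => f x * W x) ν := by
  rw [integrable_withDensity_iff_integrable_smul₀' hW.aemeasurable.ennreal_ofReal
    (Filter.Eventually.of_forall fun _ => ENNReal.ofReal_lt_top)]
  refine integrable_congr (Filter.Eventually.of_forall fun x => ?_)
  simp only [ENNReal.toReal_ofReal (h0 x), smul_eq_mul, mul_comm]

lemma withDensity_ofReal_univ (hW : Integrable W ν) (h0 : 0 ≤ W) :
    (ν.withDensity fun x => ENNReal.ofReal (W x)) Set.univ = ENNReal.ofReal (∫ x, W x ∂ν) := by
  rw [withDensity_apply _ MeasurableSet.univ, Measure.restrict_univ,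
    ofReal_integral_eq_lintegral_ofReal hW (Filter.Eventually.of_forall h0)]

lemma integral_normalize (μ : Measure Ω) (f : Ω → ℝ) :
    ∫ x, f x ∂(normalize μ) = (μ.real Set.univ)⁻¹ * ∫ x, f x ∂μ := by
  rw [normalize, integral_smul_measure, ENNReal.toReal_inv]; rfl

lemma integrable_normalize {μ : Measure Ω} (h : μ Set.univ ≠ 0) {f : Ω → ℝ}
    (hf : Integrable f μ) : Integrable f (normalize μ) :=
  hf.smul_measure (ENNReal.inv_ne_top.mpr h)

end Normalize

/-! ### The one-variable Laguerre weight. -/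

section Laguerre

open Classical in
/-- The Laguerre weight on the positive half line, extended by zero. -/
noncomputable def laguerreWeight (α x : ℝ) : ℝ := if 0 < x then x ^ α * Real.exp (-x) else 0

lemma laguerreWeight_nonneg (α x : ℝ) : 0 ≤ laguerreWeight α x := by
  rw [laguerreWeight]; split_ifs <;> positivity

lemma laguerreWeight_pos (α : ℝ) {x : ℝ} (hx : 0 < x) : 0 < laguerreWeight α x := by
  rw [laguerreWeight, if_pos hx]; positivity

lemma wishartWeight_eq (m : ℕ) (α : ℝ) (x : Fin m → ℝ) :
    wishartWeight m α x = vandermondeSq x * ∏ i, laguerreWeight α (x i) := by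
  rw [wishartWeight]
  split_ifs with h
  · congr 1; exact prod_congr rfl fun i _ => by rw [laguerreWeight, if_pos (h i)]
  · push Not at h
    obtain ⟨i, hi⟩ := h
    rw [prod_eq_zero (mem_univ i) (by rw [laguerreWeight, if_neg hi.not_gt]), mul_zero]

lemma vandermondeSq_nonneg {m : ℕ} (x : Fin m → ℝ) : 0 ≤ vandermondeSq x :=
  prod_nonneg fun _ _ => prod_nonneg fun _ _ => sq_nonneg _

lemma wishartWeight_nonneg (m : ℕ) (α : ℝ) : 0 ≤ wishartWeight m α := fun x => by
  rw [wishartWeight_eq]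
  exact mul_nonneg (vandermondeSq_nonneg x) (prod_nonneg fun _ _ => laguerreWeight_nonneg _ _)

variable {α : ℝ} (hα : -1 < α)

lemma laguerre_integrand_eq (α : ℝ) (k p : ℕ) :
    (fun x => x ^ k * Real.log x ^ p * laguerreWeight α x)
      = (Set.Ioi 0).indicator fun x : ℝ =>
        x ^ (α + 1 + k - 1) * Real.log x ^ p * Real.exp (-x) := by
  funext x
  by_cases hx : 0 < x
  · rw [Set.indicator_of_mem (Set.mem_Ioi.mpr hx), laguerreWeight, if_pos hx,
      show α + 1 + k - 1 = α + k by ring, Real.rpow_add hx, Real.rpow_natCast]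
    ring
  · rw [Set.indicator_of_notMem (s := Set.Ioi (0 : ℝ)) hx, laguerreWeight, if_neg hx, mul_zero]

include hα in
lemma integrable_laguerre (k p : ℕ) :
    Integrable fun x => x ^ k * Real.log x ^ p * laguerreWeight α x := by
  rw [laguerre_integrand_eq, integrable_indicator_iff measurableSet_Ioi]
  exact integrableOn_gammaLog p (by have := (Nat.cast_nonneg k : (0 : ℝ) ≤ k); linarith)

lemma integral_laguerre (α : ℝ) (k p : ℕ) :
    ∫ x, x ^ k * Real.log x ^ p * laguerreWeight α x = gammaLog p (α + 1 + k) := by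
  rw [laguerre_integrand_eq, integral_indicator measurableSet_Ioi, gammaLog]

lemma integral_laguerre_zero (α : ℝ) (k : ℕ) :
    ∫ x, x ^ k * laguerreWeight α x = gammaLog 0 (α + 1 + k) := by
  simpa using integral_laguerre α k 0

lemma pow_mul_pow_log (a b k p : ℕ) (x : ℝ) :
    x ^ k * (x ^ a * Real.log x ^ b) ^ p * laguerreWeight α x
      = x ^ (k + a * p) * Real.log x ^ (b * p) * laguerreWeight α x := by
  rw [mul_pow, ← pow_mul, ← pow_mul, pow_add]; ring

include hα in
lemma integrable_laguerre_pow (a b k p : ℕ) :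
    Integrable fun x => x ^ k * (x ^ a * Real.log x ^ b) ^ p * laguerreWeight α x := by
  simp only [pow_mul_pow_log]; exact integrable_laguerre hα _ _

lemma integral_laguerre_pow (α : ℝ) (a b k p : ℕ) :
    ∫ x, x ^ k * (x ^ a * Real.log x ^ b) ^ p * laguerreWeight α x
      = gammaLog (b * p) (α + 1 + (k + a * p : ℕ)) := by
  simp only [pow_mul_pow_log]; exact integral_laguerre _ _ _

include hα in
lemma integrable_laguerre_zero (k : ℕ) : Integrable fun x => x ^ k * laguerreWeight α x := by
  simpa using integrable_laguerre hα k 0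

end Laguerre

/-! ### Moments and means of linear statistics over the Wishart-Laguerre ensemble. -/

section Wishart

open PowerSeries

variable {α : ℝ} (hα : -1 < α) {F : ℝ → ℝ}
  (hF : ∀ k p : ℕ, Integrable fun x => x ^ k * F x ^ p * laguerreWeight α x)

lemma constantCoeff_weightedMoment (w F : ℝ → ℝ) (k : ℕ) :
    constantCoeff (weightedMoment w F k) = ∫ x, x ^ k * w x := by
  rw [← coeff_zero_eq_constantCoeff_apply, weightedMoment, coeff_mk]; simp

lemma coeff_one_weightedMoment (w F : ℝ → ℝ) (k : ℕ) :
    coeff 1 (weightedMoment w F k) = ∫ x, x ^ k * F x * w x := by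
  rw [weightedMoment, coeff_mk]; simp

include hα in
lemma exists_isOPS_weightedMoment (F : ℝ → ℝ) :
    ∃ π h hi, IsOPS (weightedMoment (laguerreWeight α) F) π h hi := by
  refine exists_isOPS_of_pos (constantCoeff (R := ℝ)) (fun a ha => ?_) _ fun g hg => ?_
  · rw [PowerSeries.isUnit_iff_constantCoeff]; exact ha.isUnit
  · simp only [constantCoeff_weightedMoment]
    exact momentFunctional_mul_self_pos (integrable_laguerre_zero hα) (laguerreWeight_nonneg α)
      (fun x hx => laguerreWeight_pos α hx) hg

include hα in
lemma constantCoeff_det_pos (F : ℝ → ℝ) (m : ℕ) :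
    0 < constantCoeff (Matrix.of fun i j : Fin m =>
      weightedMoment (laguerreWeight α) F (i + j)).det := by
  obtain ⟨π, h, hi, H⟩ := exists_isOPS_weightedMoment hα F
  rw [H.det_hankel, map_prod]
  refine prod_pos fun k _ => ?_
  have H' := H.map (constantCoeff (R := ℝ))
  rw [← H'.norm k]
  simp only [constantCoeff_weightedMoment]
  refine momentFunctional_mul_self_pos (integrable_laguerre_zero hα) (laguerreWeight_nonneg α)
      (fun x hx => laguerreWeight_pos α hx) fun h0 => ?_
  have := H'.coeff_self k
  rw [h0] at this
  simp at this

include hα in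
lemma integrable_wishartWeight (m : ℕ) : Integrable (wishartWeight m α) := by
  have := integrable_andreief (w := laguerreWeight α) (F := fun x => x ^ 0 * Real.log x ^ 0)
    (integrable_laguerre_pow hα 0 0) m 0
  simpa [← wishartWeight_eq] using this

lemma integral_wishartWeight (F : ℝ → ℝ)
    (hF : ∀ k p : ℕ, Integrable fun x => x ^ k * F x ^ p * laguerreWeight α x) (m : ℕ) :
    ∫ x, wishartWeight m α x = m.factorial * constantCoeff (Matrix.of fun i j : Fin m =>
      weightedMoment (laguerreWeight α) F (i + j)).det := by
  have := integral_andreief hF m 0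
  rw [coeff_zero_eq_constantCoeff_apply] at this
  simpa [← wishartWeight_eq] using this

include hα in
lemma integral_wishartWeight_pos (m : ℕ) : 0 < ∫ x, wishartWeight m α x := by
  rw [integral_wishartWeight _ (integrable_laguerre_pow hα 0 0)]
  exact mul_pos (by positivity) (constantCoeff_det_pos hα _ m)

/-- The unnormalized Wishart-Laguerre measure. -/
noncomputable def wishartUnnormalized (m : ℕ) (α : ℝ) : Measure (Fin m → ℝ) :=
  volume.withDensity fun x => ENNReal.ofReal (wishartWeight m α x)

include hα in
lemma wishartUnnormalized_univ (m : ℕ) :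
    wishartUnnormalized m α Set.univ = ENNReal.ofReal (∫ x, wishartWeight m α x) :=
  withDensity_ofReal_univ (integrable_wishartWeight hα m) (wishartWeight_nonneg m α)

include hα in
lemma wishartUnnormalized_univ_ne_zero (m : ℕ) : wishartUnnormalized m α Set.univ ≠ 0 := by
  rw [wishartUnnormalized_univ hα]
  simpa using integral_wishartWeight_pos hα m

include hα hF in
lemma integrable_wishartUnnormalized_pow (m l : ℕ) :
    Integrable (fun x : Fin m → ℝ => (∑ i, F (x i)) ^ l) (wishartUnnormalized m α) := by
  rw [wishartUnnormalized, integrable_withDensity_ofReal_iff (integrable_wishartWeight hα m)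
    (wishartWeight_nonneg m α)]
  simp only [wishartWeight_eq]
  exact integrable_andreief hF m l

include hα hF in
lemma integrable_wishartLaguerre_pow (m l : ℕ) :
    Integrable (fun x : Fin m → ℝ => (∑ i, F (x i)) ^ l) (wishartLaguerre m α) :=
  integrable_normalize (wishartUnnormalized_univ_ne_zero hα m)
    (integrable_wishartUnnormalized_pow hα hF m l)

include hα hF in
/-- The moments of linear statistics over the Wishart-Laguerre ensemble. -/
lemma integral_wishartLaguerre_pow (m l : ℕ) :
    ∫ x : Fin m → ℝ, (∑ i, F (x i)) ^ l ∂(wishartLaguerre m α) = l.factorial *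
      (coeff l (Matrix.of fun i j : Fin m => weightedMoment (laguerreWeight α) F (i + j)).det /
      constantCoeff (Matrix.of fun i j : Fin m =>
        weightedMoment (laguerreWeight α) F (i + j)).det) := by
  have h1 : (wishartUnnormalized m α).real Set.univ = ∫ x, wishartWeight m α x := by
    rw [Measure.real, wishartUnnormalized_univ hα,
      ENNReal.toReal_ofReal (integral_wishartWeight_pos hα m).le]
  have h2 : ∫ x : Fin m → ℝ, (∑ i, F (x i)) ^ l ∂(wishartUnnormalized m α)
      = l.factorial * m.factorial * coeff l (Matrix.of fun i j : Fin m =>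
        weightedMoment (laguerreWeight α) F (i + j)).det := by
    rw [wishartUnnormalized, integral_withDensity_ofReal (integrable_wishartWeight hα m)
      (wishartWeight_nonneg m α)]
    simp only [wishartWeight_eq]
    exact integral_andreief hF m l
  change ∫ x : Fin m → ℝ, (∑ i, F (x i)) ^ l ∂(normalize (wishartUnnormalized m α)) = _
  rw [integral_normalize, h1, h2, integral_wishartWeight F hF]
  have := (constantCoeff_det_pos hα F m).ne'
  field_simp

include hα hF in
/-- The mean of a linear statistic over the Wishart-Laguerre ensemble. -/
lemma integral_wishartLaguerre_linStat {π : ℕ → Polynomial ℝ} {h hi : ℕ → ℝ}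
    (H : IsOPS (fun k => ∫ x, x ^ k * laguerreWeight α x) π h hi) (m : ℕ) :
    ∫ x : Fin m → ℝ, ∑ i, F (x i) ∂(wishartLaguerre m α)
      = linStat (fun k => ∫ x, x ^ k * F x * laguerreWeight α x) π hi 0 m := by
  obtain ⟨π', h', hi', H'⟩ := exists_isOPS_weightedMoment hα F
  have h1 := integral_wishartLaguerre_pow hα hF m 1
  -- The mean is the ratio of the first two coefficients of the Hankel determinant, that is, its
  -- logarithmic derivative at zero.
  have h2 := congrArg (coeff 0) (H'.derivation_det_hankel (formalDerivative ℝ) m)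
  rw [coeff_formalDerivative] at h2
  simp only [coeff_zero_eq_constantCoeff, map_mul, map_linStat] at h2
  have H0 := H'.map (constantCoeff (R := ℝ))
  simp only [constantCoeff_weightedMoment] at H0
  obtain ⟨e1, -, e2⟩ := H0.unique H
  rw [e1, e2] at h2
  have e3 : ∀ k, constantCoeff (formalDerivative ℝ (weightedMoment (laguerreWeight α) F k))
      = ∫ x, x ^ k * F x * laguerreWeight α x := by
    intro k
    rw [← coeff_zero_eq_constantCoeff_apply, coeff_formalDerivative, zero_add,
      coeff_one_weightedMoment]
    simp
  simp only [e3] at h2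
  simp only [pow_one] at h1
  rw [h1, div_eq_mul_inv]
  simp only [zero_add, Nat.cast_zero, mul_one] at h2
  rw [h2]
  have := (constantCoeff_det_pos hα F m).ne'
  field_simp
  simp

end Wishart

lemma RingDerivation.map_mul {R : Type*} [CommRing R] (δ : RingDerivation R) (a b : R) :
    δ (a * b) = a * δ b + b * δ a := δ.leibniz a b

/-! ### Analytic means as specializations of the formal ones. -/

section WishartSystem

open PowerSeries

variable {α : ℝ} (hα : -1 < α)

/-- Evaluation at the undeformed ensemble. -/
noncomputable def evalZero : ℝ⟦X⟧⟦X⟧ →+* ℝ :=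
  (constantCoeff (R := ℝ)).comp (constantCoeff (R := ℝ⟦X⟧))

lemma evalZero_apply (f : ℝ⟦X⟧⟦X⟧) : evalZero f = coeff 0 (coeff 0 f) := by
  simp [evalZero, coeff_zero_eq_constantCoeff]

lemma evalZero_wishartMoment (α : ℝ) (k : ℕ) :
    evalZero (wishartMoment α k) = gammaLog 0 (α + 1 + k) := by
  rw [evalZero_apply, coeff_wishartMoment]; simp

lemma evalZero_coeffwiseDerivation (α : ℝ) (k : ℕ) :
    evalZero (coeffwiseDerivation (formalDerivative ℝ) (wishartMoment α k))
      = gammaLog 1 (α + 1 + k) := by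
  rw [evalZero_apply, coeff_coeffwiseDerivation, coeff_formalDerivative, coeff_wishartMoment]; simp

include hα in
lemma exists_isOPS_wishartMoment : ∃ π h hi, IsOPS (wishartMoment α) π h hi := by
  refine exists_isOPS_of_pos evalZero (fun a ha => ?_) _ fun g hg => ?_
  · rw [PowerSeries.isUnit_iff_constantCoeff, PowerSeries.isUnit_iff_constantCoeff]
    exact ha.isUnit
  · simp only [evalZero_wishartMoment, ← integral_laguerre_zero]
    exact momentFunctional_mul_self_pos (integrable_laguerre_zero hα) (laguerreWeight_nonneg α)
      (fun x hx => laguerreWeight_pos α hx) hg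

variable {π : ℕ → Polynomial ℝ⟦X⟧⟦X⟧} {h hi : ℕ → ℝ⟦X⟧⟦X⟧} (H : IsOPS (wishartMoment α) π h hi)
include hα H

lemma meanR_eq_linStat (k m : ℕ) :
    Integrable (statR k) (wishartLaguerre m α) ∧
      meanR k m α = evalZero (linStat (wishartMoment α) π hi k m) := by
  have hF := integrable_laguerre_pow hα k 0
  simp only [pow_zero, mul_one] at hF
  refine ⟨by simpa using! integrable_wishartLaguerre_pow hα hF m 1, ?_⟩
  have H0 := H.map evalZero
  simp only [evalZero_wishartMoment, ← integral_laguerre_zero] at H0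
  rw [map_linStat]
  refine (integral_wishartLaguerre_linStat hα hF H0 m).trans ?_
  have e : (fun j => ∫ x, x ^ j * x ^ k * laguerreWeight α x)
      = fun j => (fun j => evalZero (wishartMoment α j)) (j + k) := by
    funext j
    simp only [← pow_add, integral_laguerre_zero, evalZero_wishartMoment]
  rw [e]
  simp only [linStat, diagElt, matElt, momentFunctional_shift (fun j => evalZero (wishartMoment α j)),
    pow_zero, one_mul]

lemma meanT_eq_linStat (k m : ℕ) :
    Integrable (statT k) (wishartLaguerre m α) ∧
      meanT k m α = evalZero (linStat
        (fun j => coeffwiseDerivation (formalDerivative ℝ) (wishartMoment α j)) π hi k m) := by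
  have hF := integrable_laguerre_pow hα k 1
  simp only [pow_one] at hF
  refine ⟨by simpa using! integrable_wishartLaguerre_pow hα hF m 1, ?_⟩
  have H0 := H.map evalZero
  simp only [evalZero_wishartMoment, ← integral_laguerre_zero] at H0
  rw [map_linStat]
  refine (integral_wishartLaguerre_linStat hα hF H0 m).trans ?_
  have e : (fun j => ∫ x, x ^ j * (x ^ k * Real.log x) * laguerreWeight α x)
      = fun j => (fun j => evalZero
        (coeffwiseDerivation (formalDerivative ℝ) (wishartMoment α j))) (j + k) := by
    funext j
    have := integral_laguerre α (j + k) 1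
    simp only [pow_one] at this
    simp only [← mul_assoc, ← pow_add, this, evalZero_coeffwiseDerivation]
  rw [e]
  simp only [linStat, diagElt, matElt, momentFunctional_shift (fun j => evalZero
    (coeffwiseDerivation (formalDerivative ℝ) (wishartMoment α j))), pow_zero, one_mul]

/-- The moment generating series of `T_1` over the Wishart-Laguerre ensemble. -/
lemma derivative_momentSeries_statT (m : ℕ) :
    formalDerivative ℝ (PowerSeries.mk fun l =>
        (∫ x : Fin m → ℝ, statT 1 x ^ l ∂(wishartLaguerre m α)) / l.factorial)
      = PowerSeries.map (constantCoeff (R := ℝ)) (linStat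
          (fun j => coeffwiseDerivation (formalDerivative ℝ) (wishartMoment α j)) π hi 1 m)
        * PowerSeries.mk fun l =>
          (∫ x : Fin m → ℝ, statT 1 x ^ l ∂(wishartLaguerre m α)) / l.factorial := by
  have hF := integrable_laguerre_pow hα 1 1
  simp only [pow_one] at hF
  -- Setting the increment of `α` to zero leaves the series in `t` of the moments of the weight
  -- deformed by `x ln x`.
  have e0 : ∀ k, weightedMoment (laguerreWeight α) (fun x => x * Real.log x) k
      = PowerSeries.map (constantCoeff (R := ℝ)) (wishartMoment α k) := by
    intro k
    ext p
    have h1 := integral_laguerre_pow α 1 1 k p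
    simp only [pow_one, one_mul] at h1
    rw [weightedMoment, coeff_mk, h1, coeff_map, ← coeff_zero_eq_constantCoeff_apply,
      coeff_wishartMoment]
    push_cast
    simp [add_assoc]
  have H0 := H.map (PowerSeries.map (constantCoeff (R := ℝ)))
  set d := (Matrix.of fun i j : Fin m =>
    weightedMoment (laguerreWeight α) (fun x => x * Real.log x) (i + j)).det with hd
  have e1 : (PowerSeries.mk fun l =>
        (∫ x : Fin m → ℝ, statT 1 x ^ l ∂(wishartLaguerre m α)) / l.factorial)
      = C (constantCoeff d)⁻¹ * d := by
    ext l
    have h2 := integral_wishartLaguerre_pow hα hF m l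
    rw [coeff_mk, coeff_C_mul]
    simp only [statT, pow_one]
    rw [h2, ← hd]
    field_simp
  have e2 := H0.derivation_det_hankel (formalDerivative ℝ) m
  simp only [← e0] at e2
  rw [← hd] at e2
  rw [e1, RingDerivation.map_mul, e2]
  -- The shift relation replaces `∂_t` of a moment by `∂_α` of the next one. This turns the
  -- logarithmic derivative of the determinant into the deformed mean of `T_1`.
  have e3 : (fun k => formalDerivative ℝ (weightedMoment (laguerreWeight α)
        (fun x => x * Real.log x) k))
      = fun k => (fun k => PowerSeries.map (constantCoeff (R := ℝ))
        (coeffwiseDerivation (formalDerivative ℝ) (wishartMoment α k))) (k + 1) := by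
    funext k
    simp only [← (isDeformed_wishartMoment hα).shift, e0]
    ext p
    simp
  have e4 : formalDerivative ℝ (C (constantCoeff d)⁻¹) = 0 := by
    ext p; simp [coeff_formalDerivative]
  rw [e3, e4, map_linStat]
  simp only [linStat, diagElt, matElt, momentFunctional_shift (fun k => PowerSeries.map
    (constantCoeff (R := ℝ)) (coeffwiseDerivation (formalDerivative ℝ) (wishartMoment α k))),
    pow_zero, one_mul]
  ring

end WishartSystem

end EntanglementEntropy

namespace EntanglementEntropy

open PowerSeries Finset

/-! ### Families over all parameters, handled as one object. -/

section Families

variable {ι S : Type*} [CommRing S]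

/-- The pointwise action of a derivation on families. -/
noncomputable def piDerivation (ι : Type*) (δ : RingDerivation S) : RingDerivation (ι → S) :=
  RingDerivation.ofLeibniz
    { toFun := fun f x => δ (f x)
      map_zero' := by ext; simp
      map_add' := fun f g => by ext; simp }
    (fun f g => by ext x; exact RingDerivation.map_mul δ (f x) (g x))

lemma piDerivation_apply (δ : RingDerivation S) (f : ι → S) (x : ι) :
    piDerivation ι δ f x = δ (f x) := rfl

/-- A family of power series as a power series of families. -/
noncomputable def packSeries (f : ι → S⟦X⟧) : (ι → S)⟦X⟧ := PowerSeries.mk fun p x => coeff p (f x)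

/-- The members of a power series of families. -/
noncomputable def evalSeries (x : ι) : (ι → S)⟦X⟧ →+* S⟦X⟧ := PowerSeries.map (Pi.evalRingHom (fun _ => S) x)

lemma coeff_evalSeries (x : ι) (f : (ι → S)⟦X⟧) (p : ℕ) :
    coeff p (evalSeries x f) = coeff p f x := rfl

lemma coeff_packSeries (f : ι → S⟦X⟧) (p : ℕ) (x : ι) :
    coeff p (packSeries f) x = coeff p (f x) := by rw [packSeries, coeff_mk]

@[simp]
lemma evalSeries_packSeries (f : ι → S⟦X⟧) (x : ι) : evalSeries x (packSeries f) = f x := by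
  ext p; rw [coeff_evalSeries, coeff_packSeries]

@[simp]
lemma evalSeries_X (x : ι) : evalSeries x (X : (ι → S)⟦X⟧) = X := PowerSeries.map_X _

@[simp]
lemma evalSeries_C (x : ι) (a : ι → S) : evalSeries x (C a) = C (a x) := PowerSeries.map_C _ _

@[simp]
lemma evalSeries_formalDerivative (x : ι) (f : (ι → S)⟦X⟧) :
    evalSeries x (formalDerivative _ f) = formalDerivative S (evalSeries x f) := by
  ext p
  rw [coeff_evalSeries, coeff_formalDerivative, coeff_formalDerivative, coeff_evalSeries]
  rfl

@[simp]
lemma evalSeries_coeffwiseDerivation (δ : RingDerivation S) (x : ι) (f : (ι → S)⟦X⟧) :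
    evalSeries x (coeffwiseDerivation (piDerivation ι δ) f)
      = coeffwiseDerivation δ (evalSeries x f) := by
  ext p
  rw [coeff_evalSeries, coeff_coeffwiseDerivation, coeff_coeffwiseDerivation, coeff_evalSeries]
  rfl

lemma ext_evalSeries {f g : (ι → S)⟦X⟧} (h : ∀ x, evalSeries x f = evalSeries x g) : f = g := by
  ext p x
  rw [← coeff_evalSeries, ← coeff_evalSeries, h]

/-- Treating all parameters at once is what makes the final polynomials independent of `m` and `n`:
the filtration argument is run in the ring of functions of the parameters. -/
lemma IsCumulantSystem.pack {δ : RingDerivation S} {M N : ι → S}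
    {θ r A B w g : ι → ℕ → S⟦X⟧}
    (K : ∀ x, IsCumulantSystem δ (M x) (N x) (θ x) (r x) (A x) (B x) (w x) (g x)) :
    IsCumulantSystem (piDerivation ι δ) M N (fun a => packSeries fun x => θ x a)
      (fun a => packSeries fun x => r x a) (fun a => packSeries fun x => A x a)
      (fun a => packSeries fun x => B x a) (fun a => packSeries fun x => w x a)
      (fun a => packSeries fun x => g x a) where
  off_log a := ext_evalSeries fun x => by simpa using (K x).off_log a
  off_pow a := ext_evalSeries fun x => by simpa using (K x).off_pow a
  log_zero := ext_evalSeries fun x => by simpa using (K x).log_zero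
  log a := ext_evalSeries fun x => by simpa using (K x).log a
  pow a := ext_evalSeries fun x => by simpa using (K x).pow a
  diag_log b := ext_evalSeries fun x => by simpa [map_ofNat (evalSeries x) 2] using (K x).diag_log b
  diag_pow b := ext_evalSeries fun x => by simpa [map_ofNat (evalSeries x) 2] using (K x).diag_pow b
  diag_log_zero := ext_evalSeries fun x => by simpa using (K x).diag_log_zero
  diag_pow_zero := ext_evalSeries fun x => by simpa using (K x).diag_pow_zero
  pow_zero := ext_evalSeries fun x => by simpa using (K x).pow_zero

lemma IsMeanSystem.pack {M N Ψ : ι → S} {A A' B B' w g : ι → ℕ → S}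
    (K : ∀ x, IsMeanSystem (M x) (N x) (Ψ x) (A x) (A' x) (B x) (B' x) (w x) (g x)) :
    IsMeanSystem M N Ψ (fun a x => A x a) (fun a x => A' x a) (fun a x => B x a)
      (fun a x => B' x a) (fun a x => w x a) (fun a x => g x a) where
  diag_log b := funext fun x => by simpa using (K x).diag_log b
  diag_log' b := funext fun x => by simpa using (K x).diag_log' b
  diag_pow b := funext fun x => by simpa using (K x).diag_pow b
  diag_pow' b := funext fun x => by simpa using (K x).diag_pow' b
  off_log b := funext fun x => by simpa using (K x).off_log b
  off_pow b := funext fun x => by simpa using (K x).off_pow b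
  diag_log_zero := funext fun x => by simpa using (K x).diag_log_zero
  diag_log_zero' := funext fun x => by simpa using (K x).diag_log_zero'
  diag_pow_zero := funext fun x => by simpa using (K x).diag_pow_zero
  diag_pow_zero' := funext fun x => by simpa using (K x).diag_pow_zero'
  off_log_zero := funext fun x => by simpa using (K x).off_log_zero
  off_pow_zero := funext fun x => by simpa using (K x).off_pow_zero

end Families

/-! ### The cumulant and mean systems for fixed parameters. -/

section WishartPoint

lemma diagElt_zero_self {R : Type*} [CommRing R] {c : ℕ → R} {π : ℕ → Polynomial R}
    {h hi : ℕ → R} (H : IsOPS c π h hi) (k : ℕ) : diagElt c π hi 0 k = 1 := by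
  rw [diagElt, H.matElt_zero_self, mul_comm, H.inv]

lemma linStat_zero_self {R : Type*} [CommRing R] {c : ℕ → R} {π : ℕ → Polynomial R}
    {h hi : ℕ → R} (H : IsOPS c π h hi) (m : ℕ) : linStat c π hi 0 m = m := by
  simp [linStat, diagElt_zero_self H]

lemma linStat_zero_seq {R : Type*} [CommRing R] (π : ℕ → Polynomial R) (hi : ℕ → R) (a m : ℕ) :
    linStat (0 : ℕ → R) π hi a m = 0 := by
  simp [linStat]

lemma offElt_one_succ {R : Type*} [CommRing R] {c : ℕ → R} {π : ℕ → Polynomial R}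
    {h hi : ℕ → R} (H : IsOPS c π h hi) (k : ℕ) :
    offElt c π hi 1 (k + 1) = recOff h hi (k + 1) := by
  rw [offElt, H.matElt_one_succ, recOff, mul_comm]

lemma taylorSeries_gammaLog_ne_zero {z : ℝ} (hz : 0 < z) : taylorSeries gammaLog z ≠ 0 := by
  intro h
  have := congrArg (constantCoeff (R := ℝ)) h
  rw [constantCoeff_taylorSeries, gammaLog_zero hz, map_zero] at this
  exact (Real.Gamma_pos_of_pos hz).ne' this

lemma taylorSeries_polygamma_add_one {z : ℝ} (hz : 0 < z) :
    (C z + X) * taylorSeries polygamma (z + 1) = (C z + X) * taylorSeries polygamma z + 1 := by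
  have h1 := congrArg (derivative ℝ) (taylorSeries_gammaLog_add_one hz)
  rw [derivative_taylorSeries_gammaLog (by linarith), Derivation.leibniz,
    derivative_taylorSeries_gammaLog hz, taylorSeries_gammaLog_add_one hz] at h1
  have h2 : derivative ℝ (C z + X : ℝ⟦X⟧) = 1 := by simp
  rw [h2] at h1
  refine mul_right_cancel₀ (taylorSeries_gammaLog_ne_zero hz) ?_
  simp only [smul_eq_mul] at h1
  linear_combination h1

variable {α : ℝ} (hα : -1 < α) {π : ℕ → Polynomial ℝ⟦X⟧⟦X⟧} {h hi : ℕ → ℝ⟦X⟧⟦X⟧}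
  (H : IsOPS (wishartMoment α) π h hi)

/-- The derivative of the moments in the exponent of the weight. -/
noncomputable abbrev wishartLogMoment (α : ℝ) (k : ℕ) : ℝ⟦X⟧⟦X⟧ :=
  coeffwiseDerivation (formalDerivative ℝ) (wishartMoment α k)

include hα H

/-- Decoupling involves diagonal elements at both `k` and `k + 1`. Those at `k` are eliminated by
`diagElt_sub`, and the recurrence coefficient is the off-diagonal element of exponent one, so the
system closes at the single size `k + 1`. -/
lemma isCumulantSystem_wishart (k : ℕ) :
    IsCumulantSystem (formalDerivative ℝ) (C ((k + 1 : ℕ) : ℝ)) (C (α + (k + 1 : ℕ)) + X)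
      (fun a => linStat (wishartLogMoment α) π hi a (k + 1))
      (fun a => linStat (wishartMoment α) π hi a (k + 1))
      (fun a => diagElt (wishartLogMoment α) π hi a (k + 1))
      (fun a => diagElt (wishartMoment α) π hi a (k + 1))
      (fun a => offElt (wishartLogMoment α) π hi a (k + 1))
      (fun a => offElt (wishartMoment α) π hi a (k + 1)) where
  off_log a := (isDeformed_wishartMoment hα).offElt_eq H (isDeformed_wishartMoment hα).scale_E a _
  off_pow a := by
    have := (isDeformed_wishartMoment hα).offElt_eq H (isDeformed_wishartMoment hα).scale a (k + 1)
    rwa [linStat_zero_seq, add_zero] at this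
  log_zero := by
    have := (isDeformed_wishartMoment hα).decouple_log H 0 k
    simpa using this
  log a := by
    have h1 := (isDeformed_wishartMoment hα).decouple_log H a k
    have h2 := fun i => (isDeformed_wishartMoment hα).diagElt_sub H
      (isDeformed_wishartMoment hα).scale_E i k
    rw [h1, add_sub_cancel_left, ← sum_add_distrib, mul_sum]
    refine sum_congr rfl fun i _ => ?_
    rw [offElt_one_succ H]
    linear_combination (diagElt (wishartLogMoment α) π hi (a - 1 - i) (k + 1)) * -(h2 i)
  pow a := by
    have h1 := (isDeformed_wishartMoment hα).decouple_pow H a k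
    have h2 := fun i => (isDeformed_wishartMoment hα).diagElt_sub H
      (isDeformed_wishartMoment hα).scale_E i k
    have h3 := fun i => (isDeformed_wishartMoment hα).diagElt_sub H
      (isDeformed_wishartMoment hα).scale i k
    rw [h1, add_sub_cancel_left, ← sum_add_distrib, mul_sum]
    refine sum_congr rfl fun i _ => ?_
    rw [offElt_one_succ H]
    have h4 := h3 i
    rw [offElt_zero_seq, add_zero] at h4
    linear_combination (diagElt (wishartMoment α) π hi (a - 1 - i) (k + 1)) * -(h2 i)
      + (diagElt (wishartLogMoment α) π hi (a - 1 - i) (k + 1)) * -h4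
  diag_log b := by
    have h1 := (isDeformed_wishartMoment hα).diagElt_succ H
      (isDeformed_wishartMoment hα).scale_E b (k + 1)
    rw [h1]
    simp only [map_add, map_natCast]
    push_cast
    ring
  diag_pow b := by
    have h1 := (isDeformed_wishartMoment hα).diagElt_succ H
      (isDeformed_wishartMoment hα).scale b (k + 1)
    rw [h1, diagElt_zero_seq]
    simp only [map_add, map_natCast]
    push_cast
    ring
  diag_log_zero := (isDeformed_wishartMoment hα).D_diagElt_zero H (k + 1)
  diag_pow_zero := diagElt_zero_self H _
  pow_zero := by rw [linStat_zero_self H, map_natCast, map_natCast]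

lemma constantCoeff_offElt_log (a m : ℕ) :
    constantCoeff (offElt (wishartLogMoment α) π hi a m)
      = a * constantCoeff (linStat (wishartLogMoment α) π hi a m)
        + constantCoeff (linStat (wishartMoment α) π hi a m) := by
  have h1 := congrArg (constantCoeff (R := ℝ⟦X⟧)) ((isDeformed_wishartMoment hα).offElt_eq H
    (isDeformed_wishartMoment hα).scale_E a m)
  simpa using h1

lemma constantCoeff_offElt_pow (a m : ℕ) :
    constantCoeff (offElt (wishartMoment α) π hi a m)
      = a * constantCoeff (linStat (wishartMoment α) π hi a m) := by
  have h1 := congrArg (constantCoeff (R := ℝ⟦X⟧)) ((isDeformed_wishartMoment hα).offElt_eq H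
    (isDeformed_wishartMoment hα).scale a m)
  simpa [linStat_zero_seq] using h1

lemma constantCoeff_offElt_zero (m : ℕ) :
    constantCoeff (offElt (wishartMoment α) π hi 0 m) = 0 := by
  rw [constantCoeff_offElt_pow hα H]; simp

lemma constantCoeff_offElt_log_zero (m : ℕ) :
    constantCoeff (offElt (wishartLogMoment α) π hi 0 m) = m := by
  rw [constantCoeff_offElt_log hα H, linStat_zero_self H]; simp

lemma constantCoeff_diagElt_one (k : ℕ) :
    constantCoeff (diagElt (wishartMoment α) π hi 1 k) = 2 * (k : ℝ⟦X⟧) + 1 + (C α + X) := by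
  have h1 := congrArg (constantCoeff (R := ℝ⟦X⟧)) ((isDeformed_wishartMoment hα).diagElt_succ H
    (isDeformed_wishartMoment hα).scale 0 k)
  simp only [diagElt_zero_self H, diagElt_zero_seq] at h1
  simp only [map_mul, map_add, map_sub, map_one, constantCoeff_X, constantCoeff_C, map_natCast,
    constantCoeff_offElt_zero hα H, map_ofNat, map_zero] at h1
  simp only [zero_add] at h1
  linear_combination h1

/-- At `t = 0` the diagonal recurrence coefficients are `2 k + 1 + α`, with partial sums `m (m +
α)`, and the off-diagonal element of exponent one equals such a sum. -/
lemma constantCoeff_recOff (k : ℕ) :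
    constantCoeff (recOff h hi (k + 1)) = C ((k + 1 : ℕ) : ℝ) * (C (α + (k + 1 : ℕ)) + X) := by
  have h1 : ∀ m : ℕ, constantCoeff (linStat (wishartMoment α) π hi 1 m)
      = C (m : ℝ) * (C (α + m) + X) := by
    intro m
    induction m with
    | zero => simp [linStat]
    | succ m ih =>
      rw [linStat, sum_range_succ, map_add, ← linStat, ih, constantCoeff_diagElt_one hα H]
      simp only [map_add, map_natCast, Nat.cast_add, Nat.cast_one, map_one]
      ring
  rw [← offElt_one_succ H, constantCoeff_offElt_pow hα H, h1]
  simp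

lemma constantCoeff_diagElt_sub (b k : ℕ) :
    constantCoeff (recOff h hi (k + 1)) *
      (constantCoeff (diagElt (wishartLogMoment α) π hi b (k + 1))
        - constantCoeff (diagElt (wishartLogMoment α) π hi b k))
      = (b + 1) * constantCoeff (offElt (wishartLogMoment α) π hi b (k + 1))
        + constantCoeff (offElt (wishartMoment α) π hi b (k + 1)) := by
  have h1 := congrArg (constantCoeff (R := ℝ⟦X⟧)) ((isDeformed_wishartMoment hα).diagElt_sub H
    (isDeformed_wishartMoment hα).scale_E b k)
  simpa using h1

lemma diagElt_zero_step (k : ℕ) :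
    (C (α + (k + 1 : ℕ)) + X) * constantCoeff (diagElt (wishartLogMoment α) π hi 0 (k + 1))
      = (C (α + (k + 1 : ℕ)) + X) * constantCoeff (diagElt (wishartLogMoment α) π hi 0 k)
        + 1 := by
  have h1 := constantCoeff_diagElt_sub hα H 0 k
  rw [constantCoeff_recOff hα H, constantCoeff_offElt_zero hα H,
    constantCoeff_offElt_log_zero hα H] at h1
  have h2 : C ((k + 1 : ℕ) : ℝ) ≠ (0 : ℝ⟦X⟧) := by
    intro h0
    have := congrArg (constantCoeff (R := ℝ)) h0
    rw [constantCoeff_C, map_zero] at this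
    exact Nat.cast_ne_zero.mpr (Nat.succ_ne_zero k) this
  refine mul_left_cancel₀ h2 ?_
  simp only [map_natCast, Nat.cast_zero] at h1 ⊢
  linear_combination h1

/-- At index zero this is the logarithmic derivative of `Γ(α + 1)`; both sides then obey the
recurrence `ψ_0(z + 1) = ψ_0(z) + 1/z`, expanded in the increment of `α`. -/
lemma constantCoeff_diagElt_zero (k : ℕ) :
    constantCoeff (diagElt (wishartLogMoment α) π hi 0 k)
      = taylorSeries polygamma (α + k + 1) := by
  induction k with
  | zero =>
    have h1 := congrArg (constantCoeff (R := ℝ⟦X⟧))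
      (IsDeformed.diagElt_zero_derivation (E := coeffwiseDerivation (formalDerivative ℝ)) H 0)
    have h2 : h 0 = wishartMoment α 0 := by
      rw [← H.norm, H.pi_zero, one_mul, ← Polynomial.monomial_zero_one, momentFunctional_monomial,
        one_mul]
    have h3 : constantCoeff (wishartMoment α 0) = taylorSeries gammaLog (α + 1) := by
      ext q
      rw [← coeff_zero_eq_constantCoeff_apply, coeff_wishartMoment, taylorSeries, coeff_mk]
      simp
    rw [map_mul, h2, ← coeff_zero_eq_constantCoeff_apply (coeffwiseDerivation _ _),
      coeff_coeffwiseDerivation, coeff_zero_eq_constantCoeff_apply, h3, formalDerivative_apply,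
      derivative_taylorSeries_gammaLog (by linarith)] at h1
    refine (mul_right_cancel₀ (taylorSeries_gammaLog_ne_zero (by linarith : 0 < α + 1)) ?_).symm
    simpa [mul_comm] using h1
  | succ k ih =>
    have hz : 0 < α + k + 1 := by
      have := (Nat.cast_nonneg k : (0 : ℝ) ≤ k); linarith
    have h1 := diagElt_zero_step hα H k
    have h2 := taylorSeries_polygamma_add_one hz
    have h3 : (C (α + k + 1) + X : ℝ⟦X⟧) ≠ 0 := by
      intro h0
      have := congrArg (constantCoeff (R := ℝ)) h0
      simp at this
      linarith
    have e : α + ((k + 1 : ℕ) : ℝ) = α + k + 1 := by push_cast; ring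
    rw [ih, e] at h1
    rw [e]
    exact mul_left_cancel₀ h3 (h1.trans h2.symm)

lemma isMeanSystem_wishart (k : ℕ) :
    IsMeanSystem (C ((k + 1 : ℕ) : ℝ)) (C (α + (k + 1 : ℕ)) + X)
      (taylorSeries polygamma (α + (k + 1 : ℕ)))
      (fun a => constantCoeff (diagElt (wishartLogMoment α) π hi a (k + 1)))
      (fun a => constantCoeff (diagElt (wishartLogMoment α) π hi a k))
      (fun a => constantCoeff (diagElt (wishartMoment α) π hi a (k + 1)))
      (fun a => constantCoeff (diagElt (wishartMoment α) π hi a k))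
      (fun a => constantCoeff (offElt (wishartLogMoment α) π hi a (k + 1)))
      (fun a => constantCoeff (offElt (wishartMoment α) π hi a (k + 1))) where
  diag_log b := by
    have := congrArg (constantCoeff (R := ℝ⟦X⟧)) ((isCumulantSystem_wishart hα H k).diag_log b)
    simpa [map_ofNat (constantCoeff (R := ℝ⟦X⟧)) 2] using this
  diag_log' b := by
    have h1 := congrArg (constantCoeff (R := ℝ⟦X⟧)) ((isDeformed_wishartMoment hα).diagElt_succ H
      (isDeformed_wishartMoment hα).scale_E b k)
    have h2 := congrArg (constantCoeff (R := ℝ⟦X⟧)) ((isDeformed_wishartMoment hα).offElt_sub H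
      (isDeformed_wishartMoment hα).scale_E b k)
    simp only [map_mul, map_add, map_sub, map_one, constantCoeff_X, constantCoeff_C, map_natCast,
      map_ofNat, zero_mul, sub_zero, one_mul, add_zero] at h1 h2
    simp only [map_add, map_natCast]
    push_cast
    -- Subtracting twice the difference relation moves the off-diagonal element from `k` to `k + 1`,
    -- which changes `b + 1 + α + 2 k` into `M + N - 1 - b` and flips the sign of the power term.
    linear_combination h1 - 2 * h2
  diag_pow b := by
    have := congrArg (constantCoeff (R := ℝ⟦X⟧)) ((isCumulantSystem_wishart hα H k).diag_pow b)
    simpa [map_ofNat (constantCoeff (R := ℝ⟦X⟧)) 2] using this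
  diag_pow' b := by
    have h1 := congrArg (constantCoeff (R := ℝ⟦X⟧)) ((isDeformed_wishartMoment hα).diagElt_succ H
      (isDeformed_wishartMoment hα).scale b k)
    have h2 := congrArg (constantCoeff (R := ℝ⟦X⟧)) ((isDeformed_wishartMoment hα).offElt_sub H
      (isDeformed_wishartMoment hα).scale b k)
    simp only [map_mul, map_add, map_sub, map_one, constantCoeff_X, constantCoeff_C, map_natCast,
      map_ofNat, zero_mul, sub_zero, one_mul, add_zero, diagElt_zero_seq] at h1 h2
    simp only [map_add, map_natCast]
    push_cast
    linear_combination h1 - 2 * h2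
  off_log b := by
    rw [← constantCoeff_recOff hα H, constantCoeff_diagElt_sub hα H]
  off_pow b := by
    have h1 := congrArg (constantCoeff (R := ℝ⟦X⟧)) ((isDeformed_wishartMoment hα).diagElt_sub H
      (isDeformed_wishartMoment hα).scale b k)
    rw [← constantCoeff_recOff hα H]
    simpa using h1.symm
  diag_log_zero := by
    have e : α + ((k + 1 : ℕ) : ℝ) = α + k + 1 := by push_cast; ring
    rw [diagElt_zero_step hα H, constantCoeff_diagElt_zero hα H, e]
  diag_log_zero' := by
    have e : α + ((k + 1 : ℕ) : ℝ) = α + k + 1 := by push_cast; ring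
    rw [constantCoeff_diagElt_zero hα H, e]
  diag_pow_zero := by rw [diagElt_zero_self H, map_one]
  diag_pow_zero' := by rw [diagElt_zero_self H, map_one]
  off_log_zero := by rw [constantCoeff_offElt_log_zero hα H, map_natCast]
  off_pow_zero := constantCoeff_offElt_zero hα H _

end WishartPoint

end EntanglementEntropy

namespace EntanglementEntropy

open PowerSeries Finset MeasureTheory

/-! ### Generated subalgebras under homomorphisms and derivations. -/

section Adjoin

lemma RingDerivation.map_one {R : Type*} [CommRing R] (δ : RingDerivation R) : δ 1 = 0 :=
  Derivation.map_one_eq_zero δ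

variable {𝔸 𝔹 : Type*} [CommRing 𝔸] [Algebra ℚ 𝔸] [CommRing 𝔹] [Algebra ℚ 𝔹]

lemma map_mem_of_mem_adjoin (f : 𝔸 →+* 𝔹) {s : Set 𝔸} {T : Subalgebra ℚ 𝔹}
    (h : ∀ y ∈ s, f y ∈ T) {a : 𝔸} (ha : a ∈ Algebra.adjoin ℚ s) : f a ∈ T := by
  induction ha using Algebra.adjoin_induction with
  | mem y hy => exact h y hy
  | algebraMap q => rw [RingHom.map_rat_algebraMap]; exact T.algebraMap_mem q
  | add x y _ _ hx hy => rw [map_add]; exact add_mem hx hy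
  | mul x y _ _ hx hy => rw [map_mul]; exact mul_mem hx hy

lemma derivation_mem_of_mem_adjoin (δ : RingDerivation 𝔸) {s : Set 𝔸} {T : Subalgebra ℚ 𝔸}
    (hs : s ⊆ T) (h : ∀ y ∈ s, δ y ∈ T) {a : 𝔸} (ha : a ∈ Algebra.adjoin ℚ s) : δ a ∈ T := by
  induction ha using Algebra.adjoin_induction with
  | mem y hy => exact h y hy
  | algebraMap q =>
    -- A derivation over the integers kills rational constants because it kills numerator and
    -- denominator.
    have h1 : (q.den : 𝔸) * algebraMap ℚ 𝔸 q = (q.num : 𝔸) := by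
      rw [← map_natCast (algebraMap ℚ 𝔸), ← map_intCast (algebraMap ℚ 𝔸), ← map_mul,
        Rat.den_mul_eq_num]
    have h2 := congrArg δ h1
    rw [RingDerivation.map_mul, Derivation.map_natCast, Derivation.map_intCast, mul_zero,
      add_zero] at h2
    have h3 : (algebraMap ℚ 𝔸 (q.den : ℚ)⁻¹) * (q.den : 𝔸) = 1 := by
      rw [← map_natCast (algebraMap ℚ 𝔸), ← map_mul, inv_mul_cancel₀ (by simp), map_one]
    have h4 : δ (algebraMap ℚ 𝔸 q) = 0 := by
      linear_combination (algebraMap ℚ 𝔸 (q.den : ℚ)⁻¹) * h2 - δ (algebraMap ℚ 𝔸 q) * h3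
    rw [h4]; exact zero_mem _
  | add x y _ _ hx hy => rw [map_add]; exact add_mem hx hy
  | mul x y hx' hy' hx hy =>
    have hle : Algebra.adjoin ℚ s ≤ T := Algebra.adjoin_le hs
    rw [RingDerivation.map_mul]
    exact add_mem (mul_mem (hle hx') hy) (mul_mem (hle hy') hx)

/-- The filtration generated by a sequence of elements over a base set. -/
def adjoinFiltration (s : Set 𝔸) (Ψ : ℕ → 𝔸) (r : ℕ) : Subalgebra ℚ 𝔸 :=
  Algebra.adjoin ℚ (s ∪ Ψ '' Set.Iio r)

lemma adjoinFiltration_mono (s : Set 𝔸) (Ψ : ℕ → 𝔸) : Monotone (adjoinFiltration s Ψ) :=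
  fun _ _ h => Algebra.adjoin_mono (Set.union_subset_union_right _
    (Set.image_mono (Set.Iio_subset_Iio h)))

lemma mem_adjoinFiltration_base {s : Set 𝔸} {Ψ : ℕ → 𝔸} {a : 𝔸} (ha : a ∈ s) (r : ℕ) :
    a ∈ adjoinFiltration s Ψ r := Algebra.subset_adjoin (Or.inl ha)

lemma mem_adjoinFiltration_seq (s : Set 𝔸) (Ψ : ℕ → 𝔸) {j r : ℕ} (h : j < r) :
    Ψ j ∈ adjoinFiltration s Ψ r := Algebra.subset_adjoin (Or.inr ⟨j, h, rfl⟩)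

lemma adjoin_le_adjoinFiltration {s s' : Set 𝔸} (h : s' ⊆ s) (Ψ : ℕ → 𝔸) (r : ℕ) :
    Algebra.adjoin ℚ s' ≤ adjoinFiltration s Ψ r :=
  Algebra.adjoin_mono (h.trans Set.subset_union_left)

lemma map_mem_adjoinFiltration (f : 𝔸 →+* 𝔹) {s : Set 𝔸} {s' : Set 𝔹} {Ψ : ℕ → 𝔸} {Ψ' : ℕ → 𝔹}
    (hs : ∀ y ∈ s, f y ∈ s') (hΨ : ∀ j, f (Ψ j) = Ψ' j) {a : 𝔸} {r : ℕ}
    (ha : a ∈ adjoinFiltration s Ψ r) : f a ∈ adjoinFiltration s' Ψ' r := by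
  refine map_mem_of_mem_adjoin f (fun y hy => ?_) ha
  rcases hy with hy | ⟨j, hj, rfl⟩
  · exact mem_adjoinFiltration_base (hs y hy) r
  · rw [hΨ]; exact mem_adjoinFiltration_seq _ _ hj

end Adjoin

/-! ### The parameter set and its algebras of functions. -/

section Domain

/-- The admissible values of the dimensions `m` and `n`. -/
def Dimensions : Type := {x : ℕ × ℝ // 1 ≤ x.1 ∧ (x.1 : ℝ) ≤ x.2}

namespace Dimensions

/-- The smaller dimension. -/
def dimM (x : Dimensions) : ℕ := x.1.1

/-- The larger dimension. -/
def dimN (x : Dimensions) : ℝ := x.1.2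

/-- The exponent of the weight. -/
def exponent (x : Dimensions) : ℝ := x.dimN - x.dimM

lemma one_le_dimM (x : Dimensions) : 1 ≤ x.dimM := x.2.1

lemma exponent_nonneg (x : Dimensions) : 0 ≤ x.exponent := sub_nonneg.mpr x.2.2

lemma neg_one_lt_exponent (x : Dimensions) : -1 < x.exponent := by
  have := x.exponent_nonneg; linarith

lemma exponent_add (x : Dimensions) : x.exponent + x.dimM = x.dimN := by rw [exponent]; ring

lemma one_le_dimN (x : Dimensions) : 1 ≤ x.dimN :=
  le_trans (by exact_mod_cast x.one_le_dimM) x.2.2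

end Dimensions

/-- The rational expressions in the dimensions and the polygamma functions of the larger one. -/
noncomputable def polygammaAlgebra (r : ℕ) : Subalgebra ℚ (Dimensions → ℝ) :=
  adjoinFiltration {fun x => (x.dimM : ℝ), fun x => x.dimN, fun x => (x.dimN)⁻¹}
    (fun j x => polygamma j x.dimN) r

/-- The polynomial expressions in the dimensions. -/
noncomputable def dimensionAlgebra : Subalgebra ℚ (Dimensions → ℝ) :=
  Algebra.adjoin ℚ {fun x => (x.dimM : ℝ), fun x => x.dimN}

end Domain

/-! ### Structure of the Wishart-Laguerre means and cumulants, uniformly in the parameters. -/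

section Structure

/-- `w a - Ψ * g a` equals `a * (θ a - r a * Ψ) + r a`, so a positive exponent can be divided out.
-/
lemma IsMeanSystem.linStat_mem {𝔸 : Type*} [CommRing 𝔸] [Algebra ℚ 𝔸] {M N Ψ : 𝔸}
    {A A' B B' w g θ r : ℕ → 𝔸} (K : IsMeanSystem M N Ψ A A' B B' w g)
    (hw : ∀ a : ℕ, w a = a * θ a + r a) (hg : ∀ a : ℕ, g a = a * r a)
    {𝓟 : Subalgebra ℚ 𝔸} (hM : M ∈ 𝓟) (hN : N ∈ 𝓟) (a : ℕ) :
    r (a + 1) ∈ 𝓟 ∧ θ (a + 1) - r (a + 1) * Ψ ∈ 𝓟 := by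
  obtain ⟨⟨-, -, h1⟩, -, -, h2⟩ := K.mem hM hN (a + 1)
  have h3 : r (a + 1) ∈ 𝓟 := by
    refine mem_of_natCast_mul_mem a ?_
    rw [hg] at h1; exact_mod_cast h1
  refine ⟨h3, mem_of_natCast_mul_mem a ?_⟩
  have h4 := sub_mem h2 h3
  rw [hw, hg] at h4
  convert h4 using 1
  push_cast; ring

/-- The structure of the moments of `T_1` and of the means of `R_k`, `T_k` over the
Wishart-Laguerre ensembles. -/
theorem exists_wishart_structure : ∃ θ : Dimensions → ℝ⟦X⟧,
    (∀ x, formalDerivative ℝ (PowerSeries.mk fun l =>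
        (∫ y : Fin x.dimM → ℝ, statT 1 y ^ l ∂(wishartLaguerre x.dimM x.exponent)) / l.factorial)
      = θ x * PowerSeries.mk fun l =>
        (∫ y : Fin x.dimM → ℝ, statT 1 y ^ l ∂(wishartLaguerre x.dimM x.exponent))
          / l.factorial) ∧
    (∀ k, (fun x => meanR (k + 1) x.dimM x.exponent) ∈ dimensionAlgebra) ∧
    (∀ k, (fun x => meanT (k + 1) x.dimM x.exponent
      - meanR (k + 1) x.dimM x.exponent * polygamma 0 x.dimN) ∈ dimensionAlgebra) ∧
    ∀ p, (fun x => (p.factorial : ℝ) * coeff p (θ x)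
      - meanR (p + 1) x.dimM x.exponent * polygamma p x.dimN) ∈ polygammaAlgebra p := by
  choose π h hi H using fun x : Dimensions => exists_isOPS_wishartMoment x.neg_one_lt_exponent
  set M : Dimensions → ℝ⟦X⟧ := fun x => C (x.dimM : ℝ) with hMdef
  set N : Dimensions → ℝ⟦X⟧ := fun x => C (x.exponent + x.dimM) + X with hNdef
  set Ni : Dimensions → ℝ⟦X⟧ := fun x => (C (x.exponent + x.dimM) + X)⁻¹ with hNidef
  -- The Taylor expansion of `ψ_j` at `n` in the increment of the exponent, so that `δ` sends `Ψ j`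
  -- to `Ψ (j + 1)`.
  set Ψ : ℕ → Dimensions → ℝ⟦X⟧ := fun j x =>
    taylorSeries (fun q => polygamma (j + q)) (x.exponent + x.dimM) with hΨdef
  set δ := piDerivation Dimensions (formalDerivative ℝ) with hδdef
  have KS : ∀ x : Dimensions, IsCumulantSystem (formalDerivative ℝ) (M x) (N x)
      (fun a => linStat (wishartLogMoment x.exponent) (π x) (hi x) a x.dimM)
      (fun a => linStat (wishartMoment x.exponent) (π x) (hi x) a x.dimM)
      (fun a => diagElt (wishartLogMoment x.exponent) (π x) (hi x) a x.dimM)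
      (fun a => diagElt (wishartMoment x.exponent) (π x) (hi x) a x.dimM)
      (fun a => offElt (wishartLogMoment x.exponent) (π x) (hi x) a x.dimM)
      (fun a => offElt (wishartMoment x.exponent) (π x) (hi x) a x.dimM) := by
    intro x
    have := isCumulantSystem_wishart x.neg_one_lt_exponent (H x) (x.dimM - 1)
    rwa [Nat.sub_add_cancel x.one_le_dimM] at this
  have KM : ∀ x : Dimensions, IsMeanSystem (M x) (N x) (Ψ 0 x)
      (fun a => constantCoeff (diagElt (wishartLogMoment x.exponent) (π x) (hi x) a x.dimM))
      (fun a => constantCoeff (diagElt (wishartLogMoment x.exponent) (π x) (hi x) a (x.dimM - 1)))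
      (fun a => constantCoeff (diagElt (wishartMoment x.exponent) (π x) (hi x) a x.dimM))
      (fun a => constantCoeff (diagElt (wishartMoment x.exponent) (π x) (hi x) a (x.dimM - 1)))
      (fun a => constantCoeff (offElt (wishartLogMoment x.exponent) (π x) (hi x) a x.dimM))
      (fun a => constantCoeff (offElt (wishartMoment x.exponent) (π x) (hi x) a x.dimM)) := by
    intro x
    have := isMeanSystem_wishart x.neg_one_lt_exponent (H x) (x.dimM - 1)
    rw [Nat.sub_add_cancel x.one_le_dimM] at this
    simpa only [hΨdef, zero_add] using this
  have KS' := IsCumulantSystem.pack KS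
  have KM' := IsMeanSystem.pack KM
  have hunit : ∀ x : Dimensions, (C (x.exponent + x.dimM) + X : ℝ⟦X⟧)
      * (C (x.exponent + x.dimM) + X)⁻¹ = 1 := by
    intro x
    refine PowerSeries.mul_inv_cancel _ ?_
    have := x.one_le_dimN
    rw [x.exponent_add]
    simp
    linarith
  have hNNi : N * Ni = 1 := funext hunit
  set s : Set (Dimensions → ℝ⟦X⟧) := {M, N, Ni} with hs
  set 𝓕 := adjoinFiltration s Ψ with h𝓕
  have hmono : Monotone 𝓕 := adjoinFiltration_mono s Ψ
  have hMs : M ∈ s := Or.inl rfl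
  have hNs : N ∈ s := Or.inr (Or.inl rfl)
  have hNis : Ni ∈ s := Or.inr (Or.inr rfl)
  have hM : ∀ r, M ∈ 𝓕 r := fun r => mem_adjoinFiltration_base hMs r
  have hN : ∀ r, N ∈ 𝓕 r := fun r => mem_adjoinFiltration_base hNs r
  have hNi : ∀ r, Ni ∈ 𝓕 r := fun r => mem_adjoinFiltration_base hNis r
  have hΨδ : ∀ j, δ (Ψ j) = Ψ (j + 1) := by
    intro j
    funext x
    rw [hδdef, piDerivation_apply, formalDerivative_apply, derivative_taylorSeries]
    simp only [hΨdef, add_assoc, add_comm 1]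
  have hδM : δ M = 0 := by
    funext x
    rw [hδdef, piDerivation_apply]
    ext p; simp [hMdef]
  have hδN : δ N = 1 := by
    funext x
    rw [hδdef, piDerivation_apply, formalDerivative_apply]
    simp [hNdef]
  have hδNi : δ Ni = - (Ni * Ni) := by
    have h1 := congrArg δ hNNi
    rw [RingDerivation.map_mul, hδN, RingDerivation.map_one] at h1
    linear_combination Ni * h1 - δ Ni * hNNi
  have hδ : ∀ r, ∀ a ∈ 𝓕 r, δ a ∈ 𝓕 (r + 1) := by
    intro r a ha
    refine derivation_mem_of_mem_adjoin δ (fun y hy => ?_) (fun y hy => ?_) ha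
    · exact hmono (Nat.le_succ r) (Algebra.subset_adjoin hy)
    · rcases hy with (rfl | rfl | rfl) | ⟨j, hj, rfl⟩
      · rw [hδM]; exact zero_mem _
      · rw [hδN]; exact one_mem _
      · rw [hδNi]; exact neg_mem (mul_mem (hNi _) (hNi _))
      · rw [hΨδ]; exact mem_adjoinFiltration_seq _ _ (Nat.succ_lt_succ hj)
  have hΨ : ∀ j, Ψ j ∈ 𝓕 (j + 1) := fun j => mem_adjoinFiltration_seq _ _ (Nat.lt_succ_self j)
  -- The inverse of `N` is excluded here: the polynomial claims at `t = 0` require that no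
  -- denominator occurs.
  set 𝓟 : Subalgebra ℚ (Dimensions → ℝ⟦X⟧) := Algebra.adjoin ℚ {M, N} with h𝓟
  have hMP : M ∈ 𝓟 := Algebra.subset_adjoin (Or.inl rfl)
  have hNP : N ∈ 𝓟 := Algebra.subset_adjoin (Or.inr rfl)
  have hP𝓕 : ∀ r, 𝓟 ≤ 𝓕 r := fun r => adjoin_le_adjoinFiltration (by
    rintro y (rfl | rfl)
    · exact hMs
    · exact hNs) Ψ r
  have hlin := KM'.linStat_mem (θ := fun a x => constantCoeff
      (linStat (wishartLogMoment x.exponent) (π x) (hi x) a x.dimM))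
    (r := fun a x => constantCoeff
      (linStat (wishartMoment x.exponent) (π x) (hi x) a x.dimM))
    (fun a => funext fun x => constantCoeff_offElt_log x.neg_one_lt_exponent (H x) a x.dimM)
    (fun a => funext fun x => constantCoeff_offElt_pow x.neg_one_lt_exponent (H x) a x.dimM)
    hMP hNP
  have hr0 : ∀ a, (fun x : Dimensions => constantCoeff
      (linStat (wishartMoment x.exponent) (π x) (hi x) a x.dimM)) ∈ 𝓟 := by
    intro a
    cases a with
    | zero =>
      have : (fun x : Dimensions => constantCoeff
        (linStat (wishartMoment x.exponent) (π x) (hi x) 0 x.dimM)) = M := by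
        funext x
        simp only [linStat_zero_self (H x), hMdef, map_natCast]
      rw [this]; exact hMP
    | succ a => exact (hlin a).1
  have hcoeff : ∀ f : Dimensions → ℝ⟦X⟧⟦X⟧, coeff 0 (packSeries f) = fun x => constantCoeff (f x) :=
    fun f => funext fun x => by rw [coeff_packSeries, coeff_zero_eq_constantCoeff]
  have hdiv : ∀ {a : Dimensions → ℝ⟦X⟧} {r : ℕ}, N * a ∈ 𝓕 r → a ∈ 𝓕 r := by
    intro a r ha
    have := mul_mem (hNi r) ha
    rwa [← mul_assoc, mul_comm Ni, hNNi, one_mul] at this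
  have h0 : IsCumulantSystem.CoeffsMem hmono
      (fun a => packSeries fun x => linStat (wishartLogMoment x.exponent) (π x) (hi x) a x.dimM)
      (fun a => packSeries fun x => linStat (wishartMoment x.exponent) (π x) (hi x) a x.dimM)
      (fun a => packSeries fun x => diagElt (wishartLogMoment x.exponent) (π x) (hi x) a x.dimM)
      (fun a => packSeries fun x => diagElt (wishartMoment x.exponent) (π x) (hi x) a x.dimM)
      0 := by
    refine ⟨fun a i hi' => ?_, fun a i hi' => ?_, fun a i hi' => ?_, fun a i hi' => ?_⟩ <;>
      obtain rfl := Nat.le_zero.mp hi' <;> rw [hcoeff]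
    · have h1 := add_mem (hP𝓕 1 (hlin a).2) (mul_mem (hP𝓕 1 (hr0 (a + 1))) (hΨ 0))
      rwa [sub_add_cancel] at h1
    · exact hP𝓕 1 (hr0 a)
    · have h1 := KM'.mem hMP hNP a
      have h2 := add_mem (hP𝓕 1 h1.2.1) (mul_mem (hΨ 0) (mul_mem (hN 1) (hP𝓕 1 h1.1.1)))
      rw [sub_add_cancel] at h2
      exact hdiv h2
    · exact hP𝓕 1 (KM'.mem hMP hNP a).1.1
  have hlead := KS'.leading_coeff hmono hδ (hM 0) (hN 0) h0
    (ρ := fun a x => constantCoeff (linStat (wishartMoment x.exponent) (π x) (hi x) a x.dimM))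
    (fun k => hP𝓕 0 (hr0 k)) hΨ hΨδ (fun a => by rw [hcoeff]; exact hP𝓕 0 (hlin a).2)
  -- The increment of the exponent has served for differentiation and is now set to zero.
  set ev : (Dimensions → ℝ⟦X⟧) →+* (Dimensions → ℝ) :=
    RingHom.pi fun x => (constantCoeff (R := ℝ)).comp (Pi.evalRingHom _ x) with hev
  have ev_apply : ∀ f x, ev f x = constantCoeff (f x) := fun _ _ => rfl
  have evM : ev M = fun x => (x.dimM : ℝ) := by funext x; simp [ev_apply, hMdef]
  have evN : ev N = fun x => x.dimN := by
    funext x; simp only [ev_apply, hNdef, x.exponent_add]; simp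
  have evNi : ev Ni = fun x => (x.dimN)⁻¹ := by
    funext x; simp only [ev_apply, hNidef, x.exponent_add, constantCoeff_inv]; simp
  have evΨ : ∀ j, ev (Ψ j) = fun x => polygamma j x.dimN := by
    intro j; funext x
    simp only [ev_apply, hΨdef, x.exponent_add, constantCoeff_taylorSeries, add_zero]
  have hevP : ∀ a ∈ 𝓟, ev a ∈ dimensionAlgebra := by
    intro a ha
    refine map_mem_of_mem_adjoin ev (fun y hy => ?_) ha
    rcases hy with rfl | rfl
    · rw [evM]; exact Algebra.subset_adjoin (Or.inl rfl)
    · rw [evN]; exact Algebra.subset_adjoin (Or.inr rfl)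
  have hevF : ∀ r, ∀ a ∈ 𝓕 r, ev a ∈ polygammaAlgebra r := by
    intro r a ha
    refine map_mem_adjoinFiltration ev (fun y hy => ?_) evΨ ha
    rcases hy with rfl | rfl | rfl
    · rw [evM]; exact Or.inl rfl
    · rw [evN]; exact Or.inr (Or.inl rfl)
    · rw [evNi]; exact Or.inr (Or.inr rfl)
  have hR : ∀ k (x : Dimensions), meanR k x.dimM x.exponent = constantCoeff (constantCoeff
      (linStat (wishartMoment x.exponent) (π x) (hi x) k x.dimM)) := fun k x =>
    (meanR_eq_linStat x.neg_one_lt_exponent (H x) k x.dimM).2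
  have hT : ∀ k (x : Dimensions), meanT k x.dimM x.exponent = constantCoeff (constantCoeff
      (linStat (wishartLogMoment x.exponent) (π x) (hi x) k x.dimM)) := fun k x =>
    (meanT_eq_linStat x.neg_one_lt_exponent (H x) k x.dimM).2
  refine ⟨fun x => PowerSeries.map (constantCoeff (R := ℝ))
    (linStat (wishartLogMoment x.exponent) (π x) (hi x) 1 x.dimM), fun x => ?_, fun k => ?_,
    fun k => ?_, fun p => ?_⟩
  · exact derivative_momentSeries_statT x.neg_one_lt_exponent (H x) x.dimM
  · convert hevP _ (hr0 (k + 1)) using 1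
    funext x
    rw [ev_apply, hR]
  · convert hevP _ (hlin k).2 using 1
    rw [map_sub, map_mul, evΨ]
    funext x
    rw [Pi.sub_apply, Pi.mul_apply, ev_apply, ev_apply, hR, hT]
  · convert hevF p _ (hlead p 0) using 1
    rw [map_sub, map_mul, map_mul, evΨ, map_natCast]
    funext x
    rw [Pi.sub_apply, Pi.mul_apply, Pi.mul_apply, ev_apply, ev_apply, hR, coeff_packSeries,
      coeff_map, zero_add, add_comm p 1, Pi.natCast_apply]

end Structure

end EntanglementEntropy

namespace EntanglementEntropy

open MeasureTheory Finset
open scoped ENNReal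

/-! ### Coordinates given by the trace and the normalized vector. -/

section Polar

lemma hyperplanePoint_succ (k : ℕ) (y : Fin k → ℝ) :
    hyperplanePoint (k + 1) y = (Fin.snoc y (1 - ∑ j, y j) : Fin (k + 1) → ℝ) := by
  funext i
  refine Fin.lastCases ?_ (fun i => ?_) i
  · rw [Fin.snoc_last, hyperplanePoint, dif_neg (by simp)]; rfl
  · rw [Fin.snoc_castSucc, hyperplanePoint, dif_pos (by simp)]; rfl

lemma measurable_hyperplanePoint (m : ℕ) : Measurable (hyperplanePoint m) := by
  refine measurable_pi_lambda _ fun i => ?_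
  unfold hyperplanePoint
  split_ifs with h
  · exact measurable_pi_apply _
  · fun_prop

lemma sum_hyperplanePoint {m : ℕ} (hm : 1 ≤ m) (y : Fin (m - 1) → ℝ) :
    ∑ i, hyperplanePoint m y i = 1 := by
  obtain ⟨k, rfl⟩ : ∃ k, m = k + 1 := ⟨m - 1, by omega⟩
  change Fin k → ℝ at y
  rw [hyperplanePoint_succ, Fin.sum_univ_castSucc]
  simp

lemma ae_sum_eq_one {m : ℕ} (hm : 1 ≤ m) : ∀ᵐ x ∂(deltaHyperplane m), ∑ i, x i = 1 := by
  rw [deltaHyperplane, ae_map_iff (measurable_hyperplanePoint m).aemeasurable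
    (measurableSet_eq_fun (by fun_prop) measurable_const)]
  exact Filter.Eventually.of_forall fun y => sum_hyperplanePoint hm y

instance (m : ℕ) : SFinite (deltaHyperplane m) := by
  unfold deltaHyperplane; infer_instance

lemma lintegral_snoc (k : ℕ) (F : (Fin (k + 1) → ℝ) → ℝ≥0∞) (hF : Measurable F) :
    ∫⁻ x, F x = ∫⁻ y : Fin k → ℝ, ∫⁻ s : ℝ, F (Fin.snoc y s : Fin (k + 1) → ℝ) := by
  have h := (volume_preserving_piFinSuccAbove (fun _ : Fin (k + 1) => ℝ) (Fin.last k)).symm _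
  have hm : Measurable fun p : ℝ × (Fin k → ℝ) =>
      F ((MeasurableEquiv.piFinSuccAbove (fun _ : Fin (k + 1) => ℝ) (Fin.last k)).symm p) :=
    hF.comp (MeasurableEquiv.measurable _)
  rw [← h.lintegral_comp hF, Measure.volume_eq_prod, lintegral_prod_symm' _ hm]
  refine lintegral_congr fun y => lintegral_congr fun s => ?_
  congr 1
  exact Fin.insertNth_last' s y

lemma lintegral_smul_eq (k : ℕ) {r : ℝ} (hr : 0 < r) (G : (Fin k → ℝ) → ℝ≥0∞) (hG : Measurable G) :
    ∫⁻ y, G y = ENNReal.ofReal (r ^ k) * ∫⁻ y, G (r • y) := by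
  have h := Measure.map_addHaar_smul (volume : Measure (Fin k → ℝ)) hr.ne'
  rw [← lintegral_map hG (measurable_const_smul r), h, lintegral_smul_measure, smul_eq_mul,
    ← mul_assoc, ← ENNReal.ofReal_mul (by positivity), Module.finrank_fin_fun,
    abs_of_nonneg (by positivity), mul_inv_cancel₀ (by positivity), ENNReal.ofReal_one, one_mul]

/-- Integration in the coordinates given by the trace and the normalized vector. -/
lemma lintegral_polar (k : ℕ) (F : (Fin (k + 1) → ℝ) → ℝ≥0∞) (hF : Measurable F)
    (h0 : ∀ x, ∑ i, x i ≤ 0 → F x = 0) :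
    ∫⁻ x, F x = ∫⁻ r in Set.Ioi (0 : ℝ), ENNReal.ofReal (r ^ k) *
      ∫⁻ x, F (r • x) ∂(deltaHyperplane (k + 1)) := by
  have hm : Measurable fun p : (Fin k → ℝ) × ℝ => (Fin.snoc p.1 (p.2 - ∑ j, p.1 j) :
      Fin (k + 1) → ℝ) := by
    refine measurable_pi_lambda _ fun i => ?_
    refine Fin.lastCases ?_ (fun i => ?_) i
    · simp only [Fin.snoc_last]; fun_prop
    · simp only [Fin.snoc_castSucc]; fun_prop
  rw [lintegral_snoc k F hF]
  have h1 : ∀ y : Fin k → ℝ, ∫⁻ s : ℝ, F (Fin.snoc y s : Fin (k + 1) → ℝ)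
      = ∫⁻ r : ℝ, F (Fin.snoc y (r - ∑ j, y j) : Fin (k + 1) → ℝ) := fun y =>
    (lintegral_sub_right_eq_self (fun s : ℝ => F (Fin.snoc y s : Fin (k + 1) → ℝ)) _).symm
  simp only [h1]
  have hFm : Measurable (Function.uncurry fun (y : Fin k → ℝ) (r : ℝ) =>
      F (Fin.snoc y (r - ∑ j, y j) : Fin (k + 1) → ℝ)) := hF.comp hm
  -- Space is sliced by the trace `r`, the last coordinate being `r - ∑ y_j`. Rescaling `y` by `r`
  -- on a slice yields the Jacobian `r ^ k`, and slices with `r ≤ 0` vanish by `h0`.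
  rw [lintegral_lintegral_swap hFm.aemeasurable, ← lintegral_indicator measurableSet_Ioi]
  refine lintegral_congr fun r => ?_
  by_cases hr : 0 < r
  · have hG : Measurable fun y : Fin k → ℝ =>
        F (Fin.snoc y (r - ∑ j, y j) : Fin (k + 1) → ℝ) :=
      hFm.comp (measurable_id.prodMk measurable_const)
    have hH : Measurable fun x : Fin (k + 1) → ℝ => F (r • x) :=
      hF.comp (measurable_const_smul r)
    rw [Set.indicator_of_mem (Set.mem_Ioi.mpr hr), lintegral_smul_eq k hr _ hG, deltaHyperplane,
      lintegral_map hH (measurable_hyperplanePoint _)]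
    congr 1
    refine lintegral_congr fun y => ?_
    rw [hyperplanePoint_succ]
    congr 1
    funext i
    refine Fin.lastCases ?_ (fun i => ?_) i
    · simp only [Fin.snoc_last, Pi.smul_apply, smul_eq_mul, mul_sub, mul_sum, mul_one]
    · simp only [Fin.snoc_castSucc, Pi.smul_apply, smul_eq_mul]
  · rw [Set.indicator_of_notMem (s := Set.Ioi (0 : ℝ)) hr]
    have : ∀ y : Fin k → ℝ, F (Fin.snoc y (r - ∑ j, y j) : Fin (k + 1) → ℝ) = 0 := fun y =>
      h0 _ (by rw [Fin.sum_univ_castSucc]; simpa using not_lt.mp hr)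
    simp [this]

end Polar

/-! ### Independence of trace and normalized spectrum. -/

section Disintegration

lemma measurableSet_pos (m : ℕ) : MeasurableSet {x : Fin m → ℝ | ∀ i, 0 < x i} := by
  rw [Set.ofPred_forall]
  exact MeasurableSet.iInter fun i => measurableSet_lt measurable_const (measurable_pi_apply i)

lemma measurable_vandermondeSq (m : ℕ) : Measurable (vandermondeSq (m := m)) := by
  unfold vandermondeSq
  fun_prop

lemma measurable_wishartWeight (m : ℕ) (α : ℝ) : Measurable (wishartWeight m α) := by
  unfold wishartWeight
  refine Measurable.ite (measurableSet_pos m) ((measurable_vandermondeSq m).mul ?_) measurable_const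
  fun_prop

lemma measurable_hilbertSchmidtWeight (m : ℕ) (α : ℝ) :
    Measurable (hilbertSchmidtWeight m α) := by
  unfold hilbertSchmidtWeight
  refine Measurable.ite (measurableSet_pos m) ((measurable_vandermondeSq m).mul ?_) measurable_const
  fun_prop

lemma vandermondeSq_smul {m : ℕ} (r : ℝ) (x : Fin m → ℝ) :
    vandermondeSq (r • x) = r ^ (m * (m - 1)) * vandermondeSq x := by
  have h1 : (Matrix.vandermonde (r • x)).transpose.det
      = (∏ j : Fin m, r ^ (j : ℕ)) * (Matrix.vandermonde x).transpose.det := by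
    rw [← Matrix.det_mul_column]
    congr 1
    ext i j
    simp [Matrix.vandermonde_apply, mul_pow]
  rw [vandermondeSq_eq, vandermondeSq_eq, h1, Fin.prod_univ_eq_prod_range (fun j => r ^ j),
    prod_pow_eq_pow_sum, ← Finset.sum_range_id_mul_two, pow_mul]
  ring

/-- The exponent of the trace density is `m (m + α)`. -/
lemma wishartWeight_smul {k : ℕ} (α : ℝ) {r : ℝ} (hr : 0 < r) {x : Fin (k + 1) → ℝ}
    (hx : ∑ i, x i = 1) :
    r ^ k * wishartWeight (k + 1) α (r • x)
      = r ^ (((k + 1 : ℕ) : ℝ) * ((k + 1 : ℕ) + α) - 1) * Real.exp (-r)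
        * hilbertSchmidtWeight (k + 1) α x := by
  have hiff : (∀ i, 0 < (r • x) i) ↔ ∀ i, 0 < x i :=
    forall_congr' fun i => by simp [hr]
  rw [wishartWeight, hilbertSchmidtWeight]
  by_cases h : ∀ i, 0 < x i
  · rw [if_pos (hiff.mpr h), if_pos h, vandermondeSq_smul, prod_mul_distrib, ← Real.exp_sum]
    have h1 : ∏ i, (r • x) i ^ α = r ^ (((k + 1 : ℕ) : ℝ) * α) * ∏ i, x i ^ α := by
      simp only [Pi.smul_apply, smul_eq_mul]
      rw [prod_congr rfl fun i _ => Real.mul_rpow hr.le (h i).le, prod_mul_distrib, prod_const,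
        card_univ, Fintype.card_fin, ← Real.rpow_natCast, ← Real.rpow_mul hr.le, mul_comm α]
    have h2 : ∑ i, -(r • x) i = -r := by
      simp only [Pi.smul_apply, smul_eq_mul, sum_neg_distrib, ← mul_sum, hx, mul_one]
    -- The three factors come from the Jacobian, the squared Vandermonde and the powers `x_i ^ α`.
    have h3 : r ^ (((k + 1 : ℕ) : ℝ) * ((k + 1 : ℕ) + α) - 1)
        = r ^ k * r ^ ((k + 1) * (k + 1 - 1)) * r ^ (((k + 1 : ℕ) : ℝ) * α) := by
      rw [← Real.rpow_natCast, ← Real.rpow_natCast, ← Real.rpow_add hr, ← Real.rpow_add hr]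
      congr 1
      push_cast [Nat.add_sub_cancel]
      ring
    rw [h1, h2, h3]
    ring
  · rw [if_neg (fun h' => h (hiff.mp h')), if_neg h, mul_zero, mul_zero]

/-- The density of the trace of a Wishart matrix, up to normalization. -/
noncomputable def radialMeasure (z : ℝ) : Measure ℝ :=
  (volume.restrict (Set.Ioi 0)).withDensity fun r => ENNReal.ofReal (r ^ (z - 1) * Real.exp (-r))

/-- The unnormalized Hilbert-Schmidt measure. -/
noncomputable def hilbertSchmidtUnnormalized (m : ℕ) (α : ℝ) : Measure (Fin m → ℝ) :=
  (deltaHyperplane m).withDensity fun x => ENNReal.ofReal (hilbertSchmidtWeight m α x)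

instance (m : ℕ) (α : ℝ) : SFinite (hilbertSchmidtUnnormalized m α) := by
  unfold hilbertSchmidtUnnormalized; infer_instance

instance (z : ℝ) : SFinite (radialMeasure z) := by
  unfold radialMeasure; infer_instance

lemma measurable_smul_pair (m : ℕ) : Measurable fun p : ℝ × (Fin m → ℝ) => p.1 • p.2 := by
  fun_prop

/-- The trace and the normalized matrix of a Wishart matrix are independent. -/
lemma wishartUnnormalized_eq_map {m : ℕ} (hm : 1 ≤ m) (α : ℝ) :
    wishartUnnormalized m α = ((radialMeasure (m * (m + α))).prod
      (hilbertSchmidtUnnormalized m α)).map fun p => p.1 • p.2 := by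
  obtain ⟨k, rfl⟩ : ∃ k, m = k + 1 := ⟨m - 1, by omega⟩
  have hd : Measurable fun r : ℝ => ENNReal.ofReal
      (r ^ (((k + 1 : ℕ) : ℝ) * ((k + 1 : ℕ) + α) - 1) * Real.exp (-r)) := by fun_prop
  ext s hs
  have hpre := measurable_smul_pair (k + 1) hs
  rw [Measure.map_apply (measurable_smul_pair _) hs, Measure.prod_apply hpre, radialMeasure,
    lintegral_withDensity_eq_lintegral_mul _ hd (measurable_measure_prodMk_left hpre),
    wishartUnnormalized, withDensity_apply _ hs, ← lintegral_indicator hs, lintegral_polar]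
  · refine setLIntegral_congr_fun measurableSet_Ioi fun r hr => ?_
    have hs' : MeasurableSet ((fun x : Fin (k + 1) → ℝ => r • x) ⁻¹' s) :=
      measurable_const_smul r hs
    have hm1 : Measurable fun x : Fin (k + 1) → ℝ => s.indicator
        (fun a => ENNReal.ofReal (wishartWeight (k + 1) α a)) (r • x) :=
      ((measurable_wishartWeight _ _).ennreal_ofReal.indicator hs).comp (measurable_const_smul r)
    simp only [Pi.mul_apply]
    rw [show (Prod.mk r ⁻¹' ((fun p : ℝ × (Fin (k + 1) → ℝ) => p.1 • p.2) ⁻¹' s))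
      = (fun x : Fin (k + 1) → ℝ => r • x) ⁻¹' s from rfl, hilbertSchmidtUnnormalized,
      withDensity_apply _ hs', ← lintegral_indicator hs', ← lintegral_const_mul _ hm1, ← lintegral_const_mul _
        ((measurable_hilbertSchmidtWeight _ _).ennreal_ofReal.indicator hs')]
    refine lintegral_congr_ae ?_
    filter_upwards [ae_sum_eq_one hm] with x hx
    by_cases hxs : r • x ∈ s
    · rw [Set.indicator_of_mem hxs, Set.indicator_of_mem (s := (fun x => r • x) ⁻¹' s) hxs,
        ← ENNReal.ofReal_mul (pow_nonneg (le_of_lt hr) _), ← ENNReal.ofReal_mul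
          (mul_nonneg (Real.rpow_nonneg (le_of_lt hr) _) (Real.exp_pos _).le),
        wishartWeight_smul α hr hx]
    · rw [Set.indicator_of_notMem hxs, Set.indicator_of_notMem (s := (fun x => r • x) ⁻¹' s) hxs,
        mul_zero, mul_zero]
  · exact (measurable_wishartWeight _ _).ennreal_ofReal.indicator hs
  · intro x hx
    have : wishartWeight (k + 1) α x = 0 := by
      rw [wishartWeight, if_neg]
      intro h
      exact absurd (sum_pos (fun i _ => h i) univ_nonempty) (not_lt.mpr hx)
    simp [Set.indicator, this]

end Disintegration

end EntanglementEntropy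

namespace EntanglementEntropy

open MeasureTheory ProbabilityTheory Finset
open scoped ENNReal

/-! ### The gamma law of the trace. -/

section Radial

variable {z : ℝ} (hz : 0 < z)

lemma radial_integrand_eq (z : ℝ) (l j : ℕ) : Set.EqOn
    (fun r : ℝ => (ENNReal.ofReal (r ^ (z - 1) * Real.exp (-r))).toReal • (r ^ l * Real.log r ^ j))
    (fun r => r ^ (z + l - 1) * Real.log r ^ j * Real.exp (-r)) (Set.Ioi 0) := by
  intro r hr
  have hr' : (0 : ℝ) < r := hr
  simp only [smul_eq_mul]
  rw [ENNReal.toReal_ofReal (by positivity), show z + l - 1 = z - 1 + l by ring,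
    Real.rpow_add hr', Real.rpow_natCast]
  ring

lemma measurable_radial_density (z : ℝ) :
    Measurable fun r : ℝ => ENNReal.ofReal (r ^ (z - 1) * Real.exp (-r)) := by fun_prop

include hz in
lemma integrable_radial (l j : ℕ) :
    Integrable (fun r => r ^ l * Real.log r ^ j) (radialMeasure z) := by
  rw [radialMeasure, integrable_withDensity_iff_integrable_smul' (measurable_radial_density z)
    (Filter.Eventually.of_forall fun _ => ENNReal.ofReal_lt_top)]
  refine (integrableOn_gammaLog j (z := z + l) (by positivity)).congr ?_
  exact (ae_restrict_of_forall_mem measurableSet_Ioi fun r hr => (radial_integrand_eq z l j hr).symm)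

lemma integral_radial (z : ℝ) (l j : ℕ) :
    ∫ r, r ^ l * Real.log r ^ j ∂(radialMeasure z) = gammaLog j (z + l) := by
  rw [radialMeasure, integral_withDensity_eq_integral_toReal_smul (measurable_radial_density z)
    (Filter.Eventually.of_forall fun _ => ENNReal.ofReal_lt_top), gammaLog]
  exact setIntegral_congr_fun measurableSet_Ioi (radial_integrand_eq z l j)

include hz in
lemma isFiniteMeasure_radial : IsFiniteMeasure (radialMeasure z) := by
  have h := integrable_radial hz 0 0
  simp only [pow_zero, mul_one] at h
  exact (integrable_const_iff_isFiniteMeasure (one_ne_zero (α := ℝ))).mp h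

include hz in
lemma radial_real_univ : (radialMeasure z).real Set.univ = Real.Gamma z := by
  have h := integral_radial z 0 0
  simpa [gammaLog_zero hz] using h

lemma ae_radial_pos (z : ℝ) : ∀ᵐ r ∂(radialMeasure z), 0 < r := by
  rw [radialMeasure, ae_withDensity_iff (measurable_radial_density z)]
  filter_upwards [ae_restrict_mem measurableSet_Ioi] with r hr _ using hr

end Radial

/-! ### Moments of `T_1` in terms of moments of the entropy. -/

section Entropy

lemma ae_hilbertSchmidtUnnormalized {m : ℕ} (hm : 1 ≤ m) (α : ℝ) :
    ∀ᵐ x ∂(hilbertSchmidtUnnormalized m α), (∀ i, 0 < x i) ∧ ∑ i, x i = 1 := by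
  rw [hilbertSchmidtUnnormalized,
    ae_withDensity_iff (measurable_hilbertSchmidtWeight m α).ennreal_ofReal]
  filter_upwards [ae_sum_eq_one hm] with x hx h
  refine ⟨?_, hx⟩
  by_contra h'
  rw [hilbertSchmidtWeight, if_neg h'] at h
  simp at h

lemma measurable_vonNeumannEntropy (m : ℕ) : Measurable (vonNeumannEntropy (m := m)) := by
  unfold vonNeumannEntropy
  fun_prop

lemma measurable_statT (k m : ℕ) : Measurable (statT k (m := m)) := by
  unfold statT
  fun_prop

/-- Boundedness on the simplex supplies all moments and exponential moments of the entropy. -/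
lemma abs_vonNeumannEntropy_le {m : ℕ} {x : Fin m → ℝ} (h0 : ∀ i, 0 < x i)
    (h1 : ∑ i, x i = 1) : |vonNeumannEntropy x| ≤ m := by
  rw [vonNeumannEntropy, abs_neg]
  refine (abs_sum_le_sum_abs _ _).trans ?_
  have : ∀ i ∈ (univ : Finset (Fin m)), |x i * Real.log (x i)| ≤ 1 := by
    intro i _
    have hle : x i ≤ 1 := by
      rw [← h1]; exact single_le_sum (f := x) (fun j _ => (h0 j).le) (mem_univ i)
    rw [mul_comm]
    exact (Real.abs_log_mul_self_lt _ (h0 i) hle).le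
  exact (sum_le_sum this).trans (by simp)

variable {m : ℕ} (hm : 1 ≤ m) {α : ℝ} (hα : -1 < α)

include hm hα in
lemma mul_add_pos : 0 < (m : ℝ) * (m + α) := by
  have : (1 : ℝ) ≤ m := by exact_mod_cast hm
  exact mul_pos (by linarith) (by linarith)

include hm in
lemma wishartUnnormalized_univ_eq_mul : wishartUnnormalized m α Set.univ
    = radialMeasure (m * (m + α)) Set.univ * hilbertSchmidtUnnormalized m α Set.univ := by
  rw [wishartUnnormalized_eq_map hm, Measure.map_apply (measurable_smul_pair m) MeasurableSet.univ,
    Set.preimage_univ, ← Measure.prod_prod, Set.univ_prod_univ]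

include hm hα in
lemma hilbertSchmidtUnnormalized_univ_ne_zero :
    hilbertSchmidtUnnormalized m α Set.univ ≠ 0 := fun h =>
  wishartUnnormalized_univ_ne_zero hα m (by rw [wishartUnnormalized_univ_eq_mul hm, h, mul_zero])

include hm hα in
-- The finite Wishart mass is the product of this mass with a nonzero radial mass, so neither direct
-- estimates nor a normalization constant are needed.
lemma isFiniteMeasure_hilbertSchmidtUnnormalized :
    IsFiniteMeasure (hilbertSchmidtUnnormalized m α) := by
  refine ⟨lt_top_iff_ne_top.mpr fun h => ?_⟩
  have h1 := wishartUnnormalized_univ_eq_mul (α := α) hm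
  have h2 : radialMeasure (m * (m + α)) Set.univ ≠ 0 := fun h2 =>
    wishartUnnormalized_univ_ne_zero hα m (by rw [h1, h2, zero_mul])
  rw [h, ENNReal.mul_top h2, wishartUnnormalized_univ hα] at h1
  exact ENNReal.ofReal_ne_top h1

include hm hα in
lemma integrable_vonNeumannEntropy_pow (i : ℕ) :
    Integrable (fun x => vonNeumannEntropy x ^ i) (hilbertSchmidtUnnormalized m α) := by
  have := isFiniteMeasure_hilbertSchmidtUnnormalized hm hα
  refine Integrable.of_bound ((measurable_vonNeumannEntropy m).pow_const i).aestronglyMeasurable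
    ((m : ℝ) ^ i) ?_
  filter_upwards [ae_hilbertSchmidtUnnormalized hm α] with x hx
  rw [norm_pow, Real.norm_eq_abs]
  exact pow_le_pow_left₀ (abs_nonneg _) (abs_vonNeumannEntropy_le hx.1 hx.2) i

include hm hα in
lemma isProbabilityMeasure_hilbertSchmidt : IsProbabilityMeasure (hilbertSchmidt m α) := by
  have := isFiniteMeasure_hilbertSchmidtUnnormalized hm hα
  refine ⟨?_⟩
  change ((hilbertSchmidtUnnormalized m α Set.univ)⁻¹ • hilbertSchmidtUnnormalized m α) Set.univ = 1
  rw [Measure.smul_apply, smul_eq_mul, ENNReal.inv_mul_cancel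
    (hilbertSchmidtUnnormalized_univ_ne_zero hm hα) (measure_ne_top _ _)]

include hm hα in
lemma integrable_exp_vonNeumannEntropy (t : ℝ) :
    Integrable (fun x => Real.exp (t * vonNeumannEntropy x)) (hilbertSchmidt m α) := by
  have := isFiniteMeasure_hilbertSchmidtUnnormalized hm hα
  refine integrable_normalize (hilbertSchmidtUnnormalized_univ_ne_zero hm hα)
    (Integrable.of_bound (μ := hilbertSchmidtUnnormalized m α)
    ((measurable_vonNeumannEntropy m).const_mul t).exp.aestronglyMeasurable
    (Real.exp (|t| * m)) ?_)
  filter_upwards [ae_hilbertSchmidtUnnormalized hm α] with x hx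
  rw [Real.norm_eq_abs, abs_of_pos (Real.exp_pos _)]
  refine Real.exp_le_exp.mpr ((le_abs_self _).trans ?_)
  rw [abs_mul]
  exact mul_le_mul_of_nonneg_left (abs_vonNeumannEntropy_le hx.1 hx.2) (abs_nonneg _)

lemma statT_one_smul {r : ℝ} (hr : 0 < r) {x : Fin m → ℝ} (h0 : ∀ i, 0 < x i)
    (h1 : ∑ i, x i = 1) :
    statT 1 (r • x) = -(r * vonNeumannEntropy x) + r * Real.log r := by
  have : ∀ i, (r • x) i ^ 1 * Real.log ((r • x) i)
      = r * (x i * Real.log (x i)) + r * Real.log r * x i := by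
    intro i
    rw [pow_one, Pi.smul_apply, smul_eq_mul, Real.log_mul hr.ne' (h0 i).ne']
    ring
  rw [statT, sum_congr rfl fun i _ => this i, sum_add_distrib, ← mul_sum, ← mul_sum, h1,
    vonNeumannEntropy]
  ring

include hm hα in
/-- The moments of `T_1` over the Wishart-Laguerre ensemble in terms of those of the entropy over
the Hilbert-Schmidt ensemble. -/
lemma integral_statT_pow (l : ℕ) :
    ∫ x : Fin m → ℝ, statT 1 x ^ l ∂(wishartLaguerre m α)
      = ∑ i ∈ range (l + 1), (l.choose i : ℝ) * (-1) ^ i *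
        (gammaLog (l - i) (m * (m + α) + l) / Real.Gamma (m * (m + α))
          * ∫ x, vonNeumannEntropy x ^ i ∂(hilbertSchmidt m α)) := by
  have hz := mul_add_pos hm hα
  set z := (m : ℝ) * (m + α) with hzdef
  have fin1 := isFiniteMeasure_hilbertSchmidtUnnormalized hm hα
  have fin2 := isFiniteMeasure_radial hz
  have hH : 0 < (hilbertSchmidtUnnormalized m α).real Set.univ :=
    ENNReal.toReal_pos (hilbertSchmidtUnnormalized_univ_ne_zero hm hα) (measure_ne_top _ _)
  have hG : 0 < Real.Gamma z := Real.Gamma_pos_of_pos hz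
  have hW : (wishartUnnormalized m α).real Set.univ
      = Real.Gamma z * (hilbertSchmidtUnnormalized m α).real Set.univ := by
    rw [Measure.real, wishartUnnormalized_univ_eq_mul hm, ENNReal.toReal_mul, ← hzdef,
      ← radial_real_univ hz]
    rfl
  have key : ∫ x : Fin m → ℝ, statT 1 x ^ l ∂(wishartUnnormalized m α)
      = ∑ i ∈ range (l + 1), (l.choose i : ℝ) * (-1) ^ i * (gammaLog (l - i) (z + l)
          * ∫ x, vonNeumannEntropy x ^ i ∂(hilbertSchmidtUnnormalized m α)) := by
    rw [wishartUnnormalized_eq_map hm, integral_map (measurable_smul_pair m).aemeasurable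
      ((measurable_statT 1 m).pow_const l).aestronglyMeasurable, ← hzdef]
    have e : ∀ᵐ p ∂((radialMeasure z).prod (hilbertSchmidtUnnormalized m α)),
        statT 1 (p.1 • p.2) ^ l = ∑ i ∈ range (l + 1), (l.choose i : ℝ) * (-1) ^ i *
          ((p.1 ^ l * Real.log p.1 ^ (l - i)) * vonNeumannEntropy p.2 ^ i) := by
      filter_upwards [Measure.quasiMeasurePreserving_fst.ae (ae_radial_pos z),
        Measure.quasiMeasurePreserving_snd.ae (ae_hilbertSchmidtUnnormalized hm α)] with p h1 h2
      rw [statT_one_smul h1 h2.1 h2.2, add_pow]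
      refine sum_congr rfl fun i hi => ?_
      have : p.1 ^ l = p.1 ^ i * p.1 ^ (l - i) := by
        rw [← pow_add, Nat.add_sub_cancel' (Nat.lt_succ_iff.mp (mem_range.mp hi))]
      rw [this, neg_pow, mul_pow, mul_pow]
      ring
    rw [integral_congr_ae e, integral_finsetSum]
    · refine sum_congr rfl fun i _ => ?_
      rw [integral_const_mul, integral_prod_mul (fun r => r ^ l * Real.log r ^ (l - i))
        (fun x => vonNeumannEntropy x ^ i), integral_radial]
    · intro i _
      exact ((integrable_radial hz l (l - i)).mul_prod
        (integrable_vonNeumannEntropy_pow hm hα i)).const_mul _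
  change ∫ x : Fin m → ℝ, statT 1 x ^ l ∂(normalize (wishartUnnormalized m α)) = _
  rw [integral_normalize, key, hW, mul_sum]
  refine sum_congr rfl fun i _ => ?_
  change _ = _ * (_ * ∫ x, vonNeumannEntropy x ^ i ∂(normalize (hilbertSchmidtUnnormalized m α)))
  rw [integral_normalize]
  field_simp

end Entropy

end EntanglementEntropy

namespace EntanglementEntropy

open MeasureTheory ProbabilityTheory Finset

/-! ### The moment-cumulant recurrence and filtrations. -/

section BinomialRecurrence

variable {𝔸 : Type*} [CommRing 𝔸] [Algebra ℚ 𝔸] {𝓖 : ℕ → Subalgebra ℚ 𝔸} (hmono : Monotone 𝓖)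
  {a b : ℕ → 𝔸} (h0 : a 0 = 1)
  (hrec : ∀ l, a (l + 1) = ∑ i ∈ range (l + 1), (l.choose i : 𝔸) * b i * a (l - i))

omit [Algebra ℚ 𝔸] in
include h0 hrec in
lemma binomial_recurrence_sub (l : ℕ) :
    a (l + 1) - b l = ∑ i ∈ range l, (l.choose i : 𝔸) * b i * a (l - i) := by
  rw [hrec, sum_range_succ, Nat.choose_self, Nat.sub_self, h0]
  simp

include hmono in
lemma binomial_sum_mem {l : ℕ} (ha : ∀ i ≤ l, a i ∈ 𝓖 l) (hb : ∀ i < l, b i ∈ 𝓖 (i + 1)) :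
    ∑ i ∈ range l, (l.choose i : 𝔸) * b i * a (l - i) ∈ 𝓖 l := by
  refine sum_mem fun i hi => ?_
  have hi' := mem_range.mp hi
  exact mul_mem (mul_mem (natCast_mem _ _) (hmono hi' (hb i hi'))) (ha _ (Nat.sub_le _ _))

include hmono h0 hrec in
-- With `a` as moments and `b` as shifted cumulants, every summand except `i = l` is a product of
-- elements of `𝓖 l`; hence the highest moment and cumulant share their leading term.
lemma mem_of_binomial_recurrence (hb : ∀ i, b i ∈ 𝓖 (i + 1)) (l : ℕ) :
    a l ∈ 𝓖 l ∧ a (l + 1) - b l ∈ 𝓖 l := by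
  have h1 : ∀ l, ∀ i ≤ l, a i ∈ 𝓖 l := by
    intro l
    induction l with
    | zero =>
      intro i hi
      rw [Nat.le_zero.mp hi, h0]
      exact one_mem _
    | succ l ih =>
      intro i hi
      rcases hi.eq_or_lt with rfl | hlt
      · rw [hrec, sum_range_succ, Nat.choose_self, Nat.sub_self, h0]
        refine add_mem (hmono (Nat.le_succ l) (binomial_sum_mem hmono ih fun i _ => hb i)) ?_
        exact mul_mem (mul_mem (natCast_mem _ _) (hb l)) (one_mem _)
      · exact hmono (Nat.le_succ l) (ih i (by omega))
  refine ⟨h1 l l le_rfl, ?_⟩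
  rw [binomial_recurrence_sub h0 hrec]
  exact binomial_sum_mem hmono (h1 l) fun i _ => hb i

include hmono h0 hrec in
-- The converse direction, from moments to cumulants: the relation is solved for the newest `b`.
lemma mem_of_binomial_recurrence' (ha : ∀ i, a i ∈ 𝓖 i) (l : ℕ) : a (l + 1) - b l ∈ 𝓖 l := by
  induction l using Nat.strong_induction_on with
  | _ l ih =>
    rw [binomial_recurrence_sub h0 hrec]
    refine binomial_sum_mem hmono (fun i hi => hmono hi (ha i)) fun i hi => ?_
    have h1 := sub_mem (ha (i + 1)) (hmono (Nat.le_succ i) (ih i hi))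
    rwa [sub_sub_cancel] at h1

lemma binomial_recurrence_of_derivative {a b : ℕ → ℝ}
    (h : formalDerivative ℝ (PowerSeries.mk fun l => a l / l.factorial)
      = (PowerSeries.mk fun l => b l / l.factorial)
        * PowerSeries.mk fun l => a l / l.factorial) (l : ℕ) :
    a (l + 1) = ∑ i ∈ range (l + 1), (l.choose i : ℝ) * b i * a (l - i) := by
  have h1 := congrArg (PowerSeries.coeff l) h
  rw [coeff_formalDerivative, PowerSeries.coeff_mul, Nat.sum_antidiagonal_eq_sum_range_succ_mk] at h1
  simp only [PowerSeries.coeff_mk] at h1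
  have h2 : a (l + 1) = l.factorial * (a (l + 1) / (l + 1).factorial * (l + 1)) := by
    rw [Nat.factorial_succ]; push_cast; field_simp
  rw [h2, h1, mul_sum]
  refine sum_congr rfl fun i hi => ?_
  rw [Nat.cast_choose ℝ (Nat.lt_succ_iff.mp (mem_range.mp hi))]
  field_simp

end BinomialRecurrence

/-! ### Moments from cumulants. -/

section Cumulants

/-- The recurrence between the moments and the cumulants. -/
lemma moment_succ_eq_sum_cumulant {Ω : Type*} [MeasurableSpace Ω] {μ : Measure Ω}
    [IsProbabilityMeasure μ] {Y : Ω → ℝ} (hY : ∀ t : ℝ, Integrable (fun ω => Real.exp (t * Y ω)) μ)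
    (l : ℕ) : ∫ ω, Y ω ^ (l + 1) ∂μ
      = ∑ i ∈ range (l + 1), (l.choose i : ℝ) * cumulant Y μ (i + 1) * ∫ ω, Y ω ^ (l - i) ∂μ := by
  have hint : ∀ t, t ∈ interior (integrableExpSet Y μ) := by
    have : integrableExpSet Y μ = Set.univ := Set.eq_univ_of_forall hY
    intro t; rw [this, interior_univ]; trivial
  have hmom : ∀ j, iteratedDeriv j (mgf Y μ) 0 = ∫ ω, Y ω ^ j ∂μ := fun j =>
    iteratedDeriv_mgf_zero (hint 0) j
  have hd : deriv (mgf Y μ) = deriv (cgf Y μ) * mgf Y μ := by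
    funext t
    have hpos := mgf_pos (hY t)
    have h1 : deriv (cgf Y μ) t = deriv (mgf Y μ) t / mgf Y μ t :=
      ((analyticAt_mgf (hint t)).differentiableAt.hasDerivAt.log hpos.ne').deriv
    rw [Pi.mul_apply, h1, div_mul_cancel₀ _ hpos.ne']
  -- The Leibniz rule for the `l`-th derivative of `M' = K' M`, where `K = ln M`, evaluated at zero.
  rw [← hmom, iteratedDeriv_succ', hd, iteratedDeriv_mul
    (analyticAt_cgf (hint 0)).deriv.contDiffAt (analyticAt_mgf (hint 0)).contDiffAt]
  refine sum_congr rfl fun i _ => ?_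
  rw [hmom, cumulant, iteratedDeriv_succ']

end Cumulants

/-! ### Rational expressions in the dimensions and polygamma values; trace moments. -/

section EntropyAlgebra

/-- The product of the dimensions. -/
noncomputable def Dimensions.dimMN (x : Dimensions) : ℝ := x.dimM * x.dimN

lemma Dimensions.dimMN_pos (x : Dimensions) : 0 < x.dimMN := by
  have h1 : (1 : ℝ) ≤ x.dimM := by exact_mod_cast x.one_le_dimM
  have h2 := x.one_le_dimN
  exact mul_pos (by linarith) (by linarith)

lemma Dimensions.mul_exponent_add (x : Dimensions) :
    (x.dimM : ℝ) * (x.dimM + x.exponent) = x.dimMN := by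
  rw [add_comm, x.exponent_add, Dimensions.dimMN]

/-- The generators of the rational expressions in the dimensions. -/
def rationalGenerators : Set (Dimensions → ℝ) :=
  {fun x => (x.dimM : ℝ), fun x => x.dimN, fun x => (x.dimN)⁻¹}
    ∪ Set.range fun (i : ℕ) (x : Dimensions) => (x.dimMN + i)⁻¹

/-- The rational expressions in the dimensions and the polygamma functions of order less than `r`
of `mn` and `n`. -/
noncomputable def entropyAlgebra (r : ℕ) : Subalgebra ℚ (Dimensions → ℝ) :=
  Algebra.adjoin ℚ (rationalGenerators ∪ ((fun j x => polygamma j x.dimMN) '' Set.Iio r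
    ∪ (fun j x => polygamma j x.dimN) '' Set.Iio r))

lemma entropyAlgebra_mono : Monotone entropyAlgebra := fun _ _ h =>
  Algebra.adjoin_mono (Set.union_subset_union_right _ (Set.union_subset_union
    (Set.image_mono (Set.Iio_subset_Iio h)) (Set.image_mono (Set.Iio_subset_Iio h))))

lemma polygammaAlgebra_le (r : ℕ) : polygammaAlgebra r ≤ entropyAlgebra r :=
  Algebra.adjoin_mono (Set.union_subset_union Set.subset_union_left Set.subset_union_right)

lemma dimM_mem (r : ℕ) : (fun x : Dimensions => (x.dimM : ℝ)) ∈ entropyAlgebra r :=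
  Algebra.subset_adjoin (Or.inl (Or.inl (Or.inl rfl)))

lemma dimN_mem (r : ℕ) : (fun x : Dimensions => x.dimN) ∈ entropyAlgebra r :=
  Algebra.subset_adjoin (Or.inl (Or.inl (Or.inr (Or.inl rfl))))

lemma dimMN_mem (r : ℕ) : (fun x : Dimensions => x.dimMN) ∈ entropyAlgebra r :=
  mul_mem (dimM_mem r) (dimN_mem r)

lemma dimensionAlgebra_le (r : ℕ) : dimensionAlgebra ≤ entropyAlgebra r :=
  Algebra.adjoin_le (by
    rintro y (rfl | rfl)
    · exact dimM_mem r
    · exact dimN_mem r)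

lemma inv_dimMN_add_mem (i r : ℕ) :
    (fun x : Dimensions => (x.dimMN + i)⁻¹) ∈ entropyAlgebra r :=
  Algebra.subset_adjoin (Or.inl (Or.inr ⟨i, rfl⟩))

lemma polygamma_dimMN_mem {j r : ℕ} (h : j < r) :
    (fun x : Dimensions => polygamma j x.dimMN) ∈ entropyAlgebra r :=
  Algebra.subset_adjoin (Or.inr (Or.inl ⟨j, h, rfl⟩))

lemma polygamma_dimN_mem {j r : ℕ} (h : j < r) :
    (fun x : Dimensions => polygamma j x.dimN) ∈ entropyAlgebra r :=
  Algebra.subset_adjoin (Or.inr (Or.inr ⟨j, h, rfl⟩))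

/-- The rising factorial of `mn`. -/
noncomputable def risingMN (l : ℕ) (x : Dimensions) : ℝ := (ascPochhammer ℝ l).eval x.dimMN

lemma risingMN_succ (l : ℕ) : risingMN (l + 1) = risingMN l * fun x : Dimensions => x.dimMN + l :=
  funext fun _ => ascPochhammer_succ_eval l _

lemma risingMN_pos (l : ℕ) (x : Dimensions) : 0 < risingMN l x := ascPochhammer_pos l _ x.dimMN_pos

lemma inv_risingMN_mem (l r : ℕ) : (risingMN l)⁻¹ ∈ entropyAlgebra r := by
  induction l with
  | zero =>
    have : (risingMN 0)⁻¹ = 1 := by funext x; simp [risingMN]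
    rw [this]; exact one_mem _
  | succ l ih =>
    rw [risingMN_succ, mul_inv]
    exact mul_mem ih (inv_dimMN_add_mem l r)

/-- The normalized logarithmic moments of the trace. -/
noncomputable def traceMoment (l j : ℕ) (x : Dimensions) : ℝ :=
  gammaLog j (x.dimMN + l) / Real.Gamma x.dimMN

lemma traceMoment_succ_left (l j : ℕ) :
    traceMoment (l + 1) j = (fun x : Dimensions => x.dimMN + l) * traceMoment l j
      + (j : Dimensions → ℝ) * traceMoment l (j - 1) := by
  funext x
  have hx := x.dimMN_pos
  have h := gammaLog_add_one j (z := x.dimMN + l) (by positivity)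
  simp only [traceMoment, Pi.add_apply, Pi.mul_apply, Pi.natCast_apply]
  rw [show x.dimMN + ((l + 1 : ℕ) : ℝ) = x.dimMN + l + 1 by push_cast; ring, h]
  ring

lemma traceMoment_zero_zero : traceMoment 0 0 = 1 := by
  funext x
  have hG := (Real.Gamma_pos_of_pos x.dimMN_pos).ne'
  rw [traceMoment, Nat.cast_zero, add_zero, gammaLog_zero x.dimMN_pos, div_self hG, Pi.one_apply]

lemma traceMoment_zero_succ (l : ℕ) :
    traceMoment 0 (l + 1) = ∑ i ∈ range (l + 1), (l.choose i : Dimensions → ℝ)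
      * (fun x => polygamma i x.dimMN) * traceMoment 0 (l - i) := by
  funext x
  have h := binomial_recurrence_of_derivative
    (derivative_taylorSeries_gammaLog x.dimMN_pos) l
  rw [Finset.sum_apply]
  simp only [traceMoment, Pi.mul_apply, Pi.natCast_apply, Nat.cast_zero, add_zero]
  rw [h, sum_div]
  exact sum_congr rfl fun i _ => by ring

/-- At `l = 0` this is the moment-cumulant recurrence for `Γ' = ψ_0 Γ`. Each unit step in `l`
multiplies the leading part by `mn + l` and adds a term with fewer logarithms, which builds up the
rising factorial. -/
lemma traceMoment_mem (l j : ℕ) : traceMoment l j ∈ entropyAlgebra j ∧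
    traceMoment l (j + 1) - risingMN l * (fun x => polygamma j x.dimMN) ∈ entropyAlgebra j := by
  induction l generalizing j with
  | zero =>
    have h := mem_of_binomial_recurrence entropyAlgebra_mono traceMoment_zero_zero
      traceMoment_zero_succ (fun i => polygamma_dimMN_mem (Nat.lt_succ_self i)) j
    have h1 : risingMN 0 = 1 := by funext x; simp [risingMN]
    rwa [h1, one_mul]
  | succ l ih =>
    have hl : (fun x : Dimensions => x.dimMN + l) ∈ entropyAlgebra j :=
      add_mem (dimMN_mem j) (natCast_mem _ l)
    constructor
    · rw [traceMoment_succ_left]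
      exact add_mem (mul_mem hl (ih j).1) (mul_mem (natCast_mem _ _)
        (entropyAlgebra_mono (Nat.sub_le j 1) (ih (j - 1)).1))
    · rw [traceMoment_succ_left, risingMN_succ, Nat.add_sub_cancel]
      have := add_mem (mul_mem hl (ih j).2) (mul_mem (natCast_mem _ (j + 1)) (ih j).1)
      convert this using 1
      ring

lemma traceMoment_zero_right (l : ℕ) : traceMoment l 0 = risingMN l := by
  induction l with
  | zero => rw [traceMoment_zero_zero]; funext x; simp [risingMN]
  | succ l ih => rw [traceMoment_succ_left, risingMN_succ, ih, Nat.cast_zero, zero_mul, add_zero,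
      mul_comm]

end EntropyAlgebra

/-! ### Leading terms of the entropy moments. -/

section EntropyMoments

/-- The moments of the entropy. -/
noncomputable def entropyMoment (l : ℕ) (x : Dimensions) : ℝ :=
  ∫ y, vonNeumannEntropy y ^ l ∂(hilbertSchmidt x.dimM x.exponent)

/-- The moments of `T_1`. -/
noncomputable def statTMoment (l : ℕ) (x : Dimensions) : ℝ :=
  ∫ y : Fin x.dimM → ℝ, statT 1 y ^ l ∂(wishartLaguerre x.dimM x.exponent)

lemma statTMoment_eq (l : ℕ) :
    statTMoment l = ∑ i ∈ range (l + 1), (l.choose i : Dimensions → ℝ) * (-1) ^ i *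
      (traceMoment l (l - i) * entropyMoment i) := by
  funext x
  rw [statTMoment, integral_statT_pow x.one_le_dimM x.neg_one_lt_exponent, Finset.sum_apply]
  refine sum_congr rfl fun i _ => ?_
  rw [x.mul_exponent_add]
  rfl

lemma entropyMoment_zero : entropyMoment 0 = 1 := by
  funext x
  have := isProbabilityMeasure_hilbertSchmidt x.one_le_dimM x.neg_one_lt_exponent
  simp [entropyMoment]

lemma statTMoment_zero : statTMoment 0 = 1 := by
  rw [statTMoment_eq]
  simp [traceMoment_zero_zero, entropyMoment_zero]

/-- The leading term of the moments of the entropy. -/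
lemma entropyMoment_mem
    (hT : ∀ l, statTMoment l ∈ entropyAlgebra l)
    {ρ : ℕ → Dimensions → ℝ}
    (hT' : ∀ l, statTMoment (l + 1) - ρ (l + 1) * (fun x => polygamma l x.dimN)
      ∈ entropyAlgebra l) :
    (∀ l, entropyMoment l ∈ entropyAlgebra l) ∧
    ∀ l, entropyMoment (l + 1) - (-1) ^ l * ((fun x => polygamma l x.dimMN)
      - ρ (l + 1) * (risingMN (l + 1))⁻¹ * fun x => polygamma l x.dimN) ∈ entropyAlgebra l := by
  have hinv : ∀ l, (risingMN l)⁻¹ * risingMN l = 1 := fun l =>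
    funext fun x => inv_mul_cancel₀ (risingMN_pos l x).ne'
  have hsgn : ∀ l : ℕ, ((-1) ^ l * (-1) ^ l : Dimensions → ℝ) = 1 := fun l => by
    rw [← mul_pow]; simp
  have hneg : ∀ (l r : ℕ), ((-1) ^ l : Dimensions → ℝ) ∈ entropyAlgebra r := fun l r =>
    pow_mem (neg_mem (one_mem _)) l
  have h1 : ∀ l, entropyMoment l ∈ entropyAlgebra l := by
    intro l
    induction l using Nat.strong_induction_on with
    | _ l ih =>
      have h2 := statTMoment_eq l
      rw [sum_range_succ, Nat.sub_self, traceMoment_zero_right, Nat.choose_self, Nat.cast_one,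
        one_mul] at h2
      have h3 : ∑ i ∈ range l, (l.choose i : Dimensions → ℝ) * (-1) ^ i *
          (traceMoment l (l - i) * entropyMoment i) ∈ entropyAlgebra l := by
        refine sum_mem fun i hi => mul_mem (mul_mem (natCast_mem _ _) (hneg _ _)) (mul_mem ?_ ?_)
        · exact entropyAlgebra_mono (Nat.sub_le l i) (traceMoment_mem l (l - i)).1
        · exact entropyAlgebra_mono (mem_range.mp hi).le (ih i (mem_range.mp hi))
      -- The summand `i = l` has coefficient `(-1) ^ l (mn)_l`, invertible in the algebra, so the
      -- relation is solved for the newest entropy moment.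
      have h4 := mul_mem (mul_mem (hneg l l) (inv_risingMN_mem l l)) (sub_mem (hT l) h3)
      convert h4 using 1
      linear_combination -((-1) ^ l * (risingMN l)⁻¹) * h2
        - (-1) ^ l * (-1) ^ l * entropyMoment l * hinv l - entropyMoment l * hsgn l
  refine ⟨h1, fun l => ?_⟩
  have h2 := statTMoment_eq (l + 1)
  -- Both end terms are split off: `i = 0` carries the trace moment that yields `ψ_l(mn)`, and `i =
  -- l + 1` is the unknown. All terms in between stay in step `l`.
  rw [sum_range_succ, sum_range_succ', Nat.sub_self, traceMoment_zero_right, Nat.choose_self,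
    Nat.choose_zero_right, Nat.sub_zero, entropyMoment_zero] at h2
  simp only [Nat.cast_one, pow_zero, one_mul, mul_one] at h2
  have h3 : ∑ i ∈ range l, ((l + 1).choose (i + 1) : Dimensions → ℝ) * (-1) ^ (i + 1) *
      (traceMoment (l + 1) (l + 1 - (i + 1)) * entropyMoment (i + 1)) ∈ entropyAlgebra l := by
    refine sum_mem fun i hi => mul_mem (mul_mem (natCast_mem _ _) (hneg _ _)) (mul_mem ?_ ?_)
    · exact entropyAlgebra_mono (by omega) (traceMoment_mem (l + 1) (l + 1 - (i + 1))).1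
    · exact entropyAlgebra_mono (mem_range.mp hi) (h1 (i + 1))
  have h4 := mul_mem (mul_mem (hneg (l + 1) l) (inv_risingMN_mem (l + 1) l))
    (sub_mem (sub_mem (hT' l) h3) (traceMoment_mem (l + 1) l).2)
  convert h4 using 1
  linear_combination -((-1) ^ (l + 1) * (risingMN (l + 1))⁻¹) * h2
    - (-1) ^ (l + 1) * (-1) ^ (l + 1) * entropyMoment (l + 1) * hinv (l + 1)
    - entropyMoment (l + 1) * hsgn (l + 1)
    - (-1) ^ (l + 1) * (fun x : Dimensions => polygamma l x.dimMN) * hinv (l + 1)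

end EntropyMoments

end EntanglementEntropy

namespace EntanglementEntropy

open MeasureTheory ProbabilityTheory Finset

/-! ### From membership in an algebra to explicit polynomials. -/

section Polynomials

open MvPolynomial

/-- Each generator is a quotient whose denominator is `1`, `n` or `mn + i`, nonzero on the whole
domain, and such quotients are closed under sums and products. -/
lemma exists_polygammaExpr {r : ℕ} {f : Dimensions → ℝ} (hf : f ∈ entropyAlgebra r) :
    ∃ (P : MvPolynomial (Fin 2 ⊕ (Fin r ⊕ Fin r)) ℚ) (D : MvPolynomial (Fin 2) ℚ),
      ∀ x : Dimensions, aeval ![(x.dimM : ℝ), x.dimN] D ≠ 0 ∧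
        f x = polygammaExpr r P D x.dimM x.dimN := by
  have hinl : ∀ (x : Dimensions) (D : MvPolynomial (Fin 2) ℚ),
      aeval (Sum.elim ![(x.dimM : ℝ), x.dimN] (Sum.elim
        (fun j : Fin r => polygamma j (x.dimM * x.dimN)) (fun j : Fin r => polygamma j x.dimN)))
        (rename Sum.inl D) = aeval ![(x.dimM : ℝ), x.dimN] D := by
    intro x D
    rw [aeval_rename, Sum.elim_comp_inl]
  have hN : ∀ x : Dimensions, x.dimN ≠ 0 := fun x => by have := x.one_le_dimN; linarith
  have hMN : ∀ (x : Dimensions) (i : ℕ), (x.dimM : ℝ) * x.dimN + i ≠ 0 := fun x i => by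
    have := x.dimMN_pos
    rw [Dimensions.dimMN] at this
    positivity
  simp only [polygammaExpr]
  induction hf using Algebra.adjoin_induction with
  | mem y hy =>
    rcases hy with ((rfl | rfl | rfl) | ⟨i, rfl⟩) | ⟨j, hj, rfl⟩ | ⟨j, hj, rfl⟩
    · exact ⟨X (Sum.inl 0), 1, fun x => by simp⟩
    · exact ⟨X (Sum.inl 1), 1, fun x => by simp⟩
    · exact ⟨1, X 1, fun x => by simp [hN x]⟩
    · refine ⟨1, X 0 * X 1 + C (i : ℚ), fun x => ?_⟩
      simpa [Dimensions.dimMN] using hMN x i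
    · exact ⟨X (Sum.inr (Sum.inl ⟨j, hj⟩)), 1, fun x => by simp [Dimensions.dimMN]⟩
    · exact ⟨X (Sum.inr (Sum.inr ⟨j, hj⟩)), 1, fun x => by simp⟩
  | algebraMap q => exact ⟨C q, 1, fun x => by simp⟩
  | add f g _ _ hf hg =>
    obtain ⟨P, D, h⟩ := hf
    obtain ⟨P', D', h'⟩ := hg
    refine ⟨P * rename Sum.inl D' + P' * rename Sum.inl D, D * D', fun x => ?_⟩
    have h1 := (h x).1
    have h2 := (h' x).1
    rw [map_mul, map_add, map_mul, map_mul, hinl, hinl, Pi.add_apply, (h x).2, (h' x).2]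
    exact ⟨mul_ne_zero h1 h2, by field_simp⟩
  | mul f g _ _ hf hg =>
    obtain ⟨P, D, h⟩ := hf
    obtain ⟨P', D', h'⟩ := hg
    refine ⟨P * P', D * D', fun x => ?_⟩
    have h1 := (h x).1
    have h2 := (h' x).1
    rw [map_mul, map_mul, Pi.mul_apply, (h x).2, (h' x).2]
    exact ⟨mul_ne_zero h1 h2, by field_simp⟩

lemma exists_mvPolynomial {f : Dimensions → ℝ} (hf : f ∈ dimensionAlgebra) :
    ∃ A : MvPolynomial (Fin 2) ℚ, ∀ x : Dimensions, f x = aeval ![(x.dimM : ℝ), x.exponent] A := by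
  induction hf using Algebra.adjoin_induction with
  | mem y hy =>
    rcases hy with rfl | rfl
    · exact ⟨X 0, fun x => by simp⟩
    · exact ⟨X 1 + X 0, fun x => by simp [x.exponent_add]⟩
  | algebraMap q => exact ⟨C q, fun x => by simp⟩
  | add f g _ _ hf hg =>
    obtain ⟨A, h⟩ := hf
    obtain ⟨A', h'⟩ := hg
    exact ⟨A + A', fun x => by rw [map_add, Pi.add_apply, h, h']⟩
  | mul f g _ _ hf hg =>
    obtain ⟨A, h⟩ := hf
    obtain ⟨A', h'⟩ := hg
    exact ⟨A * A', fun x => by rw [map_mul, Pi.mul_apply, h, h']⟩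

end Polynomials

/-! ### Leading terms of the entropy cumulants. -/

section EntropyCumulants

/-- The cumulants of the entropy. -/
noncomputable def entropyCumulant (l : ℕ) (x : Dimensions) : ℝ :=
  cumulant vonNeumannEntropy (hilbertSchmidt x.dimM x.exponent) l

lemma entropyMoment_succ (l : ℕ) :
    entropyMoment (l + 1) = ∑ i ∈ range (l + 1), (l.choose i : Dimensions → ℝ)
      * entropyCumulant (i + 1) * entropyMoment (l - i) := by
  funext x
  have := isProbabilityMeasure_hilbertSchmidt x.one_le_dimM x.neg_one_lt_exponent
  rw [entropyMoment, moment_succ_eq_sum_cumulant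
    (integrable_exp_vonNeumannEntropy x.one_le_dimM x.neg_one_lt_exponent), Finset.sum_apply]
  rfl

/-- The leading term of the cumulants of the entropy. -/
lemma entropyCumulant_mem (l : ℕ) :
    entropyCumulant (l + 1) - (-1) ^ l * ((fun x => polygamma l x.dimMN)
      - (fun x => meanR (l + 1) x.dimM x.exponent) * (risingMN (l + 1))⁻¹
        * fun x => polygamma l x.dimN) ∈ entropyAlgebra l := by
  obtain ⟨θ, hθ, hR, -, hlead⟩ := exists_wishart_structure
  have hb : ∀ p, (fun x => (p.factorial : ℝ) * PowerSeries.coeff p (θ x))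
      ∈ entropyAlgebra (p + 1) := by
    intro p
    have h1 := add_mem (entropyAlgebra_mono (Nat.le_succ p) (polygammaAlgebra_le p (hlead p)))
      (mul_mem (dimensionAlgebra_le (p + 1) (hR p)) (polygamma_dimN_mem (Nat.lt_succ_self p)))
    convert h1 using 1
    funext x
    simp
  have hrec : ∀ l, statTMoment (l + 1) = ∑ i ∈ range (l + 1), (l.choose i : Dimensions → ℝ)
      * (fun x => (i.factorial : ℝ) * PowerSeries.coeff i (θ x)) * statTMoment (l - i) := by
    intro l
    funext x
    have e : θ x = PowerSeries.mk fun i =>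
        ((i.factorial : ℝ) * PowerSeries.coeff i (θ x)) / i.factorial := by
      ext i
      rw [PowerSeries.coeff_mk]
      field_simp
    have h1 := hθ x
    rw [e] at h1
    rw [Finset.sum_apply]
    exact binomial_recurrence_of_derivative (a := fun l => statTMoment l x)
      (b := fun i => (i.factorial : ℝ) * PowerSeries.coeff i (θ x)) h1 l
  have hT := mem_of_binomial_recurrence entropyAlgebra_mono statTMoment_zero hrec hb
  obtain ⟨h1, h2⟩ := entropyMoment_mem (fun l => (hT l).1)
    (ρ := fun k x => meanR k x.dimM x.exponent) (fun l => by
      have := add_mem (hT l).2 (polygammaAlgebra_le l (hlead l))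
      convert this using 1
      funext x
      simp)
  -- The difference between moment and cumulant lies in step `l`, so the leading term found for the
  -- moments carries over unchanged.
  have h3 := mem_of_binomial_recurrence' (b := fun i => entropyCumulant (i + 1))
    entropyAlgebra_mono entropyMoment_zero entropyMoment_succ h1 l
  have h4 := sub_mem (h2 l) h3
  convert h4 using 1
  ring

end EntropyCumulants

end EntanglementEntropy

open EntanglementEntropy in
theorem corollary2 :
    (∀ l : ℕ, 1 ≤ l →
      ∃ (P : MvPolynomial (Fin 2 ⊕ (Fin (l - 1) ⊕ Fin (l - 1))) ℚ) (D : MvPolynomial (Fin 2) ℚ),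
        ∀ (m : ℕ) (n : ℝ), 1 ≤ m → (m : ℝ) ≤ n →
          MvPolynomial.aeval ![(m : ℝ), n] D ≠ 0 ∧
          cumulant vonNeumannEntropy (hilbertSchmidt m (n - m)) l =
            (-1 : ℝ) ^ (l - 1) *
                (polygamma (l - 1) (m * n)
                  - meanR l m (n - m) / (ascPochhammer ℝ l).eval ((m : ℝ) * n)
                    * polygamma (l - 1) n)
              + polygammaExpr (l - 1) P D m n) ∧
    (∀ k : ℕ, 1 ≤ k →
      ∃ A Λ : MvPolynomial (Fin 2) ℚ,
        ∀ (m : ℕ) (α : ℝ), 1 ≤ m → 0 ≤ α →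
          MeasureTheory.Integrable (statR k) (wishartLaguerre m α) ∧
          MeasureTheory.Integrable (statT k) (wishartLaguerre m α) ∧
          meanR k m α = MvPolynomial.aeval ![(m : ℝ), α] A ∧
          meanT k m α =
            meanR k m α * polygamma 0 (m + α) + MvPolynomial.aeval ![(m : ℝ), α] Λ) := by
  refine ⟨fun l hl => ?_, fun k hk => ?_⟩
  · obtain ⟨l, rfl⟩ : ∃ j, l = j + 1 := ⟨l - 1, by omega⟩
    simp only [Nat.add_sub_cancel]
    obtain ⟨P, D, h⟩ := exists_polygammaExpr (entropyCumulant_mem l)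
    refine ⟨P, D, fun m n hm hn => ?_⟩
    obtain ⟨h1, h2⟩ := h ⟨(m, n), hm, hn⟩
    refine ⟨h1, ?_⟩
    rw [← sub_eq_iff_eq_add']
    simpa [div_eq_mul_inv] using! h2
  · obtain ⟨k, rfl⟩ : ∃ j, k = j + 1 := ⟨k - 1, by omega⟩
    obtain ⟨-, -, hR, hT, -⟩ := exists_wishart_structure
    obtain ⟨A, hA⟩ := exists_mvPolynomial (hR k)
    obtain ⟨Λ, hΛ⟩ := exists_mvPolynomial (hT k)
    refine ⟨A, Λ, fun m α hm hα => ?_⟩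
    have hα' : -1 < α := by linarith
    obtain ⟨π, h, hi, H⟩ := exists_isOPS_wishartMoment hα'
    refine ⟨(meanR_eq_linStat hα' H _ m).1, (meanT_eq_linStat hα' H _ m).1, ?_⟩
    have e : Dimensions.exponent ⟨(m, m + α), hm, by simpa using hα⟩ = α :=
      add_sub_cancel_left (m : ℝ) α
    have h1 := hA ⟨(m, m + α), hm, by simpa using hα⟩
    have h2 := hΛ ⟨(m, m + α), hm, by simpa using hα⟩
    rw [e] at h1 h2
    exact ⟨h1, sub_eq_iff_eq_add'.mp h2⟩
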